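/- Let $V:\mathbb{R}^3\to\mathbb{R}$ be an integrable radial function with $V\ge 0$ and $V\not\equiv 0$ (that is, $V$ does not vanish almost everywhere), and let $\widehat V(p)=\int_{\mathbb{R}^3}e^{-ip\cdot x}V(x)\,dx$, which is real-valued and radial. Assume that $\widehat V\ge 0$, $\widehat V\in C^1(\mathbb{R}^3)\cap L^1(\mathbb{R}^3)$, $\|\widehat V\|_\infty<\infty$, $\|\nabla\widehat V\|_2<\infty$ and $\|\nabla\widehat V\|_\infty<\infty$. Assume in addition that $\widehat V\in C^3(\mathbb{R}^3)$ and that all derivatives of $\widehat V$ up to third order are bounded. For real measurable functions $\gamma,\alpha$ on $\mathbb{R}^3$ and $\rho_0\in\mathbb{R}$ put $\rho=\rho_0+(2\pi)^{-3}\int_{\mathbb{R}^3}\gamma(p)\,dp$, let $$\mathcal D=\{(\gamma,\alpha,\rho_0)\;:\;\gamma\in L^1((1+p^2)dp),\ \gamma\ge 0,\ \alpha^2\le\gamma(1+\gamma)\ \text{a.e.},\ \rho_0\ge 0\},$$ and for $T\ge 0$, $\mu\in\mathbb{R}$ define on $\mathcal D$ the grand canonical Bogoliubov free energy functional $$\begin{aligned}\mathcal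 F(\gamma,\alpha,\rho_0)={}&(2\pi)^{-3}\int_{\mathbb{R}^3}p^2\gamma(p)\,dp-\mu\rho-TS(\gamma,\alpha)+\frac{\widehat V(0)}{2}\rho^2\\&+\frac12(2\pi)^{-6}\iint_{\mathbb{R}^3\times\mathbb{R}^3}\widehat V(p-q)\bigl(\alpha(p)\alpha(q)+\gamma(p)\gamma(q)\bigr)\,dp\,dq\\&+\rho_0(2\pi)^{-3}\int_{\mathbb{R}^3}\widehat V(p)\bigl(\gamma(p)+\alpha(p)\bigr)\,dp,\end{aligned}$$ where $S(\gamma,\alpha)=(2\pi)^{-3}\int_{\mathbb{R}^3}\bigl[(\beta+\tfrac12)\ln(\beta+\tfrac12)-(\beta-\tfrac12)\ln(\beta-\tfrac12)\bigr]dp$, with $\beta(p)=\sqrt{(\tfrac12+\gamma(p))^2-\alpha(p)^2}$ and $0\ln 0=0$. Then for $T=0$ and every $\mu\in\mathbb{R}$ the functional $\mathcal F$ has a minimizer on $\mathcal D$: there is $(\gamma,\alpha,\rho_0)\in\mathcal D$ with $\mathcal F(\gamma,\alpha,\rho_0)\le\mathcal F(\gamma',\alpha',\rho_0')$ for all $(\gamma',\alpha',\rho_0')\in\mathcal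 D$. -/

import Mathlib

noncomputable section

namespace Bogoliubov

open MeasureTheory

/-- Position or momentum space `ℝ³` with its Euclidean norm. -/
abbrev Space : Type := EuclideanSpace ℝ (Fin 3)

/-- `∫ e^{-i p·x} V(x) dx`, as a complex number. -/
def fourierC (V : Space → ℝ) (p : Space) : ℂ :=
  ∫ x : Space, Complex.exp (-Complex.I * ((inner ℝ p x : ℝ) : ℂ)) * ((V x : ℝ) : ℂ)

/-- The Fourier transform `V̂` as a real function. For a radial `V` (indeed for every even one)
`fourierC V` is real, see `ofReal_Vhat`, so that nothing is lost in taking the real part. -/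
def Vhat (V : Space → ℝ) (p : Space) : ℝ := (fourierC V p).re

/-- `f` depends on `|x|` only. -/
def IsRadial (f : Space → ℝ) : Prop := ∀ x y : Space, ‖x‖ = ‖y‖ → f x = f y

theorem ofReal_Vhat {V : Space → ℝ} (hV : IsRadial V) (p : Space) :
    ((Vhat V p : ℝ) : ℂ) = fourierC V p := by
  have h : (starRingEnd ℂ) (fourierC V p) = fourierC V p := by
    unfold fourierC
    rw [← integral_conj, ← integral_neg_eq_self]
    refine integral_congr_ae (Filter.Eventually.of_forall fun x => ?_)
    have hx : V (-x) = V x := hV _ _ (norm_neg x)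
    simp [← Complex.exp_conj, hx]
  exact Complex.conj_eq_iff_re.mp h

/-- The standing assumptions on the two-body potential `V` and its Fourier transform.
Integrability of `V` is what makes the integral defining `V̂` meaningful; `V ≢ 0` is meant
as a statement about functions modulo null sets. `V̂` is radial because `V` is. -/
structure IsInteraction (V : Space → ℝ) : Prop where
  integrable : Integrable V
  radial : IsRadial V
  nonneg : ∀ x, 0 ≤ V x
  ne_zero : ¬ (V =ᵐ[volume] 0)
  hat_nonneg : ∀ p, 0 ≤ Vhat V p
  hat_contDiff : ContDiff ℝ 1 (Vhat V)
  hat_integrable : Integrable (Vhat V)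
  hat_bounded : ∃ C : ℝ, ∀ p, |Vhat V p| ≤ C
  grad_memLp : MemLp (gradient (Vhat V)) 2
  grad_bounded : ∃ C : ℝ, ∀ p, ‖gradient (Vhat V) p‖ ≤ C

/-- A triple `(γ, α, ρ₀)`. -/
abbrev Triple : Type := (Space → ℝ) × (Space → ℝ) × ℝ

/-- The domain `𝒟`: `γ ∈ L¹((1+p²)dp)`, `γ ≥ 0`, `α² ≤ γ(1+γ)`, `ρ₀ ≥ 0`. The functions are
representatives of classes modulo null sets, and the pointwise constraints hold a.e. -/
def domain : Set Triple :=
  {x | match x with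
    | (γ, α, ρ₀) =>
      Integrable (fun p : Space => (1 + ‖p‖ ^ 2) * γ p) ∧
      AEStronglyMeasurable α volume ∧
      (∀ᵐ p : Space, 0 ≤ γ p) ∧
      (∀ᵐ p : Space, α p ^ 2 ≤ γ p * (1 + γ p)) ∧
      0 ≤ ρ₀}

/-- `(2π)⁻³`. -/
def c₃ : ℝ := ((2 * Real.pi) ^ 3)⁻¹

/-- `β = √((1/2 + γ)² - α²)`, for values `g` of `γ` and `a` of `α`. -/
def beta (g a : ℝ) : ℝ := Real.sqrt ((1 / 2 + g) ^ 2 - a ^ 2)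

/-- The entropy density `s(β)`, with the convention `0 ln 0 = 0`. -/
def entropyDensity (b : ℝ) : ℝ :=
  (b + 1 / 2) * Real.log (b + 1 / 2) - (b - 1 / 2) * Real.log (b - 1 / 2)

/-- The entropy `S(γ, α)`. -/
def entropy (γ α : Space → ℝ) : ℝ :=
  c₃ * ∫ p : Space, entropyDensity (beta (γ p) (α p))

/-- The total density `ρ = ρ₀ + (2π)⁻³ ∫ γ`. -/
def density (γ : Space → ℝ) (ρ₀ : ℝ) : ℝ := ρ₀ + c₃ * ∫ p : Space, γ p

/-- The Bogoliubov free energy functional at temperature `T` and chemical potential `μ`. -/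
def freeEnergy (V : Space → ℝ) (T μ : ℝ) : Triple → ℝ
  | (γ, α, ρ₀) =>
    c₃ * (∫ p : Space, ‖p‖ ^ 2 * γ p)
      - μ * density γ ρ₀
      - T * entropy γ α
      + Vhat V 0 / 2 * density γ ρ₀ ^ 2
      + 1 / 2 * c₃ ^ 2 *
          (∫ z : Space × Space, Vhat V (z.1 - z.2) * (α z.1 * α z.2 + γ z.1 * γ z.2))
      + ρ₀ * (c₃ * ∫ p : Space, Vhat V p * (γ p + α p))

end Bogoliubov

end

/-! At zero temperature and fixed ρ₀ = t the functional is convex in (γ, α): the pointwise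
constraint is convex, V̂ is positive definite because V ≥ 0, and the remaining terms are linear or
squares. Joint convexity in ρ₀ fails, and an L¹-bounded sequence γₙ may concentrate, so the question
is one of compactness.

Let I be the infimum over bounded-support pairs and t a density at which it is approached
(`IsKernel.exists_optimal_density`). At this t one minimizes with supports in a growing ball and a
small penalty ε ∫ (γ² + α²). Strong convexity gives a unique minimizer, hence rotation invariance,
and an Euler–Lagrange inequality (`IsKernel.euler_lagrange`): (γₙ(p), αₙ(p)) almost minimizes the
linear function Aₙ(p) g + Bₙ(p) a over the feasible pairs (g, a). This yields uniform L¹ and tail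
bounds (`IsApproxSeq.bounds`), so the potentials are equi-Lipschitz and Aₙ → A, Bₙ → B along a
subsequence.

If A > |B|, the almost minimizers converge to an explicit pair (`tendsto_of_abs_lt`); if 0 < A ≤
|B|, they escape to infinity (`tendsto_atTop_of_le_abs`), which Fatou's lemma forbids almost
everywhere. For t > 0, stationarity in ρ₀ and comparison with a pure condensate give A ≥ p². The
decisive point is that A > |B| at every p ≠ 0 (`IsConvSeq.abs_limB_lt_limA`): otherwise A - |B|
vanishes to second order on a sphere and the limit of γₙ has a nonintegrable singularity there.
Hence γₙ and αₙ converge in L¹ away from the origin and can concentrate only at p = 0.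

Mass concentrated at p = 0 interacts just as the condensate does. Moving it into ρ₀, with the sign
of α chosen favourably, does not raise the energy in the limit (`IsKernel.energyMin_tail_le`), so
the limit pair with the enlarged ρ₀ has energy at most I. For t = 0 a pure condensate already does
as well. A cutoff argument extends the lower bound I to the whole domain. -/

noncomputable section

namespace Bogoliubov

open MeasureTheory Filter Topology

/-! ### The interaction kernel: positivity, symmetry, regularity -/

/-- The properties of the interaction kernel `v = V̂` on which the existence proof rests;
`M` is a common bound for `v`, its Lipschitz constant and its second differences. -/
structure IsKernel (v : Space → ℝ) (M : ℝ) : Prop where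
  continuous : Continuous v
  nonneg : ∀ p, 0 ≤ v p
  le : ∀ p, v p ≤ M
  integrable : Integrable v
  radial : IsRadial v
  lipschitz : ∀ p q, |v p - v q| ≤ M * ‖p - q‖
  second_diff : ∀ p h, |v (p + h) + v (p - h) - 2 * v p| ≤ M * ‖h‖ ^ 2
  posSemidef : ∀ f : Space → ℝ, Integrable f → 0 ≤ ∫ z : Space × Space, v (z.1 - z.2) * (f z.1 * f z.2)
  pos : 0 < v 0

theorem Vhat_eq_integral_cos {V : Space → ℝ} (hV : Integrable V) (p : Space) :
    Vhat V p = ∫ x, Real.cos (inner ℝ p x) * V x := by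
  have hint : Integrable fun x : Space =>
      Complex.exp (-Complex.I * ((inner ℝ p x : ℝ) : ℂ)) * ((V x : ℝ) : ℂ) := by
    refine hV.ofReal.bdd_mul (c := 1) ?_ (ae_of_all _ fun x => ?_)
    · exact (by fun_prop : Continuous fun x : Space =>
        Complex.exp (-Complex.I * ((inner ℝ p x : ℝ) : ℂ))).aestronglyMeasurable
    · rw [Complex.norm_exp]; simp
  unfold Vhat fourierC
  have h := integral_re hint
  simp only [RCLike.re_to_complex] at h
  rw [← h]
  refine integral_congr_ae (ae_of_all _ fun x => ?_)
  simp only [Complex.re_mul_ofReal, Complex.exp_re]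
  simp

/-- The double integral is the squared modulus of the Fourier transform of f at x, by the addition
formula for the cosine. Integrated against V ≥ 0 it makes V̂ positive definite. -/
theorem integral_cos_mul_mul {f : Space → ℝ} (hf : Integrable f) (x : Space) :
    ∫ z : Space × Space, Real.cos (inner ℝ (z.1 - z.2) x) * (f z.1 * f z.2)
      = (∫ p, Real.cos (inner ℝ p x) * f p) ^ 2 + (∫ p, Real.sin (inner ℝ p x) * f p) ^ 2 := by
  have hc : Integrable fun p : Space => Real.cos (inner ℝ p x) * f p :=
    hf.bdd_mul (c := 1) (by fun_prop : Continuous fun p : Space =>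
      Real.cos (inner ℝ p x)).aestronglyMeasurable (ae_of_all _ fun p => Real.abs_cos_le_one _)
  have hs : Integrable fun p : Space => Real.sin (inner ℝ p x) * f p :=
    hf.bdd_mul (c := 1) (by fun_prop : Continuous fun p : Space =>
      Real.sin (inner ℝ p x)).aestronglyMeasurable (ae_of_all _ fun p => Real.abs_sin_le_one _)
  rw [sq, sq, ← integral_prod_mul, ← integral_prod_mul, Measure.volume_eq_prod,
    ← integral_add (hc.mul_prod hc) (hs.mul_prod hs)]
  refine integral_congr_ae (ae_of_all _ fun z => ?_)
  simp only [inner_sub_left, Real.cos_sub]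
  ring

theorem Vhat_posSemidef {V : Space → ℝ} (hV : Integrable V) (h0 : ∀ x, 0 ≤ V x)
    {f : Space → ℝ} (hf : Integrable f) :
    0 ≤ ∫ z : Space × Space, Vhat V (z.1 - z.2) * (f z.1 * f z.2) := by
  have hint : Integrable (fun w : (Space × Space) × Space =>
      Real.cos (inner ℝ (w.1.1 - w.1.2) w.2) * ((f w.1.1 * f w.1.2) * V w.2))
      ((volume.prod volume).prod volume) := by
    refine Integrable.bdd_mul (c := 1) ((hf.mul_prod hf).mul_prod hV) ?_
      (ae_of_all _ fun p => Real.abs_cos_le_one _)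
    exact (by fun_prop : Continuous fun w : (Space × Space) × Space =>
      Real.cos (inner ℝ (w.1.1 - w.1.2) w.2)).aestronglyMeasurable
  have h1 : ∫ z : Space × Space, Vhat V (z.1 - z.2) * (f z.1 * f z.2)
      = ∫ z : Space × Space, ∫ x,
        Real.cos (inner ℝ (z.1 - z.2) x) * ((f z.1 * f z.2) * V x) := by
    refine integral_congr_ae (ae_of_all _ fun z => ?_)
    simp only [Vhat_eq_integral_cos hV]
    rw [← integral_mul_const]
    refine integral_congr_ae (ae_of_all _ fun x => ?_)
    simp only
    ring
  rw [h1, Measure.volume_eq_prod, integral_integral_swap hint]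
  refine integral_nonneg fun x => ?_
  have h2 : ∫ z : Space × Space, Real.cos (inner ℝ (z.1 - z.2) x) * ((f z.1 * f z.2) * V x)
      = (∫ z : Space × Space, Real.cos (inner ℝ (z.1 - z.2) x) * (f z.1 * f z.2)) * V x := by
    rw [← integral_mul_const]
    refine integral_congr_ae (ae_of_all _ fun z => ?_)
    simp only
    ring
  rw [Measure.volume_eq_prod] at h2
  simp only [Pi.zero_apply]
  rw [h2, ← Measure.volume_eq_prod, integral_cos_mul_mul hf]
  exact mul_nonneg (by positivity) (h0 x)

/-- Two vectors of equal norm are exchanged by the reflection in the hyperplane orthogonal to their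
difference, which preserves the measure, the inner product and V. -/
theorem Vhat_radial {V : Space → ℝ} (hV : Integrable V) (hr : IsRadial V) :
    IsRadial (Vhat V) := by
  intro x y hxy
  set R := Submodule.reflection (Submodule.span ℝ {x - y})ᗮ with hR
  have hRx : R x = y := Submodule.reflection_sub hxy
  rw [Vhat_eq_integral_cos hV, Vhat_eq_integral_cos hV, ← hRx,
    ← R.measurePreserving.integral_comp R.toHomeomorph.measurableEmbedding
      (fun z => Real.cos (inner ℝ (R x) z) * V z)]
  refine integral_congr_ae (ae_of_all _ fun z => ?_)
  simp only [LinearIsometryEquiv.inner_map_map]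
  rw [hr (R z) z (R.norm_map z)]

/-- The mean value inequality is used twice: the second derivative bounds the increments of `fderiv
ℝ v`, and such an increment is the derivative of q ↦ v (q + h) - v q. -/
theorem abs_second_diff_le {v : Space → ℝ} {C : ℝ} (h2 : ContDiff ℝ 2 v)
    (hC : ∀ p, ‖iteratedFDeriv ℝ 2 v p‖ ≤ C) (p h : Space) :
    |v (p + h) + v (p - h) - 2 * v p| ≤ C * ‖h‖ ^ 2 := by
  have hd : Differentiable ℝ v := h2.differentiable (by norm_num)
  have hd' : Differentiable ℝ (fderiv ℝ v) :=
    (h2.fderiv_right (m := 1) (by norm_num)).differentiable (by norm_num)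
  have hL : ∀ x y, ‖fderiv ℝ v y - fderiv ℝ v x‖ ≤ C * ‖y - x‖ := fun x y =>
    convex_univ.norm_image_sub_le_of_norm_fderiv_le (fun x _ => hd' x)
      (fun x _ => by
        have := hC x
        rwa [← norm_iteratedFDeriv_fderiv, norm_iteratedFDeriv_one] at this)
      (Set.mem_univ x) (Set.mem_univ y)
  have hψ : ∀ q, HasFDerivAt (fun q => v (q + h) - v q) (fderiv ℝ v (q + h) - fderiv ℝ v q) q :=
    fun q => (HasFDerivAt.comp q (hd (q + h)).hasFDerivAt
      ((hasFDerivAt_id q).add_const h)).sub (hd q).hasFDerivAt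
  have := convex_univ.norm_image_sub_le_of_norm_hasFDerivWithin_le (C := C * ‖h‖)
    (fun q _ => (hψ q).hasFDerivWithinAt)
    (fun q _ => by simpa using hL q (q + h)) (Set.mem_univ (p - h)) (Set.mem_univ p)
  simp only [sub_add_cancel, sub_sub_cancel, Real.norm_eq_abs] at this
  calc _ = |v (p + h) - v p - (v p - v (p - h))| := by ring_nf
    _ ≤ _ := this
    _ = _ := by ring

theorem IsInteraction.isKernel {V : Space → ℝ} (hV : IsInteraction V)
    (h2 : ContDiff ℝ 2 (Vhat V))
    (hbdd : ∃ C : ℝ, ∀ p, ‖iteratedFDeriv ℝ 2 (Vhat V) p‖ ≤ C) :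
    ∃ M, IsKernel (Vhat V) M := by
  obtain ⟨C2, hC2⟩ := hbdd
  obtain ⟨C1, hC1⟩ := hV.grad_bounded
  obtain ⟨C0, hC0⟩ := hV.hat_bounded
  have hd : Differentiable ℝ (Vhat V) := h2.differentiable (by norm_num)
  set M := max C0 (max C1 C2)
  refine ⟨M, ⟨h2.continuous, hV.hat_nonneg, fun p => ?_, hV.hat_integrable,
    Vhat_radial hV.integrable hV.radial, fun p q => ?_, fun p h => ?_,
    fun f hf => Vhat_posSemidef hV.integrable hV.nonneg hf, ?_⟩⟩
  · exact ((le_abs_self _).trans (hC0 p)).trans (le_max_left _ _)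
  · have := convex_univ.norm_image_sub_le_of_norm_fderiv_le (f := Vhat V) (C := C1) (fun x _ => hd x)
      (fun x _ => by simpa [gradient] using hC1 x) (Set.mem_univ q) (Set.mem_univ p)
    refine this.trans (mul_le_mul_of_nonneg_right ?_ (norm_nonneg _))
    exact (le_max_left _ _).trans (le_max_right _ _)
  · refine (abs_second_diff_le h2 hC2 p h).trans (mul_le_mul_of_nonneg_right ?_ (by positivity))
    exact (le_max_right _ _).trans (le_max_right _ _)
  -- V̂(0) = ∫ V, which is positive since V ≥ 0 does not vanish almost everywhere.
  · rw [Vhat_eq_integral_cos hV.integrable]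
    simp only [inner_zero_left, Real.cos_zero, one_mul]
    refine lt_of_le_of_ne (integral_nonneg hV.nonneg) fun h => hV.ne_zero ?_
    exact (integral_eq_zero_iff_of_nonneg hV.nonneg hV.integrable).mp h.symm

/-! ### Building blocks of the energy and their bounds -/

/-- `(2π)⁻⁶ ∬ v(p-q) f(p) g(q) dp dq`. -/
def dbl (v f g : Space → ℝ) : ℝ :=
  c₃ ^ 2 * ∫ z : Space × Space, v (z.1 - z.2) * (f z.1 * g z.2)

/-- `(2π)⁻³ v * f`. -/
def pot (v f : Space → ℝ) (p : Space) : ℝ := c₃ * ∫ q, v (p - q) * f q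

/-- `(2π)⁻³ ∫ v f`. -/
def lin (v f : Space → ℝ) : ℝ := c₃ * ∫ p, v p * f p

/-- `(2π)⁻³ ∫ f`. -/
def mass (f : Space → ℝ) : ℝ := c₃ * ∫ p, f p

/-- `(2π)⁻³ ∫ p² f(p) dp`. -/
def kin (f : Space → ℝ) : ℝ := c₃ * ∫ p : Space, ‖p‖ ^ 2 * f p

/-- The zero temperature functional for integrable `γ`, `α`, with the integrals split up. -/
def energy (v : Space → ℝ) (μ : ℝ) (γ α : Space → ℝ) (t : ℝ) : ℝ :=
  kin γ - μ * (t + mass γ) + v 0 / 2 * (t + mass γ) ^ 2 + 1 / 2 * (dbl v α α + dbl v γ γ)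
    + t * (lin v γ + lin v α)

theorem c₃_pos : 0 < c₃ := by unfold c₃; positivity

section kernel

variable {v : Space → ℝ} {M : ℝ} (hv : IsKernel v M)
include hv

theorem IsKernel.M_pos : 0 < M := hv.pos.trans_le (hv.le 0)

theorem IsKernel.abs_le (p : Space) : |v p| ≤ M := by
  rw [abs_of_nonneg (hv.nonneg p)]; exact hv.le p

theorem IsKernel.neg (p : Space) : v (-p) = v p := hv.radial _ _ (norm_neg p)

theorem IsKernel.sub_comm (p q : Space) : v (p - q) = v (q - p) := by
  rw [← neg_sub, hv.neg]

theorem IsKernel.integrable_mul {f : Space → ℝ} (hf : Integrable f) :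
    Integrable fun p => v p * f p :=
  hf.bdd_mul (c := M) hv.continuous.aestronglyMeasurable (ae_of_all _ hv.abs_le)

theorem IsKernel.integrable_sub_mul {f : Space → ℝ} (hf : Integrable f) (p : Space) :
    Integrable fun q => v (p - q) * f q :=
  hf.bdd_mul (c := M) (hv.continuous.comp (by fun_prop)).aestronglyMeasurable
    (ae_of_all _ fun _ => hv.abs_le _)

theorem IsKernel.integrable_dbl {f g : Space → ℝ} (hf : Integrable f) (hg : Integrable g) :
    Integrable fun z : Space × Space => v (z.1 - z.2) * (f z.1 * g z.2) :=
  (hf.mul_prod hg).bdd_mul (c := M) (hv.continuous.comp (by fun_prop)).aestronglyMeasurable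
    (ae_of_all _ fun _ => hv.abs_le _)

theorem IsKernel.dbl_eq {f g : Space → ℝ} (hf : Integrable f) (hg : Integrable g) :
    dbl v f g = c₃ * ∫ p, f p * pot v g p := by
  have h := integral_prod _ (hv.integrable_dbl hf hg)
  unfold dbl pot
  rw [Measure.volume_eq_prod, h, sq, mul_assoc, ← integral_const_mul]
  refine congrArg (c₃ * ·) (integral_congr_ae (ae_of_all _ fun p => ?_))
  simp only
  rw [mul_left_comm, ← integral_const_mul (f p)]
  refine congrArg (c₃ * ·) (integral_congr_ae (ae_of_all _ fun q => ?_))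
  simp only
  ring

/-- This bound and the next two depend on f only through its L¹ norm, so an L¹-bounded family has
uniformly bounded, equi-Lipschitz potentials with uniformly controlled second differences. -/
theorem IsKernel.abs_pot_le {f : Space → ℝ} (hf : Integrable f) (p : Space) :
    |pot v f p| ≤ c₃ * M * ∫ q, |f q| := by
  unfold pot
  rw [abs_mul, abs_of_pos c₃_pos, mul_assoc, ← integral_const_mul]
  refine mul_le_mul_of_nonneg_left ((abs_integral_le_integral_abs).trans ?_) c₃_pos.le
  refine integral_mono (hv.integrable_sub_mul hf p).abs (hf.abs.const_mul M) fun q => ?_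
  simp only [abs_mul]
  exact mul_le_mul_of_nonneg_right (hv.abs_le _) (abs_nonneg _)

theorem IsKernel.abs_pot_sub_le {f : Space → ℝ} (hf : Integrable f) (p p' : Space) :
    |pot v f p - pot v f p'| ≤ c₃ * M * (∫ q, |f q|) * ‖p - p'‖ := by
  unfold pot
  rw [← mul_sub, ← integral_sub (hv.integrable_sub_mul hf p) (hv.integrable_sub_mul hf p'),
    abs_mul, abs_of_pos c₃_pos, mul_assoc, mul_assoc, ← integral_mul_const, ← integral_const_mul]
  refine mul_le_mul_of_nonneg_left ((abs_integral_le_integral_abs).trans ?_) c₃_pos.le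
  refine integral_mono ((hv.integrable_sub_mul hf p).sub (hv.integrable_sub_mul hf p')).abs
    ((hf.abs.mul_const _).const_mul M) fun q => ?_
  simp only [← sub_mul, abs_mul]
  have := hv.lipschitz (p - q) (p' - q)
  rw [sub_sub_sub_cancel_right] at this
  calc _ ≤ M * ‖p - p'‖ * |f q| := mul_le_mul_of_nonneg_right this (abs_nonneg _)
    _ = _ := by ring

theorem IsKernel.abs_pot_second_diff_le {f : Space → ℝ} (hf : Integrable f) (p h : Space) :
    |pot v f (p + h) + pot v f (p - h) - 2 * pot v f p| ≤ c₃ * M * (∫ q, |f q|) * ‖h‖ ^ 2 := by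
  have i1 := hv.integrable_sub_mul hf (p + h)
  have i2 := hv.integrable_sub_mul hf (p - h)
  have i3 := (hv.integrable_sub_mul hf p).const_mul 2
  have i4 : Integrable fun q => v (p + h - q) * f q + v (p - h - q) * f q := i1.add i2
  unfold pot
  rw [mul_left_comm, ← mul_add, ← mul_sub, ← integral_const_mul, ← integral_add i1 i2,
    ← integral_sub i4 i3,
    abs_mul, abs_of_pos c₃_pos, mul_assoc, mul_assoc, ← integral_mul_const, ← integral_const_mul]
  refine mul_le_mul_of_nonneg_left ((abs_integral_le_integral_abs).trans ?_) c₃_pos.le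
  refine integral_mono (i4.sub i3).abs
    ((hf.abs.mul_const _).const_mul M) fun q => ?_
  have := hv.second_diff (p - q) h
  rw [sub_add_eq_add_sub, sub_right_comm] at this
  calc _ = |v (p + h - q) + v (p - h - q) - 2 * v (p - q)| * |f q| := by
        rw [← abs_mul]; congr 1; ring
    _ ≤ M * ‖h‖ ^ 2 * |f q| := mul_le_mul_of_nonneg_right this (abs_nonneg _)
    _ = _ := by ring

theorem IsKernel.pot_continuous {f : Space → ℝ} (hf : Integrable f) : Continuous (pot v f) := by
  have h0 : 0 ≤ c₃ * M * ∫ q, |f q| :=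
    mul_nonneg (mul_pos c₃_pos hv.M_pos).le (integral_nonneg fun _ => abs_nonneg _)
  refine (LipschitzWith.of_dist_le_mul (K := ⟨_, h0⟩) fun p p' => ?_).continuous
  rw [Real.dist_eq, dist_eq_norm]
  exact hv.abs_pot_sub_le hf p p'

theorem IsKernel.abs_dbl_le {f g : Space → ℝ} (hf : Integrable f) (hg : Integrable g) :
    |dbl v f g| ≤ c₃ ^ 2 * M * ((∫ q, |f q|) * ∫ q, |g q|) := by
  unfold dbl
  rw [abs_mul, abs_of_pos (pow_pos c₃_pos 2), mul_assoc, ← integral_prod_mul,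
    ← integral_const_mul, Measure.volume_eq_prod]
  refine mul_le_mul_of_nonneg_left ((abs_integral_le_integral_abs).trans ?_)
    (pow_pos c₃_pos 2).le
  refine integral_mono (hv.integrable_dbl hf hg).abs ((hf.abs.mul_prod hg.abs).const_mul M)
    fun q => ?_
  simp only [abs_mul]
  exact mul_le_mul_of_nonneg_right (hv.abs_le _) (by positivity)

theorem IsKernel.dbl_self_nonneg {f : Space → ℝ} (hf : Integrable f) : 0 ≤ dbl v f f :=
  mul_nonneg (pow_pos c₃_pos 2).le (hv.posSemidef f hf)

theorem IsKernel.dbl_comm (f g : Space → ℝ) : dbl v f g = dbl v g f := by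
  unfold dbl
  rw [Measure.volume_eq_prod, ← integral_prod_swap]
  congr 2
  ext z
  simp only [Prod.fst_swap, Prod.snd_swap]
  rw [hv.sub_comm]
  ring

theorem IsKernel.dbl_line {f g : Space → ℝ} (hf : Integrable f) (hg : Integrable g) (s : ℝ) :
    dbl v (fun p => f p + s * g p) (fun p => f p + s * g p)
      = dbl v f f + 2 * s * dbl v f g + s ^ 2 * dbl v g g := by
  have h : dbl v (fun p => f p + s * g p) (fun p => f p + s * g p)
      = dbl v f f + s * dbl v f g + s * dbl v g f + s ^ 2 * dbl v g g := by
    unfold dbl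
    have i1 := hv.integrable_dbl hf hf
    have i2 := (hv.integrable_dbl hf hg).const_mul s
    have i3 := (hv.integrable_dbl hg hf).const_mul s
    have i4 := (hv.integrable_dbl hg hg).const_mul (s ^ 2)
    have e : ∀ z : Space × Space, v (z.1 - z.2) * ((f z.1 + s * g z.1) * (f z.2 + s * g z.2))
      = v (z.1 - z.2) * (f z.1 * f z.2) + s * (v (z.1 - z.2) * (f z.1 * g z.2))
        + s * (v (z.1 - z.2) * (g z.1 * f z.2)) + s ^ 2 * (v (z.1 - z.2) * (g z.1 * g z.2)) :=
      fun z => by ring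
    simp only [e]
    rw [integral_add _ i4, integral_add _ i3, integral_add i1 i2, integral_const_mul,
      integral_const_mul, integral_const_mul]
    · ring
    · exact i1.add i2
    · exact (i1.add i2).add i3
  rw [h, hv.dbl_comm g f]
  ring

theorem IsKernel.lin_line {f g : Space → ℝ} (hf : Integrable f) (hg : Integrable g) (s : ℝ) :
    lin v (fun p => f p + s * g p) = lin v f + s * lin v g := by
  unfold lin
  have e : ∀ p, v p * (f p + s * g p) = v p * f p + s * (v p * g p) := fun p => by ring
  simp only [e]
  rw [integral_add (hv.integrable_mul hf) ((hv.integrable_mul hg).const_mul s),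
    integral_const_mul]
  ring

theorem IsKernel.abs_lin_le {f : Space → ℝ} (hf : Integrable f) :
    |lin v f| ≤ c₃ * M * ∫ q, |f q| := by
  have : lin v f = pot v f 0 := by
    unfold lin pot
    simp only [zero_sub, hv.neg]
  rw [this]
  exact hv.abs_pot_le hf 0

theorem IsKernel.pot_nonneg {f : Space → ℝ} (hf : ∀ᵐ p, 0 ≤ f p) (p : Space) :
    0 ≤ pot v f p :=
  mul_nonneg c₃_pos.le (integral_nonneg_of_ae (hf.mono fun _ hq => mul_nonneg (hv.nonneg _) hq))

theorem IsKernel.pot_comp {f : Space → ℝ} (R : Space ≃ₗᵢ[ℝ] Space) (p : Space) :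
    pot v (f ∘ R) p = pot v f (R p) := by
  unfold pot
  rw [← R.measurePreserving.integral_comp R.toHomeomorph.measurableEmbedding
    (fun q => v (R p - q) * f q)]
  congr 2
  ext q
  rw [← map_sub, hv.radial (R (p - q)) (p - q) (R.norm_map _), Function.comp_apply]

theorem IsKernel.dbl_comp {f g : Space → ℝ} (R : Space ≃ₗᵢ[ℝ] Space) :
    dbl v (f ∘ R) (g ∘ R) = dbl v f g := by
  unfold dbl
  have hR := R.measurePreserving.prod R.measurePreserving
  rw [Measure.volume_eq_prod, ← hR.integral_comp
    (R.toHomeomorph.prodCongr R.toHomeomorph).measurableEmbedding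
    (fun z : Space × Space => v (z.1 - z.2) * (f z.1 * g z.2))]
  congr 2
  ext z
  simp only [Prod.map, Function.comp_apply]
  rw [← map_sub, hv.radial (R (z.1 - z.2)) (z.1 - z.2) (R.norm_map _)]

theorem IsKernel.lin_comp {f : Space → ℝ} (R : Space ≃ₗᵢ[ℝ] Space) :
    lin v (f ∘ R) = lin v f := by
  unfold lin
  rw [← R.measurePreserving.integral_comp R.toHomeomorph.measurableEmbedding
    (fun q => v q * f q)]
  congr 2
  ext q
  rw [hv.radial (R q) q (R.norm_map _), Function.comp_apply]

end kernel

theorem mass_comp {f : Space → ℝ} (R : Space ≃ₗᵢ[ℝ] Space) : mass (f ∘ R) = mass f := by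
  unfold mass
  rw [← R.measurePreserving.integral_comp R.toHomeomorph.measurableEmbedding f]
  rfl

theorem kin_comp {f : Space → ℝ} (R : Space ≃ₗᵢ[ℝ] Space) : kin (f ∘ R) = kin f := by
  unfold kin
  rw [← R.measurePreserving.integral_comp R.toHomeomorph.measurableEmbedding
    (fun q => ‖q‖ ^ 2 * f q)]
  simp only [R.norm_map, Function.comp_apply]

theorem mass_line {f g : Space → ℝ} (hf : Integrable f) (hg : Integrable g) (s : ℝ) :
    mass (fun p => f p + s * g p) = mass f + s * mass g := by
  unfold mass
  rw [integral_add hf (hg.const_mul s), integral_const_mul]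
  ring

theorem kin_line {f g : Space → ℝ} (hf : Integrable fun p : Space => ‖p‖ ^ 2 * f p)
    (hg : Integrable fun p : Space => ‖p‖ ^ 2 * g p) (s : ℝ) :
    kin (fun p => f p + s * g p) = kin f + s * kin g := by
  unfold kin
  have e : ∀ p : Space, ‖p‖ ^ 2 * (f p + s * g p) = ‖p‖ ^ 2 * f p + s * (‖p‖ ^ 2 * g p) :=
    fun p => by ring
  simp only [e]
  rw [integral_add hf (hg.const_mul s), integral_const_mul]
  ring

theorem abs_mass_le (f : Space → ℝ) : |mass f| ≤ c₃ * ∫ q, |f q| := by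
  unfold mass
  rw [abs_mul, abs_of_pos c₃_pos]
  exact mul_le_mul_of_nonneg_left abs_integral_le_integral_abs c₃_pos.le

theorem mass_nonneg {f : Space → ℝ} (hf : ∀ᵐ p, 0 ≤ f p) : 0 ≤ mass f :=
  mul_nonneg c₃_pos.le (integral_nonneg_of_ae hf)

theorem kin_nonneg {f : Space → ℝ} (hf : ∀ᵐ p, 0 ≤ f p) : 0 ≤ kin f :=
  mul_nonneg c₃_pos.le (integral_nonneg_of_ae
    (hf.mono fun _ hq => mul_nonneg (sq_nonneg _) hq))

/-! ### First variation and expansion along lines -/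

/-- The derivative of the energy in `γ(p)`. -/
def coefA (v : Space → ℝ) (μ : ℝ) (γ : Space → ℝ) (t : ℝ) (p : Space) : ℝ :=
  ‖p‖ ^ 2 - μ + v 0 * (t + mass γ) + pot v γ p + t * v p

/-- The derivative of the energy in `α(p)`. -/
def coefB (v α : Space → ℝ) (t : ℝ) (p : Space) : ℝ := pot v α p + t * v p

section kernel

variable {v : Space → ℝ} {M : ℝ} (hv : IsKernel v M)
include hv

theorem IsKernel.integrable_pot_mul {f g : Space → ℝ} (hf : Integrable f) (hg : Integrable g) :
    Integrable fun p => pot v f p * g p :=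
  hg.bdd_mul (c := c₃ * M * ∫ q, |f q|) (hv.pot_continuous hf).aestronglyMeasurable
    (ae_of_all _ fun p => hv.abs_pot_le hf p)

theorem IsKernel.integrable_coefA_mul {γ δ : Space → ℝ} (hγ : Integrable γ) (hδ : Integrable δ)
    (hδ2 : Integrable fun p : Space => ‖p‖ ^ 2 * δ p) (μ t : ℝ) :
    Integrable fun p => coefA v μ γ t p * δ p := by
  have := ((hδ2.add (hδ.const_mul (v 0 * (t + mass γ) - μ))).add
    (hv.integrable_pot_mul hγ hδ)).add ((hv.integrable_mul hδ).const_mul t)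
  refine this.congr (ae_of_all _ fun p => ?_)
  simp only [Pi.add_apply, coefA]
  ring

theorem IsKernel.integrable_coefB_mul {α β : Space → ℝ} (hα : Integrable α) (hβ : Integrable β)
    (t : ℝ) : Integrable fun p => coefB v α t p * β p := by
  have := (hv.integrable_pot_mul hα hβ).add ((hv.integrable_mul hβ).const_mul t)
  refine this.congr (ae_of_all _ fun p => ?_)
  simp only [Pi.add_apply, coefB]
  ring

theorem IsKernel.integral_coefA_mul {γ δ : Space → ℝ} (hγ : Integrable γ) (hδ : Integrable δ)
    (hδ2 : Integrable fun p : Space => ‖p‖ ^ 2 * δ p) (μ t : ℝ) :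
    c₃ * ∫ p, coefA v μ γ t p * δ p
      = kin δ + (v 0 * (t + mass γ) - μ) * mass δ + dbl v γ δ + t * lin v δ := by
  rw [hv.dbl_comm, hv.dbl_eq hδ hγ]
  unfold kin mass lin
  have i1 := hδ.const_mul (v 0 * (t + mass γ) - μ)
  have i2 := hv.integrable_pot_mul hγ hδ
  have i3 := (hv.integrable_mul hδ).const_mul t
  have e : ∀ p, coefA v μ γ t p * δ p = ‖p‖ ^ 2 * δ p + (v 0 * (t + mass γ) - μ) * δ p
      + pot v γ p * δ p + t * (v p * δ p) := fun p => by unfold coefA; ring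
  simp only [e]
  rw [integral_add _ i3, integral_add _ i2, integral_add hδ2 i1, integral_const_mul,
    integral_const_mul]
  · simp only [mul_comm (δ _), mass]
    ring
  · exact hδ2.add i1
  · exact (hδ2.add i1).add i2

theorem IsKernel.integral_coefB_mul {α β : Space → ℝ} (hα : Integrable α) (hβ : Integrable β)
    (t : ℝ) : c₃ * ∫ p, coefB v α t p * β p = dbl v α β + t * lin v β := by
  rw [hv.dbl_comm, hv.dbl_eq hβ hα]
  unfold lin
  have i2 := hv.integrable_pot_mul hα hβ
  have i3 := (hv.integrable_mul hβ).const_mul t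
  have e : ∀ p, coefB v α t p * β p = pot v α p * β p + t * (v p * β p) :=
    fun p => by unfold coefB; ring
  simp only [e]
  rw [integral_add i2 i3, integral_const_mul]
  simp only [mul_comm (β _)]
  ring

/-- Exact second order expansion of the energy along a line. -/
theorem IsKernel.energy_line {γ α δ β : Space → ℝ} (hγ : Integrable γ) (hα : Integrable α)
    (hδ : Integrable δ) (hβ : Integrable β) (hγ2 : Integrable fun p : Space => ‖p‖ ^ 2 * γ p)
    (hδ2 : Integrable fun p : Space => ‖p‖ ^ 2 * δ p) (μ t s : ℝ) :
    energy v μ (fun p => γ p + s * δ p) (fun p => α p + s * β p) t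
      = energy v μ γ α t
        + s * (c₃ * ∫ p, (coefA v μ γ t p * δ p + coefB v α t p * β p))
        + s ^ 2 * (v 0 / 2 * mass δ ^ 2 + 1 / 2 * (dbl v β β + dbl v δ δ)) := by
  rw [integral_add (hv.integrable_coefA_mul hγ hδ hδ2 μ t) (hv.integrable_coefB_mul hα hβ t),
    mul_add, hv.integral_coefA_mul hγ hδ hδ2, hv.integral_coefB_mul hα hβ]
  unfold energy
  rw [kin_line hγ2 hδ2, mass_line hγ hδ, hv.dbl_line hα hβ, hv.dbl_line hγ hδ,
    hv.lin_line hγ hδ, hv.lin_line hα hβ]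
  ring

theorem IsKernel.energy_comp (μ : ℝ) (γ α : Space → ℝ) (t : ℝ) (R : Space ≃ₗᵢ[ℝ] Space) :
    energy v μ (γ ∘ R) (α ∘ R) t = energy v μ γ α t := by
  unfold energy
  rw [kin_comp, mass_comp, hv.dbl_comp, hv.dbl_comp, hv.lin_comp, hv.lin_comp]

end kernel

theorem energy_add_right (v : Space → ℝ) (μ : ℝ) (γ α : Space → ℝ) (t s : ℝ) :
    energy v μ γ α (t + s) = energy v μ γ α t
      + s * (-μ + v 0 * (t + mass γ) + (lin v γ + lin v α)) + v 0 / 2 * s ^ 2 := by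
  unfold energy; ring

/-- Splitting the integrals uses integrability of α, which membership in `domain` does not give:
where γ is small only |α| ≲ √γ is known. -/
theorem freeEnergy_eq_energy {V : Space → ℝ} {M : ℝ} (hv : IsKernel (Vhat V) M)
    {γ α : Space → ℝ} (hγ : Integrable γ) (hα : Integrable α) (μ t : ℝ) :
    freeEnergy V 0 μ (γ, α, t) = energy (Vhat V) μ γ α t := by
  simp only [freeEnergy, energy, density, dbl, lin, kin, mass]
  have e1 : ∀ z : Space × Space, Vhat V (z.1 - z.2) * (α z.1 * α z.2 + γ z.1 * γ z.2)
      = Vhat V (z.1 - z.2) * (α z.1 * α z.2) + Vhat V (z.1 - z.2) * (γ z.1 * γ z.2) :=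
    fun z => by ring
  have e2 : ∀ p, Vhat V p * (γ p + α p) = Vhat V p * γ p + Vhat V p * α p := fun p => by ring
  simp only [e1, e2]
  rw [integral_add (hv.integrable_dbl hα hα) (hv.integrable_dbl hγ hγ),
    integral_add (hv.integrable_mul hγ) (hv.integrable_mul hα)]
  ring

/-! ### The constraint set, admissible pairs and coercivity -/

/-- The pointwise constraint `0 ≤ γ`, `α² ≤ γ (1 + γ)`. -/
def Feasible (g a : ℝ) : Prop := 0 ≤ g ∧ a ^ 2 ≤ g * (1 + g)

theorem Feasible.abs_le {g a : ℝ} (h : Feasible g a) : |a| ≤ g + 1 / 2 :=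
  abs_le_of_sq_le_sq (by nlinarith [h.1, h.2]) (by linarith [h.1])

theorem feasible_zero : Feasible 0 0 := ⟨le_rfl, by norm_num⟩

theorem Feasible.neg {g a : ℝ} (h : Feasible g a) : Feasible g (-a) := ⟨h.1, by simpa using h.2⟩

/-- In the coordinates (g + 1/2, a) the constraint reads (g + 1/2)² - a² ≥ 1/4 on the positive
branch. This is the reversed Cauchy–Schwarz inequality for that hyperbolic form, and convexity of
the constraint follows from it. -/
theorem Feasible.two_mul_le {g a g' a' : ℝ} (h : Feasible g a) (h' : Feasible g' a') :
    2 * |a * a'| ≤ g + g' + 2 * (g * g') := by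
  obtain ⟨h1, h2⟩ := h
  obtain ⟨h3, h4⟩ := h'
  have : |2 * (a * a')| ≤ g + g' + 2 * (g * g') := by
    refine abs_le_of_sq_le_sq ?_ (by positivity)
    have : a ^ 2 * a' ^ 2 ≤ (g * (1 + g)) * (g' * (1 + g')) :=
      mul_le_mul h2 h4 (sq_nonneg _) (by positivity)
    nlinarith [sq_nonneg (g - g')]
  rwa [abs_mul, abs_two] at this

theorem Feasible.convex {g a g' a' s : ℝ} (h : Feasible g a) (h' : Feasible g' a') (h0 : 0 ≤ s)
    (h1 : s ≤ 1) : Feasible (g + s * (g' - g)) (a + s * (a' - a)) := by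
  have hX := (mul_le_mul_of_nonneg_left (le_abs_self (a * a')) zero_le_two).trans
    (h.two_mul_le h')
  obtain ⟨h2, h3⟩ := h
  obtain ⟨h4, h5⟩ := h'
  refine ⟨by nlinarith, ?_⟩
  have e1 := mul_le_mul_of_nonneg_left h3 (sq_nonneg (1 - s))
  have e2 := mul_le_mul_of_nonneg_left h5 (sq_nonneg s)
  have e3 := mul_le_mul_of_nonneg_left hX (mul_nonneg h0 (sub_nonneg.2 h1))
  linear_combination e1 + e2 + e3

/-- Integrable pairs of finite kinetic energy satisfying the pointwise constraint. -/
structure IsState (γ α : Space → ℝ) : Prop where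
  integrable : Integrable γ
  integrable' : Integrable α
  kin_integrable : Integrable fun p : Space => ‖p‖ ^ 2 * γ p
  feasible : ∀ᵐ p, Feasible (γ p) (α p)

/-- Square integrable pairs supported in a ball satisfying the pointwise constraint. -/
structure IsTest (R : ℝ) (γ α : Space → ℝ) : Prop where
  memLp : MemLp γ 2
  memLp' : MemLp α 2
  support : ∀ᵐ p : Space, R < ‖p‖ → γ p = 0 ∧ α p = 0
  feasible : ∀ᵐ p, Feasible (γ p) (α p)

theorem IsState.nonneg {γ α : Space → ℝ} (h : IsState γ α) : ∀ᵐ p, 0 ≤ γ p :=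
  h.feasible.mono fun _ hp => hp.1

theorem integrable_of_memLp_of_support {f : Space → ℝ} {R : ℝ} (hf : MemLp f 2)
    (hR : ∀ᵐ p : Space, R < ‖p‖ → f p = 0) : Integrable f := by
  have hB : Integrable ((Metric.closedBall (0 : Space) R).indicator fun _ => (1 : ℝ)) :=
    (integrable_indicator_iff Metric.isClosed_closedBall.measurableSet).2
      (integrableOn_const (measure_closedBall_lt_top).ne)
  refine (hB.add hf.integrable_sq).mono' hf.1 (hR.mono fun p hp => ?_)
  by_cases h : p ∈ Metric.closedBall (0 : Space) R
  · simp only [Pi.add_apply, Set.indicator_of_mem h, Real.norm_eq_abs]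
    nlinarith [abs_nonneg (f p), sq_abs (f p), sq_nonneg (|f p| - 1)]
  · rw [hp (by simpa using h)]
    simpa [Set.indicator_of_notMem h] using sq_nonneg (f p)

theorem integrable_sq_norm_mul {f : Space → ℝ} {R : ℝ} (hf : Integrable f)
    (hR : ∀ᵐ p : Space, R < ‖p‖ → f p = 0) : Integrable fun p : Space => ‖p‖ ^ 2 * f p := by
  refine (hf.abs.const_mul (R ^ 2)).mono' ?_ (hR.mono fun p hp => ?_)
  · exact (by fun_prop : Continuous fun p : Space => ‖p‖ ^ 2).aestronglyMeasurable.mul hf.1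
  · rw [norm_mul, norm_pow, norm_norm, Real.norm_eq_abs]
    by_cases h : R < ‖p‖
    · simp [hp h]
    · exact mul_le_mul_of_nonneg_right
        (pow_le_pow_left₀ (norm_nonneg _) (not_lt.1 h) 2) (abs_nonneg _)

theorem IsTest.isState {R : ℝ} {γ α : Space → ℝ} (h : IsTest R γ α) : IsState γ α := by
  have hγ := integrable_of_memLp_of_support h.memLp (h.support.mono fun p hp hR => (hp hR).1)
  exact ⟨hγ, integrable_of_memLp_of_support h.memLp' (h.support.mono fun p hp hR => (hp hR).2),
    integrable_sq_norm_mul hγ (h.support.mono fun p hp hR => (hp hR).1), h.feasible⟩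

theorem IsTest.mono {R R' : ℝ} {γ α : Space → ℝ} (h : IsTest R γ α) (hR : R ≤ R') :
    IsTest R' γ α :=
  ⟨h.memLp, h.memLp', h.support.mono fun _ hp h' => hp (hR.trans_lt h'), h.feasible⟩

theorem isTest_zero (R : ℝ) : IsTest R (fun _ => 0) (fun _ => 0) :=
  ⟨MemLp.zero, MemLp.zero, ae_of_all _ fun _ _ => ⟨rfl, rfl⟩, ae_of_all _ fun _ => feasible_zero⟩

theorem IsState.abs_le {γ α : Space → ℝ} (h : IsState γ α) : ∀ᵐ p, |α p| ≤ γ p + 1 / 2 :=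
  h.feasible.mono fun _ hp => hp.abs_le

section kernel

variable {v : Space → ℝ} {M : ℝ} (hv : IsKernel v M)
include hv

theorem IsKernel.mass_nonneg' : 0 ≤ mass v := mass_nonneg (ae_of_all _ hv.nonneg)

/-- The constraint keeps α above -(γ + 1/2), so pairing γ + α with v ≥ 0 loses at most half the mass
of v. -/
theorem IsKernel.lin_add_lin_ge {γ α : Space → ℝ} (h : IsState γ α) :
    -(1 / 2 * mass v) ≤ lin v γ + lin v α := by
  unfold lin mass
  rw [← mul_add, ← integral_add (hv.integrable_mul h.integrable) (hv.integrable_mul h.integrable'),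
    mul_left_comm, ← mul_neg, ← integral_const_mul, ← integral_neg]
  refine mul_le_mul_of_nonneg_left (integral_mono_ae (hv.integrable.const_mul _).neg
    ((hv.integrable_mul h.integrable).add (hv.integrable_mul h.integrable'))
    (h.abs_le.mono fun p hp => ?_)) c₃_pos.le
  have h1 := (_root_.abs_le.1 hp).1
  have h2 := mul_nonneg (hv.nonneg p) (by linarith : 0 ≤ γ p + α p + 1 / 2)
  simp only
  linarith

theorem IsKernel.energy_ge {γ α : Space → ℝ} (h : IsState γ α) (μ : ℝ) {t : ℝ} (ht : 0 ≤ t) :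
    kin γ + v 0 / 2 * (t + mass γ) ^ 2 - (|μ| + 1 / 2 * mass v) * (t + mass γ)
      ≤ energy v μ γ α t := by
  have h1 := hv.lin_add_lin_ge h
  have h2 := hv.dbl_self_nonneg h.integrable
  have h3 := hv.dbl_self_nonneg h.integrable'
  have h4 := mass_nonneg h.nonneg
  have h5 := hv.mass_nonneg'
  unfold energy
  have h6 : μ * (t + mass γ) ≤ |μ| * (t + mass γ) :=
    mul_le_mul_of_nonneg_right (le_abs_self _) (by positivity)
  have h7 := mul_le_mul_of_nonneg_left h1 ht
  nlinarith [mul_nonneg h5 h4]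

end kernel

theorem energy_zero (v : Space → ℝ) (μ t : ℝ) :
    energy v μ (fun _ => 0) (fun _ => 0) t = -μ * t + v 0 / 2 * t ^ 2 := by
  simp [energy, kin, mass, dbl, lin]

/-! ### Continuity in L¹, Fatou's lemma and an abstract existence principle -/

theorem tendsto_mass {f : ℕ → Space → ℝ} {g : Space → ℝ} (hf : ∀ n, Integrable (f n))
    (hg : Integrable g) (h : Tendsto (fun n => ∫ p, |f n p - g p|) atTop (𝓝 0)) :
    Tendsto (fun n => mass (f n)) atTop (𝓝 (mass g)) := by
  rw [tendsto_iff_dist_tendsto_zero]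
  refine squeeze_zero (fun _ => dist_nonneg) (fun n => ?_) (by simpa using h.const_mul c₃)
  have := abs_mass_le fun p => f n p - g p
  unfold mass at *
  rwa [Real.dist_eq, ← mul_sub, ← integral_sub (hf n) hg]

section kernel

variable {v : Space → ℝ} {M : ℝ} (hv : IsKernel v M)
include hv

theorem IsKernel.tendsto_lin {f : ℕ → Space → ℝ} {g : Space → ℝ} (hf : ∀ n, Integrable (f n))
    (hg : Integrable g) (h : Tendsto (fun n => ∫ p, |f n p - g p|) atTop (𝓝 0)) :
    Tendsto (fun n => lin v (f n)) atTop (𝓝 (lin v g)) := by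
  rw [tendsto_iff_dist_tendsto_zero]
  refine squeeze_zero (fun _ => dist_nonneg) (fun n => ?_)
    (by simpa using h.const_mul (c₃ * M))
  have h1 := hv.abs_lin_le ((hf n).sub hg)
  have h2 := hv.lin_line hg ((hf n).sub hg) 1
  simp only [Pi.sub_apply, one_mul, add_sub_cancel] at h1 h2
  have h3 : lin v (f n) - lin v g = lin v (f n - g) := by linarith
  rw [Real.dist_eq, h3]
  exact h1

theorem IsKernel.tendsto_dbl {f : ℕ → Space → ℝ} {g : Space → ℝ} (hf : ∀ n, Integrable (f n))
    (hg : Integrable g) (h : Tendsto (fun n => ∫ p, |f n p - g p|) atTop (𝓝 0)) :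
    Tendsto (fun n => dbl v (f n) (f n)) atTop (𝓝 (dbl v g g)) := by
  rw [tendsto_iff_dist_tendsto_zero]
  have hlim : Tendsto (fun n => 2 * (c₃ ^ 2 * M * ((∫ p, |g p|) * ∫ p, |f n p - g p|))
      + c₃ ^ 2 * M * ((∫ p, |f n p - g p|) * ∫ p, |f n p - g p|)) atTop (𝓝 0) := by
    have h1 := ((h.const_mul (∫ p, |g p|)).const_mul (c₃ ^ 2 * M)).const_mul 2
    have h2 := (h.mul h).const_mul (c₃ ^ 2 * M)
    simpa using h1.add h2
  refine squeeze_zero (fun _ => dist_nonneg) (fun n => ?_) hlim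
  have h0 := (hf n).sub hg
  have h1 := hv.abs_dbl_le hg h0
  have h2 := hv.abs_dbl_le h0 h0
  have h3 := hv.dbl_line hg h0 1
  simp only [Pi.sub_apply, one_mul, add_sub_cancel, one_pow, mul_one] at h1 h2 h3
  have h4 : dbl v (f n) (f n) - dbl v g g = 2 * dbl v g (f n - g) + dbl v (f n - g) (f n - g) := by
    linarith
  rw [Real.dist_eq, h4]
  refine (abs_add_le _ _).trans (add_le_add ?_ h2)
  rw [abs_mul, abs_two]
  exact mul_le_mul_of_nonneg_left h1 zero_le_two

end kernel

/-- Fatou's lemma with bounds `k n` that vary with n: besides integrability of the limit it gives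
lower semicontinuity of mass and kinetic energy. -/
theorem integrable_of_fatou {f : ℕ → Space → ℝ} {g : Space → ℝ} {k : ℕ → ℝ} {l : ℝ}
    (hf : ∀ n, Integrable (f n)) (h0 : ∀ n, ∀ᵐ p, 0 ≤ f n p)
    (hfg : ∀ᵐ p, Tendsto (fun n => f n p) atTop (𝓝 (g p)))
    (hk : ∀ n, ∫ p, f n p ≤ k n) (hl : Tendsto k atTop (𝓝 l)) :
    Integrable g ∧ ∫ p, g p ≤ l := by
  have hg0 : ∀ᵐ p, 0 ≤ g p := by
    filter_upwards [ae_all_iff.2 h0, hfg] with p h1 h2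
    exact ge_of_tendsto' h2 h1
  have hm : AEStronglyMeasurable g := aestronglyMeasurable_of_tendsto_ae _ (fun n => (hf n).1) hfg
  have hl0 : 0 ≤ l := ge_of_tendsto' hl fun n => (integral_nonneg_of_ae (h0 n)).trans (hk n)
  have key : ∫⁻ p, ENNReal.ofReal (g p) ≤ ENNReal.ofReal l := by
    have h1 : ∫⁻ p, ENNReal.ofReal (g p)
        = ∫⁻ p, liminf (fun n => ENNReal.ofReal (f n p)) atTop := by
      refine lintegral_congr_ae (hfg.mono fun p hp => ?_)
      exact ((ENNReal.continuous_ofReal.tendsto _).comp hp).liminf_eq.symm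
    have h2 := (ENNReal.continuous_ofReal.tendsto l).comp hl
    rw [h1, ← h2.liminf_eq]
    refine (lintegral_liminf_le' fun n => (hf n).1.aemeasurable.ennreal_ofReal).trans
      (liminf_le_liminf (Eventually.of_forall fun n => ?_))
    rw [← ofReal_integral_eq_lintegral_ofReal (hf n) (h0 n)]
    exact ENNReal.ofReal_le_ofReal (hk n)
  have hi : Integrable g := by
    refine ⟨hm, ?_⟩
    rw [hasFiniteIntegral_iff_ofReal hg0]
    exact key.trans_lt ENNReal.ofReal_lt_top
  refine ⟨hi, ?_⟩
  rw [← ofReal_integral_eq_lintegral_ofReal hi hg0] at key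
  exact (ENNReal.ofReal_le_ofReal_iff hl0).1 key

/-- The midpoint of two near-minimizers cannot go below the infimum, so the gain κ ‖x - y‖² forces a
minimizing sequence to be Cauchy. Lower semicontinuity along norm limits then suffices, without weak
compactness. -/
theorem exists_isMin_of_midpoint {H : Type*} [NormedAddCommGroup H] [CompleteSpace H]
    {K : Set H} (hK : K.Nonempty) {J : H → ℝ} {b κ : ℝ} (hb : ∀ x ∈ K, b ≤ J x) (hκ : 0 < κ)
    (hmid : ∀ x ∈ K, ∀ y ∈ K, ∃ m ∈ K, J m ≤ (J x + J y) / 2 - κ * ‖x - y‖ ^ 2)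
    (hlsc : ∀ (u : ℕ → H) (x : H) (l : ℝ), (∀ n, u n ∈ K) → Tendsto u atTop (𝓝 x) →
      Tendsto (fun n => J (u n)) atTop (𝓝 l) → x ∈ K ∧ J x ≤ l) :
    ∃ x ∈ K, ∀ y ∈ K, J x ≤ J y := by
  have hbd : BddBelow (J '' K) := ⟨b, by rintro _ ⟨x, hx, rfl⟩; exact hb x hx⟩
  set i := sInf (J '' K) with hi
  have hle : ∀ x ∈ K, i ≤ J x := fun x hx => csInf_le hbd ⟨x, hx, rfl⟩
  have hex : ∀ n : ℕ, ∃ x ∈ K, J x < i + 1 / ((n : ℝ) + 1) := fun n => by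
    obtain ⟨_, ⟨x, hx, rfl⟩, h⟩ := exists_lt_of_csInf_lt (hK.image J)
      (lt_add_of_pos_right i (Nat.one_div_pos_of_nat (α := ℝ) (n := n)))
    exact ⟨x, hx, h⟩
  choose u huK hu using hex
  have hJ : Tendsto (fun n => J (u n)) atTop (𝓝 i) := by
    refine tendsto_of_tendsto_of_tendsto_of_le_of_le tendsto_const_nhds
      (g := fun _ => i) (h := fun n : ℕ => i + 1 / ((n : ℝ) + 1)) ?_ (fun n => hle _ (huK n))
      (fun n => (hu n).le)
    simpa using tendsto_one_div_add_atTop_nhds_zero_nat.const_add i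
  have hC : CauchySeq u := by
    rw [Metric.cauchySeq_iff']
    intro e he
    obtain ⟨N, hN⟩ := exists_nat_one_div_lt (mul_pos hκ (pow_pos he 2))
    refine ⟨N, fun n hn => ?_⟩
    obtain ⟨m, hm, hmJ⟩ := hmid _ (huK n) _ (huK N)
    have h1 := hle m hm
    have h2 : 1 / ((n : ℝ) + 1) ≤ 1 / ((N : ℝ) + 1) := by gcongr
    rw [dist_eq_norm]
    refine lt_of_pow_lt_pow_left₀ 2 he.le (lt_of_mul_lt_mul_left (a := κ) ?_ hκ.le)
    have := hu n
    have := hu N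
    linarith
  obtain ⟨x, hx⟩ := cauchySeq_tendsto_of_complete hC
  obtain ⟨hxK, hxJ⟩ := hlsc u x i huK hx hJ
  exact ⟨x, hxK, fun y hy => hxJ.trans (hle y hy)⟩

/-! ### The regularized functional: strong convexity, uniqueness, Euler–Lagrange inequality -/

/-- `(2π)⁻³ ∫ (γ² + α²)`. -/
def sqMass (γ α : Space → ℝ) : ℝ := c₃ * ∫ p, (γ p ^ 2 + α p ^ 2)

/-- The energy with a quadratic regularization. -/
def regEnergy (v : Space → ℝ) (μ ε : ℝ) (γ α : Space → ℝ) (t : ℝ) : ℝ :=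
  energy v μ γ α t + ε * sqMass γ α

theorem sqMass_nonneg (γ α : Space → ℝ) : 0 ≤ sqMass γ α :=
  mul_nonneg c₃_pos.le (integral_nonneg fun _ => by positivity)

theorem integrable_sq_norm_mul_sub {f g : Space → ℝ}
    (hf : Integrable fun p : Space => ‖p‖ ^ 2 * f p)
    (hg : Integrable fun p : Space => ‖p‖ ^ 2 * g p) :
    Integrable fun p : Space => ‖p‖ ^ 2 * (f p - g p) :=
  (hf.sub hg).congr (ae_of_all _ fun p => by simp only [Pi.sub_apply]; ring)

theorem sqMass_line {γ α δ β : Space → ℝ} (hγ : MemLp γ 2) (hα : MemLp α 2) (hδ : MemLp δ 2)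
    (hβ : MemLp β 2) (s : ℝ) :
    sqMass (fun p => γ p + s * δ p) (fun p => α p + s * β p)
      = sqMass γ α + s * (c₃ * ∫ p, 2 * (γ p * δ p + α p * β p)) + s ^ 2 * sqMass δ β := by
  unfold sqMass
  have i1 : Integrable fun p => γ p ^ 2 + α p ^ 2 := hγ.integrable_sq.add hα.integrable_sq
  have i2 : Integrable fun p => 2 * (γ p * δ p + α p * β p) :=
    ((hγ.integrable_mul hδ).add (hα.integrable_mul hβ)).const_mul 2
  have i3 : Integrable fun p => δ p ^ 2 + β p ^ 2 := hδ.integrable_sq.add hβ.integrable_sq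
  have e : ∀ p, (γ p + s * δ p) ^ 2 + (α p + s * β p) ^ 2 = γ p ^ 2 + α p ^ 2
      + s * (2 * (γ p * δ p + α p * β p)) + s ^ 2 * (δ p ^ 2 + β p ^ 2) := fun p => by ring
  simp only [e]
  have i4 : Integrable fun p => γ p ^ 2 + α p ^ 2 + s * (2 * (γ p * δ p + α p * β p)) :=
    i1.add (i2.const_mul s)
  rw [integral_add i4 (i3.const_mul _), integral_add i1 (i2.const_mul s),
    integral_const_mul s, integral_const_mul (s ^ 2)]
  ring

theorem energy_congr {γ α γ' α' : Space → ℝ} (hγ : γ =ᵐ[volume] γ') (hα : α =ᵐ[volume] α')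
    (v : Space → ℝ) (μ t : ℝ) : energy v μ γ α t = energy v μ γ' α' t := by
  have h1 : mass γ = mass γ' := congrArg (c₃ * ·) (integral_congr_ae hγ)
  have h2 : kin γ = kin γ' := congrArg (c₃ * ·)
    (integral_congr_ae (hγ.mono fun p hp => by simp only [hp]))
  have h3 : ∀ {f g : Space → ℝ}, f =ᵐ[volume] g → lin v f = lin v g := fun h =>
    congrArg (c₃ * ·) (integral_congr_ae (h.mono fun p hp => by simp only [hp]))
  have h4 : ∀ {f g : Space → ℝ}, f =ᵐ[volume] g → dbl v f f = dbl v g g := fun {f g} h => by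
    refine congrArg (c₃ ^ 2 * ·) (integral_congr_ae ?_)
    have e1 : (fun z : Space × Space => f z.1) =ᵐ[volume.prod volume] fun z => g z.1 :=
      Measure.quasiMeasurePreserving_fst.ae_eq_comp h
    have e2 : (fun z : Space × Space => f z.2) =ᵐ[volume.prod volume] fun z => g z.2 :=
      Measure.quasiMeasurePreserving_snd.ae_eq_comp h
    filter_upwards [e1, e2] with z h1 h2
    simp only [h1, h2]
  simp only [energy, h1, h2, h3 hγ, h3 hα, h4 hγ, h4 hα]

theorem sqMass_congr {γ α γ' α' : Space → ℝ} (hγ : γ =ᵐ[volume] γ') (hα : α =ᵐ[volume] α') :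
    sqMass γ α = sqMass γ' α' := by
  refine congrArg (c₃ * ·) (integral_congr_ae ?_)
  filter_upwards [hγ, hα] with p h1 h2
  simp only [h1, h2]

theorem regEnergy_congr {γ α γ' α' : Space → ℝ} (hγ : γ =ᵐ[volume] γ') (hα : α =ᵐ[volume] α')
    (v : Space → ℝ) (μ ε t : ℝ) : regEnergy v μ ε γ α t = regEnergy v μ ε γ' α' t := by
  simp only [regEnergy, energy_congr hγ hα, sqMass_congr hγ hα]

theorem IsTest.congr {R : ℝ} {γ α γ' α' : Space → ℝ} (h : IsTest R γ α) (hγ : γ =ᵐ[volume] γ')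
    (hα : α =ᵐ[volume] α') : IsTest R γ' α' := by
  refine ⟨h.memLp.ae_eq hγ, h.memLp'.ae_eq hα, ?_, ?_⟩
  · filter_upwards [h.support, hγ, hα] with p h1 h2 h3
    rwa [← h2, ← h3]
  · filter_upwards [h.feasible, hγ, hα] with p h1 h2 h3
    rwa [← h2, ← h3]

theorem IsTest.comp {R : ℝ} {γ α : Space → ℝ} (h : IsTest R γ α) (T : Space ≃ₗᵢ[ℝ] Space) :
    IsTest R (γ ∘ T) (α ∘ T) := by
  have hT := T.measurePreserving
  refine ⟨h.memLp.comp_measurePreserving hT, h.memLp'.comp_measurePreserving hT, ?_, ?_⟩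
  · filter_upwards [hT.quasiMeasurePreserving.ae h.support] with p hp hR
    exact hp (by rwa [T.norm_map])
  · exact hT.quasiMeasurePreserving.ae h.feasible

theorem sqMass_comp (γ α : Space → ℝ) (T : Space ≃ₗᵢ[ℝ] Space) :
    sqMass (γ ∘ T) (α ∘ T) = sqMass γ α := by
  unfold sqMass
  rw [← T.measurePreserving.integral_comp T.toHomeomorph.measurableEmbedding
    (fun q => γ q ^ 2 + α q ^ 2)]
  rfl

theorem IsTest.segment {R : ℝ} {γ α γ' α' : Space → ℝ} (h : IsTest R γ α) (h' : IsTest R γ' α')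
    {s : ℝ} (h0 : 0 ≤ s) (h1 : s ≤ 1) :
    IsTest R (fun p => γ p + s * (γ' p - γ p)) (fun p => α p + s * (α' p - α p)) := by
  refine ⟨h.memLp.add ((h'.memLp.sub h.memLp).const_mul s),
    h.memLp'.add ((h'.memLp'.sub h.memLp').const_mul s), ?_, ?_⟩
  · filter_upwards [h.support, h'.support] with p h1 h2 hR
    simp [h1 hR, h2 hR]
  · filter_upwards [h.feasible, h'.feasible] with p h2 h3
    exact h2.convex h3 h0 h1

section kernel

variable {v : Space → ℝ} {M : ℝ} (hv : IsKernel v M)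
include hv

theorem IsKernel.regEnergy_line {γ α δ β : Space → ℝ} (hγ : Integrable γ) (hα : Integrable α)
    (hδ : Integrable δ) (hβ : Integrable β) (hγ2 : Integrable fun p : Space => ‖p‖ ^ 2 * γ p)
    (hδ2 : Integrable fun p : Space => ‖p‖ ^ 2 * δ p) (lγ : MemLp γ 2) (lα : MemLp α 2)
    (lδ : MemLp δ 2) (lβ : MemLp β 2) (μ ε t s : ℝ) :
    regEnergy v μ ε (fun p => γ p + s * δ p) (fun p => α p + s * β p) t
      = regEnergy v μ ε γ α t
        + s * (c₃ * ∫ p, (coefA v μ γ t p * δ p + coefB v α t p * β p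
            + ε * (2 * (γ p * δ p + α p * β p))))
        + s ^ 2 * (v 0 / 2 * mass δ ^ 2 + 1 / 2 * (dbl v β β + dbl v δ δ) + ε * sqMass δ β) := by
  have i2 : Integrable fun p => 2 * (γ p * δ p + α p * β p) :=
    ((lγ.integrable_mul lδ).add (lα.integrable_mul lβ)).const_mul 2
  have i1 : Integrable fun p => coefA v μ γ t p * δ p + coefB v α t p * β p :=
    (hv.integrable_coefA_mul hγ hδ hδ2 μ t).add (hv.integrable_coefB_mul hα hβ t)
  unfold regEnergy
  rw [hv.energy_line hγ hα hδ hβ hγ2 hδ2, sqMass_line lγ lα lδ lβ,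
    integral_add i1 (i2.const_mul ε), integral_const_mul ε]
  ring

/-- Along the segment the functional is exactly a quadratic polynomial. The energy part of its
leading coefficient is nonnegative by positive definiteness of v; the regularization part is the
term kept on the right. -/
theorem IsKernel.regEnergy_midpoint {R : ℝ} {γ α γ' α' : Space → ℝ} (h : IsTest R γ α)
    (h' : IsTest R γ' α') (μ t : ℝ) {ε : ℝ} :
    regEnergy v μ ε (fun p => γ p + 1 / 2 * (γ' p - γ p)) (fun p => α p + 1 / 2 * (α' p - α p)) t
      ≤ (regEnergy v μ ε γ α t + regEnergy v μ ε γ' α' t) / 2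
        - ε / 4 * sqMass (fun p => γ' p - γ p) (fun p => α' p - α p) := by
  have hs := h.isState
  have hs' := h'.isState
  have j1 := hs'.integrable.sub hs.integrable
  have j2 := hs'.integrable'.sub hs.integrable'
  have j3 : Integrable fun p : Space => ‖p‖ ^ 2 * (γ' p - γ p) :=
    integrable_sq_norm_mul_sub hs'.kin_integrable hs.kin_integrable
  have e : ∀ s, _ := hv.regEnergy_line hs.integrable hs.integrable' j1 j2 hs.kin_integrable j3
    h.memLp h.memLp' (h'.memLp.sub h.memLp) (h'.memLp'.sub h.memLp') μ ε t
  have e1 := e 1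
  have e2 := e (1 / 2)
  simp only [Pi.sub_apply, one_mul, add_sub_cancel, one_pow] at e1 e2
  rw [e2]
  have h1 := hv.dbl_self_nonneg j1
  have h2 := hv.dbl_self_nonneg j2
  have h3 : 0 ≤ v 0 / 2 * mass (γ' - γ) ^ 2 :=
    mul_nonneg (by linarith [hv.pos]) (sq_nonneg _)
  change _ = _ + _ + (_ + _ + ε * sqMass (fun p => γ' p - γ p) (fun p => α' p - α p)) at e1
  change _ + _ + _ * (_ + _ + ε * sqMass (fun p => γ' p - γ p) (fun p => α' p - α p)) ≤ _
  set I := ∫ p, (coefA v μ γ t p * (γ' p - γ p) + coefB v α t p * (α' p - α p)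
            + ε * (2 * (γ p * (γ' p - γ p) + α p * (α' p - α p))))
  have e1' : regEnergy v μ ε γ' α' t = _ := e1
  rw [e1']
  linarith

/-- Minimizers of the regularized functional are unique. -/
theorem IsKernel.ae_eq_of_isMin {R μ t ε : ℝ} (hε : 0 < ε) {γ α γ' α' : Space → ℝ}
    (h : IsTest R γ α) (h' : IsTest R γ' α')
    (hmin : ∀ δ β, IsTest R δ β → regEnergy v μ ε γ α t ≤ regEnergy v μ ε δ β t)
    (heq : regEnergy v μ ε γ' α' t = regEnergy v μ ε γ α t) :
    γ' =ᵐ[volume] γ ∧ α' =ᵐ[volume] α := by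
  have h1 := hv.regEnergy_midpoint h h' μ t (ε := ε)
  have h2 := hmin _ _ (h.segment h' (s := 1 / 2) (by norm_num) (by norm_num))
  have h3 : sqMass (fun p => γ' p - γ p) (fun p => α' p - α p) = 0 := by
    refine le_antisymm ?_ (sqMass_nonneg _ _)
    rw [heq] at h1
    by_contra hc
    push Not at hc
    have := mul_pos hε hc
    linarith
  have h4 : ∫ p, ((γ' p - γ p) ^ 2 + (α' p - α p) ^ 2) = 0 :=
    (mul_eq_zero.1 h3).resolve_left c₃_pos.ne'
  have h5 : Integrable fun p => (γ' p - γ p) ^ 2 + (α' p - α p) ^ 2 :=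
    (h'.memLp.sub h.memLp).integrable_sq.add (h'.memLp'.sub h.memLp').integrable_sq
  rw [integral_eq_zero_iff_of_nonneg (fun p => by simp only [Pi.zero_apply]; positivity) h5] at h4
  constructor
  · filter_upwards [h4] with p hp
    simp only [Pi.zero_apply] at hp
    nlinarith [sq_nonneg (γ' p - γ p), sq_nonneg (α' p - α p)]
  · filter_upwards [h4] with p hp
    simp only [Pi.zero_apply] at hp
    nlinarith [sq_nonneg (γ' p - γ p), sq_nonneg (α' p - α p)]

/-- A rotated minimizer is again a minimizer, so uniqueness makes γ and α invariant almost
everywhere under each isometry. Their potentials are then radial at every point. -/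
theorem IsKernel.radial_of_isMin {R μ t ε : ℝ} (hε : 0 < ε) {γ α : Space → ℝ}
    (h : IsTest R γ α)
    (hmin : ∀ δ β, IsTest R δ β → regEnergy v μ ε γ α t ≤ regEnergy v μ ε δ β t) :
    IsRadial (pot v γ) ∧ IsRadial (pot v α) := by
  have key : ∀ T : Space ≃ₗᵢ[ℝ] Space, γ ∘ T =ᵐ[volume] γ ∧ α ∘ T =ᵐ[volume] α := fun T =>
    hv.ae_eq_of_isMin hε h (h.comp T) hmin (by
      simp only [regEnergy, hv.energy_comp, sqMass_comp])
  have key2 : ∀ f : Space → ℝ, (∀ T : Space ≃ₗᵢ[ℝ] Space, f ∘ T =ᵐ[volume] f) →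
      IsRadial (pot v f) := by
    intro f hf x y hxy
    have hRx : Submodule.reflection (Submodule.span ℝ {x - y})ᗮ x = y :=
      Submodule.reflection_sub hxy
    rw [← hRx, ← hv.pot_comp]
    refine congrArg (c₃ * ·) (integral_congr_ae ?_)
    filter_upwards [hf (Submodule.reflection (Submodule.span ℝ {x - y})ᗮ)] with p hp
    rw [hp]
  exact ⟨key2 γ fun T => (key T).1, key2 α fun T => (key T).2⟩

/-- Replacing the pair by constants (g, a) on a subset of the ball is admissible, so the directional
derivative is nonnegative for every such subset, and hence its density is nonnegative almost
everywhere. The error ε (g² + a²) involves only the competitor, so it vanishes with ε however large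
γ is. -/
theorem IsKernel.euler_lagrange {R μ t ε : ℝ} (hε : 0 < ε) {γ α : Space → ℝ}
    (h : IsTest R γ α)
    (hmin : ∀ δ β, IsTest R δ β → regEnergy v μ ε γ α t ≤ regEnergy v μ ε δ β t) :
    ∀ᵐ p : Space, ‖p‖ ≤ R → ∀ g a, Feasible g a →
      coefA v μ γ t p * γ p + coefB v α t p * α p
        ≤ coefA v μ γ t p * g + coefB v α t p * a + ε * (g ^ 2 + a ^ 2) := by
  have hs := h.isState
  set B := Metric.closedBall (0 : Space) R
  have hBm : MeasurableSet B := Metric.isClosed_closedBall.measurableSet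
  have step : ∀ g a, Feasible g a → ∀ᵐ p : Space, ‖p‖ ≤ R →
      coefA v μ γ t p * γ p + coefB v α t p * α p
        ≤ coefA v μ γ t p * g + coefB v α t p * a + ε * (g ^ 2 + a ^ 2) := by
    intro g a hga
    let φ : Space → ℝ := fun p => coefA v μ γ t p * (g - γ p) + coefB v α t p * (a - α p)
            + ε * (2 * (γ p * (g - γ p) + α p * (a - α p)))
    have hcut : ∀ S, MeasurableSet S → S ⊆ B →
        Integrable (S.indicator φ) ∧ 0 ≤ ∫ p, S.indicator φ p := by
      intro S hS hSB
      have hSf : volume S ≠ ⊤ :=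
        ((measure_mono hSB).trans_lt measure_closedBall_lt_top).ne
      let γ' : Space → ℝ := fun p => γ p + S.indicator (fun p => g - γ p) p
      let α' : Space → ℝ := fun p => α p + S.indicator (fun p => a - α p) p
      have e1 : ∀ p ∈ S, γ' p = g ∧ α' p = a := fun p hp => by
        simp [γ', α', Set.indicator_of_mem hp]
      have e2 : ∀ p ∉ S, γ' p = γ p ∧ α' p = α p := fun p hp => by
        simp [γ', α', Set.indicator_of_notMem hp]
      have l1 : ∀ {f : Space → ℝ} (b : ℝ), MemLp f 2 → MemLp (S.indicator fun p => b - f p) 2 := by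
        intro f b hf
        have : (S.indicator fun p => b - f p) = (S.indicator fun _ => b) - S.indicator f := by
          ext p
          by_cases hp : p ∈ S <;> simp [hp]
        rw [this]
        exact (memLp_indicator_const 2 hS b (Or.inr hSf)).sub (hf.indicator hS)
      have ht : IsTest R γ' α' := by
        refine ⟨h.memLp.add (l1 g h.memLp), h.memLp'.add (l1 a h.memLp'), ?_, ?_⟩
        · filter_upwards [h.support] with p hp hR
          have : p ∉ S := fun hpS => absurd (hSB hpS) (by simpa [B] using hR)
          rw [(e2 p this).1, (e2 p this).2]
          exact hp hR
        · filter_upwards [h.feasible] with p hp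
          by_cases hpS : p ∈ S
          · rw [(e1 p hpS).1, (e1 p hpS).2]; exact hga
          · rw [(e2 p hpS).1, (e2 p hpS).2]; exact hp
      have hs' := ht.isState
      have j1 := hs'.integrable.sub hs.integrable
      have j2 := hs'.integrable'.sub hs.integrable'
      have j3 : Integrable fun p : Space => ‖p‖ ^ 2 * (γ' p - γ p) :=
        integrable_sq_norm_mul_sub hs'.kin_integrable hs.kin_integrable
      have l3 := ht.memLp.sub h.memLp
      have l4 := ht.memLp'.sub h.memLp'
      have eφ : S.indicator φ = fun p => coefA v μ γ t p * (γ' p - γ p)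
          + coefB v α t p * (α' p - α p)
            + ε * (2 * (γ p * (γ' p - γ p) + α p * (α' p - α p))) := by
        ext p
        by_cases hpS : p ∈ S
        · simp only [Set.indicator_of_mem hpS, (e1 p hpS).1, (e1 p hpS).2, φ]
        · simp [Set.indicator_of_notMem hpS, (e2 p hpS).1, (e2 p hpS).2]
      have iφ : Integrable (S.indicator φ) := by
        rw [eφ]
        exact ((hv.integrable_coefA_mul hs.integrable j1 j3 μ t).add
          (hv.integrable_coefB_mul hs.integrable' j2 t)).add
          ((((h.memLp.integrable_mul l3).add (h.memLp'.integrable_mul l4)).const_mul 2).const_mul ε)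
      refine ⟨iφ, ?_⟩
      have e : ∀ s, _ := hv.regEnergy_line hs.integrable hs.integrable' j1 j2 hs.kin_integrable j3
        h.memLp h.memLp' l3 l4 μ ε t
      set Q := v 0 / 2 * mass (γ' - γ) ^ 2 + 1 / 2 * (dbl v (α' - α) (α' - α)
        + dbl v (γ' - γ) (γ' - γ)) + ε * sqMass (γ' - γ) (α' - α) with hQ
      simp only [Pi.sub_apply] at e
      rw [← eφ] at e
      set I := ∫ p, S.indicator φ p with hI
      have hIQ : ∀ s : ℝ, 0 < s → s ≤ 1 → 0 ≤ c₃ * I + s * Q := by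
        intro s h0 h1
        have h2 := hmin _ _ (h.segment ht h0.le h1)
        rw [e s] at h2
        have h3 : 0 ≤ s * (c₃ * I + s * Q) := by linarith
        exact nonneg_of_mul_nonneg_right h3 h0
      have hlim : Tendsto (fun s : ℝ => c₃ * I + s * Q) (𝓝[>] 0) (𝓝 (c₃ * I + 0 * Q)) :=
        ((continuous_const.add (continuous_id.mul continuous_const)).tendsto 0).mono_left
          nhdsWithin_le_nhds
      have h5 : 0 ≤ c₃ * I + 0 * Q := by
        refine ge_of_tendsto hlim ?_
        filter_upwards [Ioc_mem_nhdsGT (zero_lt_one (α := ℝ))] with s hs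
        exact hIQ s hs.1 hs.2
      rw [zero_mul, add_zero] at h5
      exact nonneg_of_mul_nonneg_right h5 c₃_pos
    have hpos : 0 ≤ᵐ[volume] B.indicator φ := by
      refine ae_nonneg_of_forall_setIntegral_nonneg (hcut B hBm subset_rfl).1 fun S hS _ => ?_
      have := (hcut (S ∩ B) (hS.inter hBm) Set.inter_subset_right).2
      rwa [← Set.indicator_indicator, integral_indicator hS] at this
    filter_upwards [hpos] with p hp hpR
    have hpB : p ∈ B := by simpa [B] using hpR
    rw [Set.indicator_of_mem hpB] at hp
    simp only [Pi.zero_apply, φ] at hp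
    have h1 : 2 * (γ p * (g - γ p) + α p * (a - α p)) ≤ g ^ 2 + a ^ 2 := by
      nlinarith [sq_nonneg (γ p - g), sq_nonneg (α p - a), sq_nonneg (γ p), sq_nonneg (α p)]
    have h2 := mul_le_mul_of_nonneg_left h1 hε.le
    linarith
  -- The exceptional null set depends on (g, a); a countable dense set of feasible pairs and
  -- continuity in (g, a) leave a single one.
  obtain ⟨D, hDc, hDd⟩ := TopologicalSpace.exists_countable_dense {x : ℝ × ℝ // Feasible x.1 x.2}
  have hall : ∀ᵐ p : Space, ∀ x ∈ D, ‖p‖ ≤ R →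
      coefA v μ γ t p * γ p + coefB v α t p * α p
        ≤ coefA v μ γ t p * x.1.1 + coefB v α t p * x.1.2 + ε * (x.1.1 ^ 2 + x.1.2 ^ 2) :=
    (ae_ball_iff hDc).2 fun x _ => step _ _ x.2
  filter_upwards [hall] with p hp hpR g a hga
  have hcl : IsClosed {x : {x : ℝ × ℝ // Feasible x.1 x.2} |
      coefA v μ γ t p * γ p + coefB v α t p * α p
        ≤ coefA v μ γ t p * x.1.1 + coefB v α t p * x.1.2 + ε * (x.1.1 ^ 2 + x.1.2 ^ 2)} :=
    isClosed_le continuous_const (by fun_prop)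
  have := hcl.closure_subset_iff.2 (fun x hx => hp x hx hpR) (hDd ⟨(g, a), hga⟩)
  exact this

end kernel

/-! ### Existence of regularized minimizers -/

theorem integral_abs_le_of_support {f : Space → ℝ} {R : ℝ} (hf : MemLp f 2)
    (hR : ∀ᵐ p : Space, R < ‖p‖ → f p = 0) :
    ∫ p, |f p| ≤ (volume.real (Metric.closedBall (0 : Space) R) + 1) * √(∫ p, f p ^ 2) := by
  have hi := integrable_of_memLp_of_support hf hR
  set B := Metric.closedBall (0 : Space) R
  have hBm : MeasurableSet B := Metric.isClosed_closedBall.measurableSet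
  have hBf : volume B ≠ ⊤ := (measure_closedBall_lt_top).ne
  set I := ∫ p, f p ^ 2 with hI
  have hI0 : 0 ≤ I := integral_nonneg fun _ => sq_nonneg _
  rcases hI0.eq_or_lt with h0 | h0
  · have h1 : f =ᵐ[volume] 0 := by
      have := (integral_eq_zero_iff_of_nonneg (fun p => sq_nonneg (f p)) hf.integrable_sq).1 h0.symm
      filter_upwards [this] with p hp
      simpa using hp
    have h2 : ∫ p, |f p| = 0 := by
      rw [integral_congr_ae (g := fun _ => (0 : ℝ))]
      · simp
      · filter_upwards [h1] with p hp
        simp [hp]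
    rw [h2]
    positivity
  · set s := √I
    have hs : 0 < s := Real.sqrt_pos.2 h0
    have hsI : s * s = I := Real.mul_self_sqrt hI0
    have hB : Integrable (B.indicator fun _ => s) :=
      (integrable_indicator_iff hBm).2 (integrableOn_const hBf)
    -- Pointwise |f| ≤ s + f²/s on the ball. With s the L² norm of f, both terms integrate to
    -- multiples of s.
    have h1 : ∫ p, |f p| ≤ ∫ p, (B.indicator (fun _ => s) p + s⁻¹ * f p ^ 2) := by
      refine integral_mono_ae hi.abs (hB.add (hf.integrable_sq.const_mul _)) (hR.mono fun p hp => ?_)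
      simp only
      by_cases h : p ∈ B
      · rw [Set.indicator_of_mem h, ← sq_abs (f p)]
        have : s * (s + s⁻¹ * |f p| ^ 2 - |f p|) = (s - |f p| / 2) ^ 2 + 3 / 4 * |f p| ^ 2 := by
          field_simp; ring
        have h2 : 0 ≤ s * (s + s⁻¹ * |f p| ^ 2 - |f p|) := by rw [this]; positivity
        have := nonneg_of_mul_nonneg_right h2 hs
        linarith
      · rw [hp (by simpa [B] using h)]
        simp [Set.indicator_of_notMem h]
    rw [integral_add hB (hf.integrable_sq.const_mul _), integral_const_mul,
      integral_indicator hBm, setIntegral_const, smul_eq_mul, ← hI, ← hsI] at h1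
    refine h1.trans (le_of_eq ?_)
    field_simp

theorem norm_Lp_sq (f : Lp ℝ 2 (volume : Measure Space)) : ‖f‖ ^ 2 = ∫ p, f p ^ 2 := by
  rw [← real_inner_self_eq_norm_sq, L2.inner_def]
  refine integral_congr_ae (ae_of_all _ fun p => ?_)
  simp [sq]

theorem tendsto_of_tendsto_integral_abs_Lp {R : ℝ} {u : ℕ → Lp ℝ 2 (volume : Measure Space)}
    {x : Lp ℝ 2 (volume : Measure Space)} (hu : Tendsto u atTop (𝓝 x))
    (hR : ∀ n, ∀ᵐ p : Space, R < ‖p‖ → u n p = 0) (hx : ∀ᵐ p : Space, R < ‖p‖ → x p = 0) :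
    Tendsto (fun n => ∫ p, |u n p - x p|) atTop (𝓝 0) := by
  have h1 : Tendsto (fun n => (volume.real (Metric.closedBall (0 : Space) R) + 1) * ‖u n - x‖)
      atTop (𝓝 0) := by
    simpa using (tendsto_iff_norm_sub_tendsto_zero.1 hu).const_mul
      (volume.real (Metric.closedBall (0 : Space) R) + 1)
  refine squeeze_zero (fun n => integral_nonneg fun _ => abs_nonneg _) (fun n => ?_) h1
  have h2 := integral_abs_le_of_support (R := R) ((Lp.memLp (u n)).sub (Lp.memLp x)) (by
    filter_upwards [hR n, hx] with p h1 h2 h3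
    simp [h1 h3, h2 h3])
  have h3 : √(∫ p, ((u n : Space → ℝ) - x) p ^ 2) = ‖u n - x‖ := by
    rw [← Real.sqrt_sq (norm_nonneg (u n - x)), norm_Lp_sq]
    congr 1
    refine integral_congr_ae ?_
    filter_upwards [Lp.coeFn_sub (u n) x] with p hp
    rw [hp]
  rw [h3] at h2
  exact h2

theorem exists_ae_tendsto_subseq_Lp {u : ℕ → Lp ℝ 2 (volume : Measure Space)}
    {x : Lp ℝ 2 (volume : Measure Space)} (hu : Tendsto u atTop (𝓝 x)) :
    ∃ φ : ℕ → ℕ, StrictMono φ ∧ ∀ᵐ p, Tendsto (fun n => u (φ n) p) atTop (𝓝 (x p)) := by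
  have h1 : TendstoInMeasure volume (fun n => (u n : Space → ℝ)) atTop x :=
    tendstoInMeasure_of_tendsto_Lp hu
  exact h1.exists_seq_tendsto_ae

theorem isClosed_feasible : IsClosed {x : ℝ × ℝ | Feasible x.1 x.2} :=
  (isClosed_le continuous_const continuous_fst).inter
    (isClosed_le (by fun_prop) (by fun_prop) : IsClosed {x : ℝ × ℝ | x.2 ^ 2 ≤ x.1 * (1 + x.1)})

theorem tendsto_kin_of_support {R : ℝ} {f : ℕ → Space → ℝ} {g : Space → ℝ}
    (hf : ∀ n, Integrable (f n)) (hg : Integrable g)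
    (hfR : ∀ n, ∀ᵐ p : Space, R < ‖p‖ → f n p = 0) (hgR : ∀ᵐ p : Space, R < ‖p‖ → g p = 0)
    (h : Tendsto (fun n => ∫ p, |f n p - g p|) atTop (𝓝 0)) :
    Tendsto (fun n => kin (f n)) atTop (𝓝 (kin g)) := by
  rw [tendsto_iff_dist_tendsto_zero]
  refine squeeze_zero (fun _ => dist_nonneg) (fun n => ?_)
    (by simpa using h.const_mul (c₃ * R ^ 2))
  have i1 := integrable_sq_norm_mul (hf n) (hfR n)
  have i2 := integrable_sq_norm_mul hg hgR
  unfold kin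
  rw [Real.dist_eq, ← mul_sub, ← integral_sub i1 i2, abs_mul, abs_of_pos c₃_pos, mul_assoc,
    ← integral_const_mul]
  refine mul_le_mul_of_nonneg_left (abs_integral_le_integral_abs.trans
    (integral_mono_ae (i1.sub i2).abs (((hf n).sub hg).abs.const_mul _) ?_)) c₃_pos.le
  filter_upwards [hfR n, hgR] with p h1 h2
  rw [← mul_sub, abs_mul, abs_of_nonneg (sq_nonneg ‖p‖)]
  by_cases h3 : R < ‖p‖
  · simp [h1 h3, h2 h3]
  · exact mul_le_mul_of_nonneg_right
      (pow_le_pow_left₀ (norm_nonneg _) (not_lt.1 h3) 2) (abs_nonneg _)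

section kernel

variable {v : Space → ℝ} {M : ℝ} (hv : IsKernel v M)
include hv

theorem IsKernel.energy_ge_const (μ : ℝ) : ∃ b : ℝ, ∀ γ α t, IsState γ α → 0 ≤ t →
    b ≤ energy v μ γ α t := by
  refine ⟨-((|μ| + 1 / 2 * mass v) ^ 2 / (2 * v 0)), fun γ α t h ht => ?_⟩
  have h1 := hv.energy_ge h μ ht
  have h2 := kin_nonneg h.nonneg
  have h3 := hv.pos
  set D := |μ| + 1 / 2 * mass v
  have h4 : v 0 / 2 * (t + mass γ) ^ 2 - D * (t + mass γ) + D ^ 2 / (2 * v 0)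
      = (v 0 * (t + mass γ) - D) ^ 2 / (2 * v 0) := by field_simp; ring
  have h5 : 0 ≤ (v 0 * (t + mass γ) - D) ^ 2 / (2 * v 0) := by positivity
  linarith

theorem IsKernel.exists_regEnergy_min (μ : ℝ) {t ε : ℝ} (ht : 0 ≤ t) (hε : 0 < ε) (R : ℝ) :
    ∃ γ α, IsTest R γ α ∧
      ∀ δ β, IsTest R δ β → regEnergy v μ ε γ α t ≤ regEnergy v μ ε δ β t := by
  obtain ⟨b, hb⟩ := hv.energy_ge_const μ
  let H := Lp ℝ 2 (volume : Measure Space) × Lp ℝ 2 (volume : Measure Space)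
  let K : Set H := {x | IsTest R x.1 x.2}
  let J : H → ℝ := fun x => regEnergy v μ ε x.1 x.2 t
  have toH : ∀ {δ β : Space → ℝ}, IsTest R δ β → ∃ m ∈ K, J m = regEnergy v μ ε δ β t ∧
      (m.1 =ᵐ[volume] δ) ∧ (m.2 =ᵐ[volume] β) := fun {δ β} h => by
    have e1 := h.memLp.coeFn_toLp
    have e2 := h.memLp'.coeFn_toLp
    exact ⟨(h.memLp.toLp, h.memLp'.toLp), h.congr e1.symm e2.symm,
      regEnergy_congr e1 e2 v μ ε t, e1, e2⟩
  have hsq : ∀ x : H, sqMass x.1 x.2 = c₃ * (‖x.1‖ ^ 2 + ‖x.2‖ ^ 2) := fun x => by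
    rw [norm_Lp_sq, norm_Lp_sq, ← integral_add (Lp.memLp x.1).integrable_sq
      (Lp.memLp x.2).integrable_sq]
    rfl
  have hmin : ∃ x ∈ K, ∀ y ∈ K, J x ≤ J y := by
    refine exists_isMin_of_midpoint (b := b) (κ := ε / 4 * c₃) ?_ (fun x hx => ?_)
      (by have := c₃_pos; positivity) (fun x hx y hy => ?_) (fun u x l hu hux hJ => ?_)
    · obtain ⟨m, hm, -⟩ := toH (isTest_zero R)
      exact ⟨m, hm⟩
    · exact (hb _ _ t (IsTest.isState hx) ht).trans
        (le_add_of_nonneg_right (mul_nonneg hε.le (sqMass_nonneg _ _)))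
    · obtain ⟨m, hm, hmJ, -⟩ := toH (IsTest.segment hx hy (s := 1 / 2) (by norm_num) (by norm_num))
      refine ⟨m, hm, ?_⟩
      rw [hmJ]
      refine (hv.regEnergy_midpoint hx hy μ t).trans (sub_le_sub_left ?_ _)
      have e : sqMass (fun p => y.1 p - x.1 p) (fun p => y.2 p - x.2 p)
          = c₃ * (‖(y - x).1‖ ^ 2 + ‖(y - x).2‖ ^ 2) := by
        rw [← hsq]
        exact sqMass_congr (Lp.coeFn_sub y.1 x.1).symm (Lp.coeFn_sub y.2 x.2).symm
      rw [e, mul_assoc, ← norm_neg, neg_sub]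
      refine mul_le_mul_of_nonneg_left (mul_le_mul_of_nonneg_left ?_ c₃_pos.le) (by positivity)
      -- The norm of the product space is the maximum, so its square is at most the sum of the
      -- squares.
      rcases max_choice ‖(y - x).1‖ ‖(y - x).2‖ with h | h <;>
        rw [Prod.norm_def, h] <;> nlinarith [sq_nonneg ‖(y - x).1‖, sq_nonneg ‖(y - x).2‖]
    · have hu1 : Tendsto (fun n => (u n).1) atTop (𝓝 x.1) :=
        (continuous_fst.tendsto x).comp hux
      have hu2 : Tendsto (fun n => (u n).2) atTop (𝓝 x.2) :=
        (continuous_snd.tendsto x).comp hux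
      -- Subsequences converging almost everywhere serve only to pass the support and the pointwise
      -- constraint to the limit; the functional converges along the whole sequence.
      obtain ⟨φ, hφ, hφ1⟩ := exists_ae_tendsto_subseq_Lp hu1
      obtain ⟨ψ, hψ, hψ1⟩ := exists_ae_tendsto_subseq_Lp (hu2.comp hφ.tendsto_atTop)
      have hall := ae_all_iff.2 fun n => (hu n).support
      have hall' := ae_all_iff.2 fun n => (hu n).feasible
      have hxK : IsTest R x.1 x.2 := by
        refine ⟨Lp.memLp _, Lp.memLp _, ?_, ?_⟩
        · filter_upwards [hφ1, hψ1, hall] with p h1 h2 h3 hR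
          refine ⟨tendsto_nhds_unique h1 ?_, tendsto_nhds_unique h2 ?_⟩
          · simp only [fun n => (h3 n hR).1, tendsto_const_nhds]
          · simp only [Function.comp_apply, fun n => (h3 n hR).2, tendsto_const_nhds]
        · filter_upwards [hφ1, hψ1, hall'] with p h1 h2 h3
          exact isClosed_feasible.mem_of_tendsto
            ((h1.comp hψ.tendsto_atTop).prodMk_nhds h2)
            (Eventually.of_forall fun n => h3 (φ (ψ n)))
      refine ⟨hxK, le_of_eq ?_⟩
      have s1 : ∀ n, ∀ᵐ p : Space, R < ‖p‖ → (u n).1 p = 0 :=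
        fun n => (hu n).support.mono fun p hp h => (hp h).1
      have s2 : ∀ᵐ p : Space, R < ‖p‖ → x.1 p = 0 := hxK.support.mono fun p hp h => (hp h).1
      have L1 := tendsto_of_tendsto_integral_abs_Lp hu1 s1 s2
      have L2 := tendsto_of_tendsto_integral_abs_Lp hu2
        (fun n => (hu n).support.mono fun p hp h => (hp h).2)
        (hxK.support.mono fun p hp h => (hp h).2)
      have g1 := fun n => (hu n).isState.integrable
      have g2 := fun n => (hu n).isState.integrable'
      have g3 := hxK.isState.integrable
      have g4 := hxK.isState.integrable'
      have t1 := tendsto_mass g1 g3 L1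
      have t2 := tendsto_kin_of_support g1 g3 s1 s2 L1
      have t3 := hv.tendsto_dbl g1 g3 L1
      have t4 := hv.tendsto_dbl g2 g4 L2
      have t5 := hv.tendsto_lin g1 g3 L1
      have t6 := hv.tendsto_lin g2 g4 L2
      have t7 : Tendsto (fun n => sqMass (u n).1 (u n).2) atTop (𝓝 (sqMass x.1 x.2)) := by
        simp only [hsq]
        exact ((hu1.norm.pow 2).add (hu2.norm.pow 2)).const_mul _
      have := ((((t2.sub ((t1.const_add t).const_mul μ)).add
        (((t1.const_add t).pow 2).const_mul (v 0 / 2))).add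
        ((t4.add t3).const_mul (1 / 2))).add ((t5.add t6).const_mul t)).add (t7.const_mul ε)
      exact tendsto_nhds_unique this hJ
  obtain ⟨x, hx, hxJ⟩ := hmin
  refine ⟨x.1, x.2, hx, fun δ β h => ?_⟩
  obtain ⟨m, hm, hmJ, -⟩ := toH h
  rw [← hmJ]
  exact hxJ m hm

end kernel

/-! ### Approximating sequences at an optimal condensate density -/

theorem IsState.integral_abs_eq {γ α : Space → ℝ} (h : IsState γ α) : ∫ p, |γ p| = ∫ p, γ p :=
  integral_congr_ae (h.nonneg.mono fun _ hp => abs_of_nonneg hp)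

/-- Minimizers `(γₙ, αₙ)` of regularized problems at fixed `ρ₀ = t`, approximating the value `I`. -/
structure IsApproxSeq (v : Space → ℝ) (μ t I : ℝ) (R ε : ℕ → ℝ) (γ α : ℕ → Space → ℝ) : Prop where
  test : ∀ n, IsTest (R n) (γ n) (α n)
  tendsto_R : Tendsto R atTop atTop
  eps_pos : ∀ n, 0 < ε n
  tendsto_eps : Tendsto ε atTop (𝓝 0)
  radial : ∀ n, IsRadial (pot v (γ n))
  radial' : ∀ n, IsRadial (pot v (α n))
  euler_lagrange : ∀ n, ∀ᵐ p : Space, ‖p‖ ≤ R n → ∀ g a, Feasible g a →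
      coefA v μ (γ n) t p * γ n p + coefB v (α n) t p * α n p
        ≤ coefA v μ (γ n) t p * g + coefB v (α n) t p * a + ε n * (g ^ 2 + a ^ 2)
  tendsto_energy : Tendsto (fun n => energy v μ (γ n) (α n) t) atTop (𝓝 I)

theorem IsApproxSeq.subseq {v : Space → ℝ} {μ t I : ℝ} {R ε : ℕ → ℝ} {γ α : ℕ → Space → ℝ}
    (h : IsApproxSeq v μ t I R ε γ α) {φ : ℕ → ℕ} (hφ : StrictMono φ) :
    IsApproxSeq v μ t I (fun n => R (φ n)) (fun n => ε (φ n)) (fun n => γ (φ n))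
      (fun n => α (φ n)) :=
  ⟨fun _ => h.test _, h.tendsto_R.comp hφ.tendsto_atTop, fun _ => h.eps_pos _,
    h.tendsto_eps.comp hφ.tendsto_atTop, fun _ => h.radial _, fun _ => h.radial' _,
    fun _ => h.euler_lagrange _, h.tendsto_energy.comp hφ.tendsto_atTop⟩

section kernel

variable {v : Space → ℝ} {M : ℝ} (hv : IsKernel v M)
include hv

theorem IsKernel.bounds_of_energy_le (μ E : ℝ) : ∃ C : ℝ, ∀ γ α t, IsState γ α → 0 ≤ t →
    energy v μ γ α t ≤ E → t + mass γ ≤ C ∧ kin γ ≤ C := by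
  set D := |μ| + 1 / 2 * mass v with hD
  set X := |E| + D ^ 2 / v 0 with hX
  have h3 := hv.pos
  have hX0 : 0 ≤ X := by positivity
  refine ⟨1 + 4 * X / v 0 + X, fun γ α t h ht hE => ?_⟩
  have h1 := (hv.energy_ge h μ ht).trans (hE.trans (le_abs_self E))
  rw [← hD] at h1
  have h2 := kin_nonneg h.nonneg
  set ρ := t + mass γ with hρ
  -- Half of the quadratic term absorbs the linear one by completing the square; the other half
  -- bounds ρ.
  have h4 : v 0 / 4 * ρ ^ 2 - D * ρ + D ^ 2 / v 0 = (v 0 * ρ - 2 * D) ^ 2 / (4 * v 0) := by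
    field_simp; ring
  have h5 : 0 ≤ (v 0 * ρ - 2 * D) ^ 2 / (4 * v 0) := by positivity
  have h6 : kin γ + v 0 / 4 * ρ ^ 2 ≤ X := by rw [hX]; linarith
  have h7 : 0 ≤ v 0 / 4 * ρ ^ 2 := by positivity
  have h8 : ρ ^ 2 ≤ 4 * X / v 0 := by
    rw [le_div_iff₀ h3]; linarith
  have h9 : 0 ≤ 4 * X / v 0 := by positivity
  constructor
  · nlinarith [sq_nonneg (ρ - 1)]
  · linarith

theorem IsKernel.abs_lin_add_lin_le {γ α : Space → ℝ} (h : IsState γ α) :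
    |lin v γ + lin v α| ≤ 2 * M * mass γ + 1 / 2 * mass v := by
  have i1 := hv.integrable_mul h.integrable
  have i2 := hv.integrable_mul h.integrable'
  have i3 := (h.integrable.const_mul (2 * M)).add (hv.integrable.const_mul (1 / 2))
  have e : 2 * M * mass γ + 1 / 2 * mass v = c₃ * ∫ p, (2 * M * γ p + 1 / 2 * v p) := by
    rw [integral_add (h.integrable.const_mul (2 * M)) (hv.integrable.const_mul (1 / 2)),
      integral_const_mul, integral_const_mul]
    unfold mass
    ring
  rw [e]
  unfold lin
  rw [← mul_add, ← integral_add i1 i2, abs_mul, abs_of_pos c₃_pos]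
  refine mul_le_mul_of_nonneg_left (abs_integral_le_integral_abs.trans
    (integral_mono_ae (i1.add i2).abs i3 ?_)) c₃_pos.le
  filter_upwards [h.feasible] with p hp
  have h1 := hp.1
  have h2 := hp.abs_le
  have h3 := hv.nonneg p
  have h4 := hv.le p
  rw [← mul_add, abs_mul, abs_of_nonneg h3]
  have h5 : |γ p + α p| ≤ 2 * γ p + 1 / 2 := by
    refine (abs_add_le _ _).trans ?_
    rw [abs_of_nonneg h1]; linarith
  have h6 := mul_le_mul_of_nonneg_left h5 h3
  have h7 := mul_le_mul_of_nonneg_right h4 h1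
  linarith

/-- Along a minimizing sequence the condensate densities are bounded, and shifting them to a limit
point t at fixed (γ, α) costs a vanishing amount. The infimum is thus approached at the single value
ρ₀ = t, where the problem is convex. -/
theorem IsKernel.exists_optimal_density (μ : ℝ) : ∃ I t : ℝ, 0 ≤ t ∧
    (∀ R γ α s, IsTest R γ α → 0 ≤ s → I ≤ energy v μ γ α s) ∧
    ∀ δ > 0, ∃ R γ α, IsTest R γ α ∧ energy v μ γ α t ≤ I + δ := by
  obtain ⟨b, hb⟩ := hv.energy_ge_const μ
  set S : Set ℝ := {e | ∃ R γ α s, IsTest R γ α ∧ 0 ≤ s ∧ e = energy v μ γ α s}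
  have hSb : BddBelow S := ⟨b, by rintro _ ⟨R, γ, α, s, h, hs, rfl⟩; exact hb _ _ _ h.isState hs⟩
  have hSn : S.Nonempty := ⟨_, 0, _, _, 0, isTest_zero 0, le_rfl, rfl⟩
  have hex : ∀ n : ℕ, ∃ R γ α s, IsTest R γ α ∧ 0 ≤ s ∧
      energy v μ γ α s < sInf S + 1 / ((n : ℝ) + 1) := fun n => by
    obtain ⟨_, ⟨R, γ, α, s, h, hs, rfl⟩, hlt⟩ := exists_lt_of_csInf_lt hSn
      (lt_add_of_pos_right (sInf S) (Nat.one_div_pos_of_nat (α := ℝ) (n := n)))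
    exact ⟨R, γ, α, s, h, hs, hlt⟩
  choose R γ α s ht hs hlt using hex
  obtain ⟨C, hC⟩ := hv.bounds_of_energy_le μ (sInf S + 1)
  have hbd : ∀ n, s n + mass (γ n) ≤ C := fun n => by
    refine (hC _ _ _ (ht n).isState (hs n) ((hlt n).le.trans ?_)).1
    have : 1 / ((n : ℝ) + 1) ≤ 1 := by
      rw [div_le_one (by positivity)]; linarith [(Nat.cast_nonneg n : (0 : ℝ) ≤ n)]
    linarith
  have hm := fun n => mass_nonneg (ht n).isState.nonneg
  obtain ⟨t, htC, φ, hφ, hφt⟩ := (isCompact_Icc (a := (0 : ℝ)) (b := C)).tendsto_subseq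
    (x := s) (fun n => ⟨hs n, by linarith [hbd n, hm n]⟩)
  refine ⟨sInf S, t, htC.1, fun R γ α s h hs => csInf_le hSb ⟨R, γ, α, s, h, hs, rfl⟩,
    fun δ hδ => ?_⟩
  set D := |μ| + v 0 * C + (2 * M * C + 1 / 2 * mass v)
  have hlim : Tendsto (fun n => 1 / ((φ n : ℝ) + 1) + |t - s (φ n)| * D
      + v 0 / 2 * (t - s (φ n)) ^ 2) atTop (𝓝 0) := by
    have h1 : Tendsto (fun n => t - s (φ n)) atTop (𝓝 0) := by
      simpa using hφt.const_sub t
    have h2 : Tendsto (fun n => 1 / ((φ n : ℝ) + 1)) atTop (𝓝 0) :=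
      tendsto_one_div_add_atTop_nhds_zero_nat.comp hφ.tendsto_atTop
    simpa using (h2.add (h1.abs.mul_const D)).add ((h1.pow 2).const_mul (v 0 / 2))
  obtain ⟨n, hn⟩ := (hlim.eventually (gt_mem_nhds hδ)).exists
  refine ⟨R (φ n), γ (φ n), α (φ n), ht _, ?_⟩
  have e := energy_add_right v μ (γ (φ n)) (α (φ n)) (s (φ n)) (t - s (φ n))
  rw [add_sub_cancel] at e
  rw [e]
  have h1 := hlt (φ n)
  have hb1 := hbd (φ n)
  have hm1 := hm (φ n)
  have hs1 := hs (φ n)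
  have h2 : |-μ + v 0 * (s (φ n) + mass (γ (φ n))) + (lin v (γ (φ n)) + lin v (α (φ n)))| ≤ D := by
    refine (abs_add_three _ _ _).trans (add_le_add_three (abs_neg μ).le ?_ ?_)
    · rw [abs_of_nonneg (mul_nonneg hv.pos.le (by linarith))]
      exact mul_le_mul_of_nonneg_left hb1 hv.pos.le
    · refine (hv.abs_lin_add_lin_le (ht _).isState).trans ?_
      have := mul_le_mul_of_nonneg_left (by linarith : mass (γ (φ n)) ≤ C)
        (by linarith [hv.M_pos] : 0 ≤ 2 * M)
      linarith
  have h3 : (t - s (φ n)) * (-μ + v 0 * (s (φ n) + mass (γ (φ n)))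
      + (lin v (γ (φ n)) + lin v (α (φ n)))) ≤ |t - s (φ n)| * D := by
    refine (le_abs_self _).trans ?_
    rw [abs_mul]
    exact mul_le_mul_of_nonneg_left h2 (abs_nonneg _)
  linarith

theorem IsKernel.exists_isApproxSeq (μ : ℝ) : ∃ I t : ℝ, 0 ≤ t ∧
    (∀ R γ α s, IsTest R γ α → 0 ≤ s → I ≤ energy v μ γ α s) ∧
    ∃ R ε γ α, IsApproxSeq v μ t I R ε γ α := by
  obtain ⟨I, t, ht, hI, hδ⟩ := hv.exists_optimal_density μ
  refine ⟨I, t, ht, hI, ?_⟩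
  have hex : ∀ n : ℕ, ∃ R ε γ α, (n : ℝ) ≤ R ∧ 0 < ε ∧ ε ≤ 1 / ((n : ℝ) + 1) ∧ IsTest R γ α ∧
      (∀ δ β, IsTest R δ β → regEnergy v μ ε γ α t ≤ regEnergy v μ ε δ β t) ∧
      energy v μ γ α t ≤ I + 2 * (1 / ((n : ℝ) + 1)) := fun n => by
    have hn : 0 < 1 / ((n : ℝ) + 1) := Nat.one_div_pos_of_nat
    obtain ⟨R', γ', α', h', he'⟩ := hδ _ hn
    have hS := sqMass_nonneg γ' α'
    -- For this ε the penalty of the near-minimizer (γ', α') is at most 1/(n+1). Its own excess over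
    -- I is at most as much, whence the factor 2 in the energy bound.
    set ε := 1 / ((n : ℝ) + 1) / (1 + sqMass γ' α') with hε
    have hε0 : 0 < ε := by positivity
    have hε1 : ε * (1 + sqMass γ' α') = 1 / ((n : ℝ) + 1) := by
      rw [hε]; field_simp
    obtain ⟨γ, α, h, hmin⟩ := hv.exists_regEnergy_min μ ht hε0 (max R' n)
    refine ⟨max R' n, ε, γ, α, le_max_right _ _, hε0, ?_, h, hmin, ?_⟩
    · nlinarith
    · have h1 := hmin _ _ (h'.mono (le_max_left _ _))
      have h2 := mul_nonneg hε0.le (sqMass_nonneg γ α)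
      unfold regEnergy at h1
      linarith
  choose R ε γ α hR hε0 hε h hmin he using hex
  have hlim := tendsto_one_div_add_atTop_nhds_zero_nat (𝕜 := ℝ)
  refine ⟨R, ε, γ, α, h, tendsto_atTop_mono hR tendsto_natCast_atTop_atTop, hε0,
    squeeze_zero (fun n => (hε0 n).le) hε hlim, fun n => (hv.radial_of_isMin (hε0 n) (h n) (hmin n)).1,
    fun n => (hv.radial_of_isMin (hε0 n) (h n) (hmin n)).2,
    fun n => hv.euler_lagrange (hε0 n) (h n) (hmin n), ?_⟩
  refine tendsto_of_tendsto_of_tendsto_of_le_of_le tendsto_const_nhds ?_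
    (fun n => hI _ _ _ _ (h n) ht) he
  simpa using (hlim.const_mul 2).const_add I

end kernel

/-! ### Uniform bounds and tail estimates -/

theorem Feasible.mul_abs_le {g a A B : ℝ} (h : Feasible g a) (hA : 0 < A) (hB : 2 * |B| ≤ A)
    (hle : A * g + B * a ≤ 0) : A * |a| ≤ 4 / 3 * |B| := by
  obtain ⟨h1, h2⟩ := h
  have h3 : A * g ≤ |B| * |a| := by
    have := neg_abs_le (B * a)
    rw [abs_mul] at this
    linarith
  rw [← sq_abs] at h2
  have hb := abs_nonneg B
  have ha := abs_nonneg a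
  generalize |a| = x at *
  generalize |B| = b at *
  rcases ha.eq_or_lt with h0 | h0
  · rw [← h0]; linarith
  -- Multiplying a² ≤ g + g² by A² and inserting A g ≤ |B| |a| and |B| ≤ A/2 leaves A² a² ≤ A |B|
  -- |a| + A² a² / 4, whence the factor 4/3.
  have e1 : A ^ 2 * x ^ 2 ≤ A * (A * g) + (A * g) ^ 2 := by nlinarith [sq_nonneg A]
  have e2 : A * (A * g) ≤ A * (b * x) := mul_le_mul_of_nonneg_left h3 hA.le
  have e3 : (A * g) ^ 2 ≤ (b * x) ^ 2 := pow_le_pow_left₀ (by positivity) h3 2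
  have e4 : (b * x) ^ 2 ≤ (A / 2 * x) ^ 2 := pow_le_pow_left₀ (by positivity)
    (mul_le_mul_of_nonneg_right (by linarith) ha) 2
  have e5 : (A * x) * (A * x) ≤ (A * x) * (4 / 3 * b) := by nlinarith
  exact le_of_mul_le_mul_left e5 (by positivity)

/-- Points `p` with `‖p‖ ≥ r`. -/
def tail (r : ℝ) : Set Space := {p | r ≤ ‖p‖}

theorem measurableSet_tail (r : ℝ) : MeasurableSet (tail r) :=
  (isClosed_le continuous_const continuous_norm).measurableSet

theorem compl_tail (r : ℝ) : (tail r)ᶜ = Metric.ball (0 : Space) r := by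
  ext p; simp [tail]

theorem setIntegral_tail_le {f : Space → ℝ} (h0 : ∀ᵐ p, 0 ≤ f p) (hf : Integrable f)
    (hk : Integrable fun p : Space => ‖p‖ ^ 2 * f p) {r : ℝ} (hr : 0 < r) :
    ∫ p in tail r, f p ≤ (∫ p : Space, ‖p‖ ^ 2 * f p) / r ^ 2 := by
  rw [le_div_iff₀ (by positivity), ← integral_mul_const, ← integral_indicator (measurableSet_tail r)]
  refine integral_mono_ae ((hf.mul_const _).indicator (measurableSet_tail r)) hk
    (h0.mono fun p hp => ?_)
  simp only
  by_cases h : p ∈ tail r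
  · rw [Set.indicator_of_mem h, mul_comm]
    exact mul_le_mul_of_nonneg_right (pow_le_pow_left₀ hr.le h 2) hp
  · rw [Set.indicator_of_notMem h]
    positivity

section kernel

variable {v : Space → ℝ} {M : ℝ} (hv : IsKernel v M)
include hv

theorem IsKernel.integrable_pot_and_integral_pot {f : Space → ℝ} (hf : Integrable f) :
    Integrable (pot v f) ∧ ∫ p, pot v f p = mass v * ∫ p, f p := by
  have h1 : Integrable (fun z : Space × Space => f z.2 * v (z.1 - z.2)) (volume.prod volume) :=
    hf.convolution_integrand (ContinuousLinearMap.mul ℝ ℝ) hv.integrable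
  have h2 : Integrable (fun z : Space × Space => v (z.1 - z.2) * f z.2) (volume.prod volume) :=
    h1.congr (ae_of_all _ fun z => mul_comm _ _)
  refine ⟨h2.integral_prod_left.const_mul c₃, ?_⟩
  unfold pot mass
  rw [integral_const_mul, integral_integral_swap h2, mul_assoc]
  refine congrArg (c₃ * ·) ?_
  rw [← integral_const_mul]
  refine integral_congr_ae (ae_of_all _ fun q => ?_)
  simp only
  rw [integral_mul_const, integral_sub_right_eq_self v q]

theorem IsKernel.abs_coefB_le (α : Space → ℝ) {t : ℝ} (ht : 0 ≤ t)
    (p : Space) : |coefB v α t p| ≤ pot v (fun q => |α q|) p + t * v p := by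
  unfold coefB
  refine (abs_add_le _ _).trans (add_le_add ?_ (abs_of_nonneg (mul_nonneg ht (hv.nonneg p))).le)
  unfold pot
  rw [abs_mul, abs_of_pos c₃_pos]
  refine mul_le_mul_of_nonneg_left (abs_integral_le_integral_abs.trans (le_of_eq ?_)) c₃_pos.le
  congr 1
  ext q
  rw [abs_mul, abs_of_nonneg (hv.nonneg _)]

theorem IsKernel.integral_abs_coefB_le {α : Space → ℝ} (hα : Integrable α) {t : ℝ} (ht : 0 ≤ t) :
    ∫ p, |coefB v α t p| ≤ mass v * (∫ p, |α p|) + t * ∫ p, v p := by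
  have h1 := hv.integrable_pot_and_integral_pot hα.abs
  rw [← h1.2, ← integral_const_mul, ← integral_add h1.1 (hv.integrable.const_mul t)]
  refine integral_mono_of_nonneg (ae_of_all _ fun _ => abs_nonneg _)
    (h1.1.add (hv.integrable.const_mul t)) (ae_of_all _ fun p => hv.abs_coefB_le α ht p)

theorem IsKernel.integrable_coefB {α : Space → ℝ} (hα : Integrable α) (t : ℝ) :
    Integrable (coefB v α t) :=
  (hv.integrable_pot_and_integral_pot hα).1.add (hv.integrable.const_mul t)

theorem IsKernel.pot_abs_le {γ α : Space → ℝ} (h : IsState γ α) (p : Space) :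
    pot v (fun q => |α q|) p ≤ M * mass γ + 1 / 2 * mass v := by
  have i1 := hv.integrable_sub_mul h.integrable'.abs p
  have i3 : Integrable fun q => v (p - q) := hv.integrable.comp_sub_left p
  have e : M * mass γ + 1 / 2 * mass v = c₃ * ∫ q, (M * γ q + 1 / 2 * v (p - q)) := by
    rw [integral_add (h.integrable.const_mul M) (i3.const_mul (1 / 2)),
      integral_const_mul, integral_const_mul, integral_sub_left_eq_self]
    unfold mass
    ring
  rw [e]
  refine mul_le_mul_of_nonneg_left (integral_mono_ae i1
    ((h.integrable.const_mul M).add (i3.const_mul (1 / 2))) ?_) c₃_pos.le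
  filter_upwards [h.feasible] with q hq
  have h1 := mul_le_mul_of_nonneg_left hq.abs_le (hv.nonneg (p - q))
  have h2 := mul_le_mul_of_nonneg_right (hv.le (p - q)) hq.1
  linarith

theorem IsKernel.abs_coefB_le_const {γ α : Space → ℝ} (h : IsState γ α) {t : ℝ} (ht : 0 ≤ t)
    (p : Space) : |coefB v α t p| ≤ M * (t + mass γ) + 1 / 2 * mass v := by
  have h1 := hv.abs_coefB_le α ht p
  have h2 := hv.pot_abs_le h p
  have h3 := mul_le_mul_of_nonneg_left (hv.le p) ht
  linarith

theorem IsKernel.le_coefA {γ α : Space → ℝ} (h : IsState γ α) (μ : ℝ) {t : ℝ} (ht : 0 ≤ t)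
    (p : Space) : ‖p‖ ^ 2 - μ ≤ coefA v μ γ t p := by
  have h1 := hv.pot_nonneg h.nonneg p
  have h2 := mul_nonneg ht (hv.nonneg p)
  have h3 := mul_nonneg hv.pos.le (add_nonneg ht (mass_nonneg h.nonneg))
  unfold coefA
  linarith

/-- At large momenta A ≥ r²/2 and |B| ≤ r²/4, so |α| ≤ (8/3) |B| / r², rounded up to 3.
Integrability of v bounds ∫ |B| by ∫ |α| and ∫ v; for large r the former can be absorbed, which
gives an L¹ bound on α. -/
theorem IsKernel.setIntegral_tail_abs_le {γ α : Space → ℝ} (h : IsState γ α) {μ t r : ℝ}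
    (ht : 0 ≤ t)
    (hEL : ∀ᵐ p, coefA v μ γ t p * γ p + coefB v α t p * α p ≤ 0)
    (hr : 0 < r) (hr1 : 2 * |μ| ≤ r ^ 2)
    (hr2 : 4 * (M * (t + mass γ) + 1 / 2 * mass v) ≤ r ^ 2) :
    ∫ p in tail r, |α p| ≤ 3 / r ^ 2 * (mass v * (∫ p, |α p|) + t * ∫ p, v p) := by
  have i1 := (hv.integrable_coefB h.integrable' t).abs.const_mul (3 / r ^ 2)
  have h1 : ∫ p in tail r, |α p| ≤ ∫ p, 3 / r ^ 2 * |coefB v α t p| := by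
    rw [← integral_indicator (measurableSet_tail r)]
    refine integral_mono_ae (h.integrable'.abs.indicator (measurableSet_tail r)) i1 ?_
    filter_upwards [h.feasible, hEL] with p hp hE
    by_cases hpr : p ∈ tail r
    · rw [Set.indicator_of_mem hpr]
      have hpr' : r ^ 2 ≤ ‖p‖ ^ 2 := pow_le_pow_left₀ hr.le hpr 2
      have hA := hv.le_coefA h μ ht p
      have hA' : r ^ 2 / 2 ≤ coefA v μ γ t p := by linarith [le_abs_self μ]
      have hr0 : 0 < r ^ 2 := by positivity
      have h2 := hp.mul_abs_le (by linarith) (by linarith [hv.abs_coefB_le_const h ht p]) hE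
      have h3 : r ^ 2 / 2 * |α p| ≤ 4 / 3 * |coefB v α t p| :=
        (mul_le_mul_of_nonneg_right hA' (abs_nonneg _)).trans h2
      rw [div_mul_eq_mul_div, le_div_iff₀ hr0]
      linarith [abs_nonneg (coefB v α t p)]
    · rw [Set.indicator_of_notMem hpr]
      positivity
  rw [integral_const_mul] at h1
  exact h1.trans (mul_le_mul_of_nonneg_left (hv.integral_abs_coefB_le h.integrable' ht)
    (by positivity))

end kernel

section approx

variable {v : Space → ℝ} {M μ t I : ℝ} {R ε : ℕ → ℝ} {γ α : ℕ → Space → ℝ}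

theorem IsApproxSeq.le_zero (h : IsApproxSeq v μ t I R ε γ α) (n : ℕ) :
    ∀ᵐ p, coefA v μ (γ n) t p * γ n p + coefB v (α n) t p * α n p ≤ 0 := by
  filter_upwards [h.euler_lagrange n, (h.test n).support] with p h1 h2
  rcases le_or_gt ‖p‖ (R n) with hR | hR
  · simpa using h1 hR 0 0 feasible_zero
  · simp [h2 hR]

/-- Uniform bounds along an approximating sequence. -/
theorem IsApproxSeq.bounds (h : IsApproxSeq v μ t I R ε γ α) (hv : IsKernel v M) (ht : 0 ≤ t) :
    ∃ C r₀ : ℝ, 0 < C ∧ 0 < r₀ ∧ ∀ n, t + mass (γ n) ≤ C ∧ (∫ p, |γ n p|) ≤ C ∧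
      (∫ p : Space, ‖p‖ ^ 2 * γ n p) ≤ C ∧ (∫ p, |α n p|) ≤ C ∧
      ∀ r, r₀ ≤ r → ∫ p in tail r, |γ n p| ≤ C / r ^ 2 ∧ ∫ p in tail r, |α n p| ≤ C / r ^ 2 := by
  obtain ⟨E, hE⟩ := h.tendsto_energy.bddAbove_range
  obtain ⟨C₀, hC₀⟩ := hv.bounds_of_energy_le μ E
  have hst := fun n => (h.test n).isState
  have hb := fun n => hC₀ _ _ _ (hst n) ht (hE ⟨n, rfl⟩)
  have hm := fun n => mass_nonneg (hst n).nonneg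
  have hmv := hv.mass_nonneg'
  have hc := c₃_pos
  have hvi : 0 ≤ ∫ p, v p := integral_nonneg hv.nonneg
  have hC₀0 : 0 ≤ C₀ := by linarith [(hb 0).1, hm 0]
  have hγ : ∀ n, ∫ p, |γ n p| ≤ C₀ / c₃ := fun n => by
    rw [(hst n).integral_abs_eq, le_div_iff₀ hc, mul_comm]
    exact le_trans (by linarith [(hb n).1] : mass (γ n) ≤ C₀) le_rfl
  have hk : ∀ n, ∫ p : Space, ‖p‖ ^ 2 * γ n p ≤ C₀ / c₃ := fun n => by
    rw [le_div_iff₀ hc, mul_comm]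
    exact (hb n).2
  -- X contains both thresholds of `setIntegral_tail_abs_le` and 6 `mass v`; the latter makes 3
  -- `mass v` / r² ≤ 1/2, so that ∫ |α| can be absorbed on the left.
  set X := 2 * |μ| + 4 * (M * C₀ + 1 / 2 * mass v) + 6 * mass v with hX
  have hM := hv.M_pos
  have hX0 : 0 ≤ X := by positivity
  set r₀ := 1 + X with hr₀
  have hr₀0 : 0 < r₀ := by positivity
  have hXr : ∀ r, r₀ ≤ r → X ≤ r ^ 2 := fun r hr => by nlinarith
  have htail : ∀ n r, r₀ ≤ r → ∫ p in tail r, |α n p|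
      ≤ 3 / r ^ 2 * (mass v * (∫ p, |α n p|) + t * ∫ p, v p) := fun n r hr => by
    have h1 := hXr r hr
    have h2 : M * (t + mass (γ n)) ≤ M * C₀ := mul_le_mul_of_nonneg_left (hb n).1 hM.le
    have h3 : 0 ≤ M * C₀ := by positivity
    refine hv.setIntegral_tail_abs_le (hst n) ht (h.le_zero n) (hr₀0.trans_le hr) ?_ ?_
    · linarith
    · linarith [abs_nonneg μ]
  set W := volume.real (Metric.ball (0 : Space) r₀) with hW
  set Y := 2 * (C₀ / c₃ + 1 / 2 * W + 3 / r₀ ^ 2 * (t * ∫ p, v p)) with hY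
  have hα : ∀ n, ∫ p, |α n p| ≤ Y := fun n => by
    have h1 := htail n r₀ le_rfl
    have h2 : ∫ p in (tail r₀)ᶜ, |α n p| ≤ C₀ / c₃ + 1 / 2 * W := by
      rw [compl_tail]
      have hBf : volume (Metric.ball (0 : Space) r₀) ≠ ⊤ := measure_ball_lt_top.ne
      have h3 : ∫ p in Metric.ball (0 : Space) r₀, |α n p|
          ≤ ∫ p in Metric.ball (0 : Space) r₀, (|γ n p| + 1 / 2) := by
        refine integral_mono_ae (hst n).integrable'.abs.integrableOn
          ((hst n).integrable.abs.integrableOn.add (integrableOn_const hBf)) ?_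
        exact ae_restrict_of_ae ((hst n).feasible.mono fun p hp =>
          hp.abs_le.trans (add_le_add_left (le_abs_self _) _))
      rw [integral_add (hst n).integrable.abs.integrableOn (integrableOn_const hBf),
        setIntegral_const, smul_eq_mul] at h3
      have h4 : ∫ p in Metric.ball (0 : Space) r₀, |γ n p| ≤ ∫ p, |γ n p| :=
        setIntegral_le_integral (hst n).integrable.abs (ae_of_all _ fun _ => abs_nonneg _)
      have h5 := hγ n
      linarith
    have h3 := integral_add_compl (measurableSet_tail r₀) (hst n).integrable'.abs
    have h4 : 3 / r₀ ^ 2 * (mass v * ∫ p, |α n p|) ≤ 1 / 2 * ∫ p, |α n p| := by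
      rw [← mul_assoc]
      refine mul_le_mul_of_nonneg_right ?_ (integral_nonneg fun _ => abs_nonneg _)
      rw [div_mul_eq_mul_div, div_le_iff₀ (by positivity)]
      have h5 := hXr r₀ le_rfl
      have h6 : 0 ≤ M * C₀ := by positivity
      linarith [abs_nonneg μ]
    rw [mul_add] at h1
    linarith
  have hY0 : 0 ≤ Y := (integral_nonneg fun _ => abs_nonneg _).trans (hα 0)
  set Z := 3 * (mass v * Y + t * ∫ p, v p) with hZ
  have hZ0 : 0 ≤ Z := by positivity
  have hq : 0 ≤ C₀ / c₃ := by positivity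
  refine ⟨C₀ + C₀ / c₃ + Y + Z + 1, r₀, by positivity, hr₀0, fun n => ⟨?_, ?_, ?_, ?_, fun r hr => ⟨?_, ?_⟩⟩⟩
  · linarith [(hb n).1]
  · linarith [hγ n]
  · linarith [hk n]
  · linarith [hα n]
  · have h1 := setIntegral_tail_le (hst n).nonneg (hst n).integrable (hst n).kin_integrable
      (hr₀0.trans_le hr)
    have h2 : ∫ p in tail r, |γ n p| = ∫ p in tail r, γ n p :=
      integral_congr_ae (ae_restrict_of_ae ((hst n).nonneg.mono fun p hp => abs_of_nonneg hp))
    rw [h2]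
    refine h1.trans (div_le_div_of_nonneg_right ?_ (sq_nonneg r))
    linarith [hk n]
  · refine (htail n r hr).trans ?_
    rw [div_mul_eq_mul_div]
    refine div_le_div_of_nonneg_right ?_ (sq_nonneg r)
    have h1 := mul_le_mul_of_nonneg_left (hα n) hmv
    linarith

end approx

/-! ### Extraction of limits and the pointwise minimization problem -/

/-- A pointwise bounded, uniformly Lipschitz sequence of functions has a pointwise convergent
subsequence. -/
theorem exists_subseq_tendsto_of_lipschitz {F : Type*} [NormedAddCommGroup F] [ProperSpace F]
    {f : ℕ → Space → F} {C L : ℝ} (hC : ∀ n p, ‖f n p‖ ≤ C)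
    (hL : ∀ n p q, ‖f n p - f n q‖ ≤ L * ‖p - q‖) :
    ∃ φ : ℕ → ℕ, StrictMono φ ∧ ∃ g : Space → F,
      ∀ p, Tendsto (fun n => f (φ n) p) atTop (𝓝 (g p)) := by
  obtain ⟨D, hD⟩ := TopologicalSpace.exists_dense_seq Space
  have hcomp : IsCompact (Set.univ.pi fun _ : ℕ => Metric.closedBall (0 : F) C) :=
    isCompact_univ_pi fun _ => isCompact_closedBall 0 C
  -- Compactness of the product gives convergence on a dense sequence in one extraction; the common
  -- Lipschitz constant extends it to all points.
  obtain ⟨a, -, φ, hφ, ha⟩ := hcomp.tendsto_subseq (x := fun n k => f n (D k))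
    (fun n k _ => by simpa using hC n (D k))
  rw [tendsto_pi_nhds] at ha
  have hL0 : 0 ≤ |L| := abs_nonneg L
  have hcau : ∀ p, CauchySeq fun n => f (φ n) p := fun p => by
    rw [Metric.cauchySeq_iff]
    intro e he
    obtain ⟨k, hk⟩ := hD.exists_dist_lt p (by positivity : 0 < e / (3 * (|L| + 1)))
    obtain ⟨N, hN⟩ := Metric.cauchySeq_iff.1 (ha k).cauchySeq (e / 3) (by positivity)
    refine ⟨N, fun m hm n hn => ?_⟩
    have h1 := hN m hm n hn
    have h2 : ∀ j, dist (f j p) (f j (D k)) < e / 3 := fun j => by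
      rw [dist_eq_norm]
      refine (hL j _ _).trans_lt ?_
      rw [← dist_eq_norm]
      have h3 : L * dist p (D k) ≤ (|L| + 1) * dist p (D k) :=
        mul_le_mul_of_nonneg_right (by linarith [le_abs_self L]) dist_nonneg
      refine h3.trans_lt ?_
      rw [lt_div_iff₀ (by positivity)] at hk
      linarith
    have h3 := h2 (φ m)
    have h4 := h2 (φ n)
    rw [dist_comm] at h4
    simp only [Function.comp_apply] at h1
    linarith [dist_triangle4 (f (φ m) p) (f (φ m) (D k)) (f (φ n) (D k)) (f (φ n) p)]
  choose g hg using fun p => cauchySeq_tendsto_of_complete (hcau p)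
  exact ⟨φ, hφ, g, hg⟩

/-- If `A ≤ |B|`, `A > 0`, approximate minimizers of `A g + B a` escape to infinity. -/
theorem tendsto_atTop_of_le_abs {A B e g a : ℕ → ℝ} {A₀ B₀ : ℝ} (hA : Tendsto A atTop (𝓝 A₀))
    (hB : Tendsto B atTop (𝓝 B₀)) (he : Tendsto e atTop (𝓝 0)) (hg : ∀ n, Feasible (g n) (a n))
    (hmin : ∀ᶠ n in atTop, ∀ x y, Feasible x y →
      A n * g n + B n * a n ≤ A n * x + B n * y + e n * (x ^ 2 + y ^ 2))
    (hA0 : 0 < A₀) (hle : A₀ ≤ |B₀|) : Tendsto g atTop atTop := by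
  rw [tendsto_atTop]
  intro K
  set m := max K 0 with hm
  have hm0 : 0 ≤ m := le_max_right _ _
  let s : ℝ → ℝ := fun x => √(x * (1 + x))
  have hs : ∀ x, 0 ≤ x → s x ^ 2 = x * (1 + x) := fun x hx => Real.sq_sqrt (by positivity)
  have hs0 : ∀ x, 0 ≤ s x := fun x => Real.sqrt_nonneg _
  -- Since s x - x is increasing and |B₀| ≥ A₀ > 0, the best value A₀ x - |B₀| s x at height x keeps
  -- decreasing as x grows, so the limit problem has no minimizer.
  have hmono : ∀ x y, 0 ≤ x → x ≤ y → s x - x ≤ s y - y := fun x y hx hxy => by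
    have h1 := hs x hx
    have h2 := hs y (hx.trans hxy)
    have h3 : s x ≤ x + 1 / 2 := by nlinarith [hs0 x]
    have h4 := hs0 x
    have h5 := hs0 y
    by_contra hc
    push Not at hc
    nlinarith
  have hstrict : s m - m < s (m + 1) - (m + 1) := by
    have h1 := hs m hm0
    have h2 := hs (m + 1) (by positivity)
    have h3 : s m < m + 1 / 2 := by nlinarith [hs0 m]
    have h4 := hs0 m
    have h5 := hs0 (m + 1)
    by_contra hc
    push Not at hc
    nlinarith
  set x := m + 1
  -- In the limit problem, moving from any height at most m up to m + 1 gains at least `gap`,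
  -- eventually more than the errors.
  set gap := A₀ * ((s x - x) - (s m - m)) with hgap
  have hgap0 : 0 < gap := mul_pos hA0 (by linarith)
  have hBabs : Tendsto (fun n => |B n|) atTop (𝓝 |B₀|) := hB.abs
  have hlim : Tendsto (fun n => |A n - A₀| * (m + x) + |(|B n| - |B₀|)| * (m + 1 + s x)
      + e n * (x ^ 2 + (s x) ^ 2)) atTop (𝓝 0) := by
    have h1 : Tendsto (fun n => |A n - A₀|) atTop (𝓝 0) := by
      simpa using (hA.sub_const A₀).abs
    have h2 : Tendsto (fun n => |(|B n| - |B₀|)|) atTop (𝓝 0) := by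
      simpa using (hBabs.sub_const |B₀|).abs
    simpa using ((h1.mul_const (m + x)).add (h2.mul_const (m + 1 + s x))).add
      (he.mul_const (x ^ 2 + (s x) ^ 2))
  filter_upwards [hmin, hlim.eventually (gt_mem_nhds hgap0)] with n hn hlt
  by_contra hc
  push Not at hc
  have hgm : g n ≤ m := hc.le.trans (le_max_left _ _)
  obtain ⟨hg0, hga⟩ := hg n
  have hx0 : 0 ≤ x := by positivity
  have hxs := hs x hx0
  have hgs := hs (g n) hg0
  have hcomp : A n * g n + B n * a n ≤ A n * x - |B n| * s x + e n * (x ^ 2 + s x ^ 2) := by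
    rcases le_total 0 (B n) with hb | hb
    · have := hn x (-s x) ⟨hx0, by rw [neg_sq, hxs]⟩
      rw [abs_of_nonneg hb]
      rw [neg_sq] at this
      linarith
    · have := hn x (s x) ⟨hx0, hxs.le⟩
      rw [abs_of_nonpos hb]
      linarith
  have ha : |a n| ≤ s (g n) := abs_le_of_sq_le_sq (by rw [hgs]; exact hga) (hs0 _)
  have hlow : A n * g n - |B n| * s (g n) ≤ A n * g n + B n * a n := by
    have h1 := neg_abs_le (B n * a n)
    rw [abs_mul] at h1
    have h2 := mul_le_mul_of_nonneg_left ha (abs_nonneg (B n))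
    linarith
  have h1 : (A n - A₀) * (x - g n) ≤ |A n - A₀| * (m + x) := by
    refine (le_abs_self _).trans ?_
    rw [abs_mul]
    refine mul_le_mul_of_nonneg_left (abs_le.2 ⟨by linarith, by linarith⟩) (abs_nonneg _)
  have hsg : s (g n) ≤ m + 1 := by
    have : s (g n) ≤ g n + 1 / 2 := by nlinarith [hs0 (g n)]
    linarith
  have h2 : (|B n| - |B₀|) * (s (g n) - s x) ≤ |(|B n| - |B₀|)| * (m + 1 + s x) := by
    refine (le_abs_self _).trans ?_
    rw [abs_mul]
    refine mul_le_mul_of_nonneg_left (abs_le.2 ⟨by linarith [hs0 (g n)], by linarith [hs0 x]⟩)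
      (abs_nonneg _)
  have h3 := hmono (g n) m hg0 hgm
  have h4 : A₀ * (s (g n) - g n) ≤ A₀ * (s m - m) := mul_le_mul_of_nonneg_left h3 hA0.le
  have h5 : s (g n) ≤ s x := Real.sqrt_le_sqrt (by
    have : g n ≤ x := by linarith
    exact mul_le_mul this (by linarith) (by linarith) hx0)
  have h6 : 0 ≤ (|B₀| - A₀) * (s x - s (g n)) := mul_nonneg (by linarith) (by linarith)
  rw [hgap] at hlt
  nlinarith

/-- If `A > |B|`, approximate minimizers of `A g + B a` converge to the minimizer. -/
theorem tendsto_of_abs_lt {A B e g a : ℕ → ℝ} {A₀ B₀ : ℝ} (hA : Tendsto A atTop (𝓝 A₀))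
    (hB : Tendsto B atTop (𝓝 B₀)) (he : Tendsto e atTop (𝓝 0)) (hg : ∀ n, Feasible (g n) (a n))
    (hmin : ∀ᶠ n in atTop, ∀ x y, Feasible x y →
      A n * g n + B n * a n ≤ A n * x + B n * y + e n * (x ^ 2 + y ^ 2))
    (hlt : |B₀| < A₀) :
    Tendsto g atTop (𝓝 (A₀ / (2 * √(A₀ ^ 2 - B₀ ^ 2)) - 1 / 2)) ∧
      Tendsto a atTop (𝓝 (-B₀ / (2 * √(A₀ ^ 2 - B₀ ^ 2)))) := by
  have hS2 : ∀ {x y : ℝ}, |y| < x → 0 < x ^ 2 - y ^ 2 := fun {x y} h => by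
    have := sq_lt_sq' (by linarith [abs_nonneg y]) h
    rw [sq_abs] at this
    linarith
  let S : ℕ → ℝ := fun n => √(A n ^ 2 - B n ^ 2)
  set S₀ := √(A₀ ^ 2 - B₀ ^ 2) with hS₀
  have hS : Tendsto S atTop (𝓝 S₀) := ((hA.pow 2).sub (hB.pow 2)).sqrt
  have hS₀0 : 0 < S₀ := Real.sqrt_pos.2 (hS2 hlt)
  have hev : ∀ᶠ n in atTop, |B n| < A n := hB.abs.eventually_lt hA hlt
  let x : ℕ → ℝ := fun n => A n / (2 * S n) - 1 / 2
  let y : ℕ → ℝ := fun n => -B n / (2 * S n)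
  have h2S : Tendsto (fun n => 2 * S n) atTop (𝓝 (2 * S₀)) := hS.const_mul 2
  have hx : Tendsto x atTop (𝓝 (A₀ / (2 * S₀) - 1 / 2)) :=
    (hA.div h2S (by positivity)).sub_const _
  have hy : Tendsto y atTop (𝓝 (-B₀ / (2 * S₀))) := hB.neg.div h2S (by positivity)
  -- A hyperbolic rotation: the constraint becomes X² - Y² ≥ S²/4, and X is the linear functional up
  -- to a constant, minimal at X = S/2, Y = 0. Near-minimality squeezes X to its minimum, and the
  -- constraint then forces Y to zero.
  let X : ℕ → ℝ := fun n => A n * (g n + 1 / 2) + B n * a n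
  let Y : ℕ → ℝ := fun n => A n * a n + B n * (g n + 1 / 2)
  have hbound : ∀ᶠ n in atTop, S n / 2 ≤ X n ∧ X n ≤ S n / 2 + e n * (x n ^ 2 + y n ^ 2) ∧
      Y n ^ 2 ≤ X n ^ 2 - S n ^ 2 / 4 ∧ g n + 1 / 2 = (A n * X n - B n * Y n) / S n ^ 2 ∧
      a n = (A n * Y n - B n * X n) / S n ^ 2 := by
    filter_upwards [hev, hmin] with n hn hm
    have hd := hS2 hn
    have hSn : 0 < S n := Real.sqrt_pos.2 hd
    have hSsq : S n ^ 2 = A n ^ 2 - B n ^ 2 := Real.sq_sqrt hd.le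
    have hAn : 0 < A n := (abs_nonneg _).trans_lt hn
    have hSA : S n ≤ A n := abs_le_of_sq_le_sq' (by nlinarith) hAn.le |>.2
    obtain ⟨hg0, hga⟩ := hg n
    have key : X n ^ 2 - Y n ^ 2 = S n ^ 2 * ((g n + 1 / 2) ^ 2 - a n ^ 2) := by
      rw [hSsq]; simp only [X, Y]; ring
    have hY : Y n ^ 2 ≤ X n ^ 2 - S n ^ 2 / 4 := by
      have : S n ^ 2 * (1 / 4) ≤ S n ^ 2 * ((g n + 1 / 2) ^ 2 - a n ^ 2) :=
        mul_le_mul_of_nonneg_left (by nlinarith) (sq_nonneg _)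
      linarith
    have hX0 : 0 ≤ X n := by
      have h1 := neg_abs_le (B n * a n)
      rw [abs_mul] at h1
      have h2 := mul_le_mul hn.le (Feasible.abs_le ⟨hg0, hga⟩) (abs_nonneg _) hAn.le
      simp only [X]
      linarith
    have hXS : S n / 2 ≤ X n := by
      refine (abs_le_of_sq_le_sq' ?_ hX0).2
      linarith [sq_nonneg (Y n), (by ring : (S n / 2) ^ 2 = S n ^ 2 / 4)]
    have hfeas : Feasible (x n) (y n) := by
      constructor
      · simp only [x]
        rw [sub_nonneg, div_le_div_iff₀ (by norm_num) (by positivity)]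
        linarith
      · have : (x n + 1 / 2) ^ 2 - y n ^ 2 = 1 / 4 := by
          simp only [x, y]
          field_simp
          ring_nf
          nlinarith
        nlinarith
    have h3 := hm _ _ hfeas
    have h4 : A n * (x n + 1 / 2) + B n * y n = S n / 2 := by
      simp only [x, y]
      field_simp
      ring_nf
      linarith
    refine ⟨hXS, ?_, hY, ?_, ?_⟩
    · simp only [X]; linarith
    · rw [eq_div_iff (by positivity), hSsq]; simp only [X, Y]; ring
    · rw [eq_div_iff (by positivity), hSsq]; simp only [X, Y]; ring
  have hXlim : Tendsto X atTop (𝓝 (S₀ / 2)) := by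
    have h1 : Tendsto (fun n => S n / 2) atTop (𝓝 (S₀ / 2)) := hS.div_const 2
    have h2 : Tendsto (fun n => S n / 2 + e n * (x n ^ 2 + y n ^ 2)) atTop (𝓝 (S₀ / 2)) := by
      simpa using h1.add (he.mul ((hx.pow 2).add (hy.pow 2)))
    exact tendsto_of_tendsto_of_tendsto_of_le_of_le' h1 h2 (hbound.mono fun n h => h.1)
      (hbound.mono fun n h => h.2.1)
  have hYlim : Tendsto Y atTop (𝓝 0) := by
    have h1 : Tendsto (fun n => X n ^ 2 - S n ^ 2 / 4) atTop (𝓝 0) := by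
      have := (hXlim.pow 2).sub ((hS.pow 2).div_const 4)
      convert this using 2
      ring
    have h2 : Tendsto (fun n => Y n ^ 2) atTop (𝓝 0) :=
      tendsto_of_tendsto_of_tendsto_of_le_of_le' tendsto_const_nhds h1
        (Eventually.of_forall fun n => sq_nonneg _) (hbound.mono fun n h => h.2.2.1)
    have h3 := h2.sqrt
    simp only [Real.sqrt_sq_eq_abs, Real.sqrt_zero] at h3
    exact (tendsto_zero_iff_abs_tendsto_zero _).2 h3
  have hSS : S₀ ^ 2 ≠ 0 := by positivity
  constructor
  · have h1 := ((hA.mul hXlim).sub (hB.mul hYlim)).div (hS.pow 2) hSS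
    have h2 : Tendsto (fun n => g n + 1 / 2) atTop (𝓝 (A₀ / (2 * S₀))) := by
      have h3 : (A₀ * (S₀ / 2) - B₀ * 0) / S₀ ^ 2 = A₀ / (2 * S₀) := by field_simp; ring
      rw [h3] at h1
      exact Tendsto.congr' (hbound.mono fun n h => h.2.2.2.1.symm) h1
    simpa using h2.sub_const (1 / 2)
  · have h1 := ((hA.mul hYlim).sub (hB.mul hXlim)).div (hS.pow 2) hSS
    have h2 : (A₀ * 0 - B₀ * (S₀ / 2)) / S₀ ^ 2 = -B₀ / (2 * S₀) := by field_simp; ring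
    rw [h2] at h1
    exact Tendsto.congr' (hbound.mono fun n h => h.2.2.2.2.symm) h1

/-! ### Convergent sequences: stationarity in ρ₀ and limiting coefficients -/

/-- An approximating sequence, at positive `ρ₀ = t`, whose potentials and masses converge. -/
structure IsConvSeq (v : Space → ℝ) (M μ t I : ℝ) (R ε : ℕ → ℝ) (γ α : ℕ → Space → ℝ)
    (N C r₀ : ℝ) (G H : Space → ℝ) : Prop extends IsApproxSeq v μ t I R ε γ α where
  kernel : IsKernel v M
  t_pos : 0 < t
  C_pos : 0 < C
  mass_le : ∀ n, t + mass (γ n) ≤ C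
  integral_le : ∀ n, ∫ p, |γ n p| ≤ C
  kin_le : ∀ n, ∫ p : Space, ‖p‖ ^ 2 * γ n p ≤ C
  integral_le' : ∀ n, ∫ p, |α n p| ≤ C
  tail_le : ∀ n r, r₀ ≤ r → ∫ p in tail r, |γ n p| ≤ C / r ^ 2
  tail_le' : ∀ n r, r₀ ≤ r → ∫ p in tail r, |α n p| ≤ C / r ^ 2
  tendsto_mass : Tendsto (fun n => mass (γ n)) atTop (𝓝 N)
  tendsto_pot : ∀ p, Tendsto (fun n => pot v (γ n) p) atTop (𝓝 (G p))
  tendsto_pot' : ∀ p, Tendsto (fun n => pot v (α n) p) atTop (𝓝 (H p))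
  le_energy : ∀ R γ α s, IsTest R γ α → 0 ≤ s → I ≤ energy v μ γ α s

theorem IsApproxSeq.exists_isConvSeq {v : Space → ℝ} {M μ t I : ℝ} {R ε : ℕ → ℝ}
    {γ α : ℕ → Space → ℝ} (h : IsApproxSeq v μ t I R ε γ α) (hv : IsKernel v M) (ht : 0 < t)
    (hI : ∀ R γ α s, IsTest R γ α → 0 ≤ s → I ≤ energy v μ γ α s) :
    ∃ R ε γ α N C r₀ G H, IsConvSeq v M μ t I R ε γ α N C r₀ G H := by
  obtain ⟨C, r₀, hC, -, hb⟩ := h.bounds hv ht.le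
  have hst := fun n => (h.test n).isState
  have hc := c₃_pos
  have hM := hv.M_pos
  have hcM : 0 ≤ c₃ * M := by positivity
  -- The masses are carried along as a component constant in p, so that one extraction serves both
  -- potentials and masses.
  obtain ⟨φ, hφ, g, hg⟩ := exists_subseq_tendsto_of_lipschitz
    (f := fun n p => ((pot v (γ n) p, pot v (α n) p), mass (γ n)))
    (C := max (c₃ * M * C) C) (L := c₃ * M * C) (fun n p => by
      have h1 := (hv.abs_pot_le (hst n).integrable p).trans
        (mul_le_mul_of_nonneg_left (hb n).2.1 hcM)
      have h2 := (hv.abs_pot_le (hst n).integrable' p).trans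
        (mul_le_mul_of_nonneg_left (hb n).2.2.2.1 hcM)
      have h3 := mass_nonneg (hst n).nonneg
      have h4 := (hb n).1
      refine max_le (max_le ?_ ?_) ?_
      · exact h1.trans (le_max_left _ _)
      · exact h2.trans (le_max_left _ _)
      · rw [Real.norm_eq_abs, abs_of_nonneg h3]
        exact le_trans (by linarith) (le_max_right _ _)) (fun n p q => by
      have h1 := (hv.abs_pot_sub_le (hst n).integrable p q).trans
        (mul_le_mul_of_nonneg_right (mul_le_mul_of_nonneg_left (hb n).2.1 hcM) (norm_nonneg _))
      have h2 := (hv.abs_pot_sub_le (hst n).integrable' p q).trans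
        (mul_le_mul_of_nonneg_right (mul_le_mul_of_nonneg_left (hb n).2.2.2.1 hcM)
          (norm_nonneg _))
      refine max_le (max_le h1 h2) ?_
      simp only [Prod.snd_sub, sub_self, norm_zero]
      positivity)
  refine ⟨_, _, _, _, (g 0).2, C, r₀, fun p => (g p).1.1, fun p => (g p).1.2,
    ⟨h.subseq hφ, hv, ht, hC, fun n => (hb _).1, fun n => (hb _).2.1, fun n => (hb _).2.2.1,
      fun n => (hb _).2.2.2.1, fun n r hr => ((hb _).2.2.2.2 r hr).1,
      fun n r hr => ((hb _).2.2.2.2 r hr).2, ?_, fun p => ?_, fun p => ?_, hI⟩⟩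
  · exact (continuous_snd.tendsto _).comp (hg 0)
  · exact ((continuous_fst.comp continuous_fst).tendsto _).comp (hg p)
  · exact ((continuous_snd.comp continuous_fst).tendsto _).comp (hg p)

/-- The limit of the coefficients `coefA`. -/
def limA (v : Space → ℝ) (μ t N : ℝ) (G : Space → ℝ) (p : Space) : ℝ :=
  ‖p‖ ^ 2 - μ + v 0 * (t + N) + G p + t * v p

/-- The limit of the coefficients `coefB`. -/
def limB (v : Space → ℝ) (t : ℝ) (H : Space → ℝ) (p : Space) : ℝ := H p + t * v p

theorem continuous_of_abs_sub_le {f : Space → ℝ} {L : ℝ}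
    (h : ∀ p q, |f p - f q| ≤ L * ‖p - q‖) : Continuous f := by
  have hL : ∀ p q, dist (f p) (f q) ≤ (⟨|L|, abs_nonneg L⟩ : NNReal) * dist p q := fun p q => by
    rw [Real.dist_eq, dist_eq_norm]
    exact (h p q).trans (mul_le_mul_of_nonneg_right (le_abs_self L) (norm_nonneg _))
  exact (LipschitzWith.of_dist_le_mul hL).continuous

namespace IsConvSeq

variable {v : Space → ℝ} {M μ t I : ℝ} {R ε : ℕ → ℝ} {γ α : ℕ → Space → ℝ}
  {N C r₀ : ℝ} {G H : Space → ℝ} (h : IsConvSeq v M μ t I R ε γ α N C r₀ G H)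
include h

theorem isState (n : ℕ) : IsState (γ n) (α n) := (h.test n).isState

theorem tendsto_coefA (p : Space) :
    Tendsto (fun n => coefA v μ (γ n) t p) atTop (𝓝 (limA v μ t N G p)) :=
  ((((h.tendsto_mass.const_add t).const_mul (v 0)).const_add (‖p‖ ^ 2 - μ)).add
    (h.tendsto_pot p)).add_const (t * v p)

theorem tendsto_coefB (p : Space) :
    Tendsto (fun n => coefB v (α n) t p) atTop (𝓝 (limB v t H p)) :=
  (h.tendsto_pot' p).add_const (t * v p)

theorem cM_nonneg : 0 ≤ c₃ * M * C :=
  mul_nonneg (mul_nonneg c₃_pos.le h.kernel.M_pos.le) h.C_pos.le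

theorem pot_lipschitz (n : ℕ) (p q : Space) :
    |pot v (γ n) p - pot v (γ n) q| ≤ c₃ * M * C * ‖p - q‖ :=
  (h.kernel.abs_pot_sub_le (h.isState n).integrable p q).trans (mul_le_mul_of_nonneg_right
    (mul_le_mul_of_nonneg_left (h.integral_le n) (mul_pos c₃_pos h.kernel.M_pos).le)
      (norm_nonneg _))

theorem pot_lipschitz' (n : ℕ) (p q : Space) :
    |pot v (α n) p - pot v (α n) q| ≤ c₃ * M * C * ‖p - q‖ :=
  (h.kernel.abs_pot_sub_le (h.isState n).integrable' p q).trans (mul_le_mul_of_nonneg_right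
    (mul_le_mul_of_nonneg_left (h.integral_le' n) (mul_pos c₃_pos h.kernel.M_pos).le)
      (norm_nonneg _))

theorem G_lipschitz (p q : Space) : |G p - G q| ≤ c₃ * M * C * ‖p - q‖ :=
  le_of_tendsto' ((h.tendsto_pot p).sub (h.tendsto_pot q)).abs fun n => h.pot_lipschitz n p q

theorem H_lipschitz (p q : Space) : |H p - H q| ≤ c₃ * M * C * ‖p - q‖ :=
  le_of_tendsto' ((h.tendsto_pot' p).sub (h.tendsto_pot' q)).abs fun n => h.pot_lipschitz' n p q

theorem G_second_diff (p k : Space) :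
    |G (p + k) + G (p - k) - 2 * G p| ≤ c₃ * M * C * ‖k‖ ^ 2 :=
  le_of_tendsto' (((h.tendsto_pot (p + k)).add (h.tendsto_pot (p - k))).sub
    ((h.tendsto_pot p).const_mul 2)).abs fun n =>
    (h.kernel.abs_pot_second_diff_le (h.isState n).integrable p k).trans
      (mul_le_mul_of_nonneg_right (mul_le_mul_of_nonneg_left (h.integral_le n)
        (mul_pos c₃_pos h.kernel.M_pos).le) (by positivity))

theorem H_second_diff (p k : Space) :
    |H (p + k) + H (p - k) - 2 * H p| ≤ c₃ * M * C * ‖k‖ ^ 2 :=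
  le_of_tendsto' (((h.tendsto_pot' (p + k)).add (h.tendsto_pot' (p - k))).sub
    ((h.tendsto_pot' p).const_mul 2)).abs fun n =>
    (h.kernel.abs_pot_second_diff_le (h.isState n).integrable' p k).trans
      (mul_le_mul_of_nonneg_right (mul_le_mul_of_nonneg_left (h.integral_le' n)
        (mul_pos c₃_pos h.kernel.M_pos).le) (by positivity))

theorem continuous_limA : Continuous (limA v μ t N G) := by
  have h1 := continuous_of_abs_sub_le h.G_lipschitz
  have h2 := h.kernel.continuous
  unfold limA
  fun_prop

theorem continuous_limB : Continuous (limB v t H) := by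
  have h1 := continuous_of_abs_sub_le h.H_lipschitz
  have h2 := h.kernel.continuous
  unfold limB
  fun_prop

theorem radial_limA : IsRadial (limA v μ t N G) := fun x y hxy => by
  have h1 : G x = G y := tendsto_nhds_unique (h.tendsto_pot x) (by
    simpa only [h.radial _ x y hxy] using h.tendsto_pot y)
  unfold limA
  rw [hxy, h1, h.kernel.radial x y hxy]

theorem radial_limB : IsRadial (limB v t H) := fun x y hxy => by
  have h1 : H x = H y := tendsto_nhds_unique (h.tendsto_pot' x) (by
    simpa only [h.radial' _ x y hxy] using h.tendsto_pot' y)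
  unfold limB
  rw [h1, h.kernel.radial x y hxy]

theorem lin_eq_pot_zero (f : Space → ℝ) : lin v f = pot v f 0 := by
  unfold lin pot
  simp only [zero_sub, h.kernel.neg]

theorem tendsto_lin_add_lin :
    Tendsto (fun n => lin v (γ n) + lin v (α n)) atTop (𝓝 (G 0 + H 0)) := by
  simp only [h.lin_eq_pot_zero]
  exact (h.tendsto_pot 0).add (h.tendsto_pot' 0)

theorem G_nonneg (p : Space) : 0 ≤ G p :=
  ge_of_tendsto' (h.tendsto_pot p) fun n => h.kernel.pot_nonneg (h.isState n).nonneg p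

/-- Stationarity in `ρ₀`. -/
theorem stationary : -μ + v 0 * (t + N) + (G 0 + H 0) = 0 := by
  set d := -μ + v 0 * (t + N) + (G 0 + H 0) with hd
  have h0 := h.kernel.pos
  have ht := h.t_pos
  have key : ∀ s, -t ≤ s → 0 ≤ s * d + v 0 / 2 * s ^ 2 := fun s hs => by
    have h1 : Tendsto (fun n => energy v μ (γ n) (α n) (t + s)) atTop
        (𝓝 (I + s * d + v 0 / 2 * s ^ 2)) := by
      simp only [energy_add_right]
      exact (h.tendsto_energy.add ((((h.tendsto_mass.const_add t).const_mul (v 0)).const_add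
        (-μ)).add h.tendsto_lin_add_lin |>.const_mul s)).add_const _
    have h2 := ge_of_tendsto' h1 fun n => h.le_energy _ _ _ (t + s) (h.test n) (by linarith)
    linarith
  by_contra hne
  -- The shift -η d goes downhill. The bound t / |d| keeps ρ₀ nonnegative, which is where t > 0
  -- enters, and 1 / `v 0` keeps the quadratic term below the linear gain.
  set η := min (t / |d|) (1 / v 0) with hη
  have hd0 : 0 < |d| := abs_pos.2 hne
  have hη0 : 0 < η := lt_min (by positivity) (by positivity)
  have h1 : η * |d| ≤ t := by
    have := min_le_left (t / |d|) (1 / v 0)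
    rwa [le_div_iff₀ hd0] at this
  have h2 : η * v 0 ≤ 1 := by
    have := min_le_right (t / |d|) (1 / v 0)
    rwa [le_div_iff₀ h0] at this
  have h3 : -t ≤ -(η * d) := by
    have := mul_le_mul_of_nonneg_left (le_abs_self d) hη0.le
    linarith
  have h4 := key _ h3
  have h5 : 0 < η * d ^ 2 := by positivity
  have h6 : -(η * d) * d + v 0 / 2 * (-(η * d)) ^ 2 = η * d ^ 2 * (η * v 0 / 2 - 1) := by ring
  rw [h6] at h4
  have := nonneg_of_mul_nonneg_right h4 h5
  linarith

/-- Comparison with the pure condensate of equal total density: the terms in the total density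
agree, and every other term except t (`lin v γ` + `lin v α`) is nonnegative and may be dropped. -/
theorem G_add_H_zero_nonpos : G 0 + H 0 ≤ 0 := by
  have h1 : ∀ n, t * (lin v (γ n) + lin v (α n)) ≤ energy v μ (γ n) (α n) t - I := fun n => by
    have h2 := h.le_energy _ _ _ (t + mass (γ n)) (isTest_zero 0)
      (add_nonneg h.t_pos.le (mass_nonneg (h.isState n).nonneg))
    rw [energy_zero] at h2
    have h3 := h.kernel.dbl_self_nonneg (h.isState n).integrable
    have h4 := h.kernel.dbl_self_nonneg (h.isState n).integrable'
    have h5 := kin_nonneg (h.isState n).nonneg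
    unfold energy
    linarith
  have h2 := le_of_tendsto_of_tendsto' (h.tendsto_lin_add_lin.const_mul t)
    (h.tendsto_energy.sub_const I) h1
  rw [sub_self] at h2
  exact nonpos_of_mul_nonpos_right h2 h.t_pos

/-- Stationarity turns -μ + `v 0` (t + N) into -(G 0 + H 0), which is nonnegative. -/
theorem sq_norm_le_limA (p : Space) : ‖p‖ ^ 2 ≤ limA v μ t N G p := by
  have h1 := h.stationary
  have h2 := h.G_add_H_zero_nonpos
  have h3 := h.G_nonneg p
  have h4 := mul_nonneg h.t_pos.le (h.kernel.nonneg p)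
  unfold limA
  linarith

theorem ae_eventually_euler_lagrange : ∀ᵐ p : Space, ∀ᶠ n in atTop, ∀ g a, Feasible g a →
    coefA v μ (γ n) t p * γ n p + coefB v (α n) t p * α n p
      ≤ coefA v μ (γ n) t p * g + coefB v (α n) t p * a + ε n * (g ^ 2 + a ^ 2) := by
  filter_upwards [ae_all_iff.2 h.euler_lagrange] with p hp
  filter_upwards [h.tendsto_R.eventually_ge_atTop ‖p‖] with n hn
  exact hp n hn

theorem ae_liminf_lt_top :
    ∀ᵐ p : Space, liminf (fun n => ENNReal.ofReal (γ n p)) atTop < ⊤ := by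
  have hm : ∀ n, AEMeasurable (fun p => ENNReal.ofReal (γ n p)) volume := fun n =>
    (h.isState n).integrable.1.aemeasurable.ennreal_ofReal
  have hm' : AEMeasurable (fun p => liminf (fun n => ENNReal.ofReal (γ n p)) atTop) volume := by
    refine ⟨_, Measurable.liminf fun n => (hm n).measurable_mk, ?_⟩
    filter_upwards [ae_all_iff.2 fun n => (hm n).ae_eq_mk] with p hp
    simp only [hp]
  refine ae_lt_top' hm' (ne_of_lt ?_)
  refine (lintegral_liminf_le' hm).trans_lt ?_
  refine lt_of_le_of_lt (liminf_le_of_frequently_le' (x := ENNReal.ofReal C)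
    (Eventually.of_forall fun n => ?_).frequently) ENNReal.ofReal_lt_top
  rw [← ofReal_integral_eq_lintegral_ofReal (h.isState n).integrable (h.isState n).nonneg]
  refine ENNReal.ofReal_le_ofReal ?_
  rw [← (h.isState n).integral_abs_eq]
  exact h.integral_le n

/-- Where 0 < A ≤ |B| the values γₙ(p) would tend to infinity, which Fatou's lemma and the L¹ bound
exclude outside a null set. -/
theorem ae_abs_limB_lt_limA : ∀ᵐ p, |limB v t H p| < limA v μ t N G p := by
  have h0 : ∀ᵐ p : Space, p ≠ 0 := by
    rw [ae_iff]; simp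
  filter_upwards [h.ae_liminf_lt_top, h.ae_eventually_euler_lagrange,
    ae_all_iff.2 fun n => (h.isState n).feasible, h0] with p h1 h2 h3 h4
  by_contra hc
  push Not at hc
  have hA : 0 < limA v μ t N G p :=
    (pow_pos (norm_pos_iff.2 h4) 2).trans_le (h.sq_norm_le_limA p)
  have h5 := tendsto_atTop_of_le_abs (h.tendsto_coefA p) (h.tendsto_coefB p) h.tendsto_eps h3 h2
    hA hc
  have h6 := (ENNReal.tendsto_ofReal_nhds_top.2 h5).liminf_eq
  rw [h6] at h1
  exact lt_irrefl _ h1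

theorem abs_limB_le_limA (p : Space) : |limB v t H p| ≤ limA v μ t N G p := by
  have hcl : IsClosed {p | |limB v t H p| ≤ limA v μ t N G p} :=
    isClosed_le h.continuous_limB.abs h.continuous_limA
  have hd : Dense {p | |limB v t H p| ≤ limA v μ t N G p} :=
    Measure.dense_of_ae (h.ae_abs_limB_lt_limA.mono fun p hp => hp.le)
  have := hd.closure_eq
  rw [hcl.closure_eq] at this
  exact Set.eq_univ_iff_forall.1 this p

end IsConvSeq

/-! ### Spherical shells and L¹ convergence away from the origin -/

/-- The shell of half-width `d` about the sphere of radius `r`. -/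
def shell (r d : ℝ) : Set Space := {p | |‖p‖ - r| ≤ d}

theorem measurableSet_shell (r d : ℝ) : MeasurableSet (shell r d) :=
  (isClosed_le (by fun_prop) continuous_const : IsClosed (shell r d)).measurableSet

theorem shell_subset (r d : ℝ) : shell r d ⊆ Metric.closedBall 0 (r + d) := fun p hp => by
  have := (abs_le.1 (show |‖p‖ - r| ≤ d from hp)).2
  rw [mem_closedBall_zero_iff]
  linarith

theorem volume_shell_ne_top (r d : ℝ) : volume (shell r d) ≠ ⊤ :=
  ((measure_mono (shell_subset r d)).trans_lt measure_closedBall_lt_top).ne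

theorem volume_shell_ge {r d : ℝ} (hr : 0 < r) (hd : 0 < d) :
    d * (3 * r ^ 2 * volume.real (Metric.ball (0 : Space) 1)) ≤ volume.real (shell r d) := by
  have h1 : Metric.closedBall (0 : Space) (r + d) \ Metric.closedBall 0 r ⊆ shell r d := by
    rintro p ⟨hp1, hp2⟩
    simp only [mem_closedBall_zero_iff, not_le] at hp1 hp2
    change |‖p‖ - r| ≤ d
    rw [abs_le]
    constructor <;> linarith
  have h2 := measureReal_mono (μ := volume) h1 (volume_shell_ne_top r d)
  rw [measureReal_sdiff (Metric.closedBall_subset_closedBall (by linarith))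
    Metric.isClosed_closedBall.measurableSet measure_closedBall_lt_top.ne,
    Measure.addHaar_real_closedBall _ _ (by positivity),
    Measure.addHaar_real_closedBall _ _ hr.le, finrank_euclideanSpace_fin, ← sub_mul] at h2
  refine le_trans ?_ h2
  rw [← mul_assoc]
  refine mul_le_mul_of_nonneg_right ?_ measureReal_nonneg
  nlinarith [pow_pos hd 2, pow_pos hd 3, mul_pos hr (pow_pos hd 2)]

/-- The inverse distance to a sphere is not integrable. -/
theorem not_integrable_of_inv_dist_sphere {f : Space → ℝ} {r b c : ℝ} (hf : Integrable f)
    (hr : 0 < r) (hb : 0 < b)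
    (h : ∀ᵐ p : Space, r / 2 ≤ ‖p‖ → b ≤ |‖p‖ - r| * (f p + c)) : False := by
  set d : ℕ → ℝ := fun n => r / 2 * (1 / ((n : ℝ) + 1)) with hd
  have hd0 : ∀ n, 0 < d n := fun n => mul_pos (by positivity) Nat.one_div_pos_of_nat
  have hd1 : ∀ n, d n ≤ r / 2 := fun n => by
    have : 1 / ((n : ℝ) + 1) ≤ 1 := by
      rw [div_le_one (by positivity)]; linarith [(Nat.cast_nonneg n : (0 : ℝ) ≤ n)]
    simp only [hd]
    nlinarith
  have hdlim : Tendsto d atTop (𝓝 0) := by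
    have := (tendsto_one_div_add_atTop_nhds_zero_nat (𝕜 := ℝ)).const_mul (r / 2)
    rwa [mul_zero] at this
  have hi : ∀ n, IntegrableOn (fun p => f p + c) (shell r (d n)) := fun n =>
    hf.integrableOn.add (integrableOn_const (volume_shell_ne_top _ _))
  have hanti : Antitone fun n => shell r (d n) := fun m n hmn p hp => by
    refine le_trans (show |‖p‖ - r| ≤ d n from hp) ?_
    simp only [hd]
    gcongr
  have hlim := tendsto_setIntegral_of_antitone (f := fun p => f p + c) (μ := volume)
    (fun n => measurableSet_shell r (d n)) hanti ⟨0, hi 0⟩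
  have hinter : ⋂ n, shell r (d n) ⊆ Metric.sphere (0 : Space) r := fun p hp => by
    rw [Set.mem_iInter] at hp
    have : |‖p‖ - r| ≤ 0 := ge_of_tendsto' hdlim fun n => hp n
    rw [mem_sphere_zero_iff_norm]
    linarith [abs_nonpos_iff.1 this]
  have hzero : ∫ p in ⋂ n, shell r (d n), (f p + c) = 0 :=
    setIntegral_measure_zero _ (measure_mono_null hinter (Measure.addHaar_sphere _ _ _))
  rw [hzero] at hlim
  set V := volume.real (Metric.ball (0 : Space) 1) with hV
  have hV0 : 0 < V := ENNReal.toReal_pos (Metric.measure_ball_pos _ _ one_pos).ne'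
    measure_ball_lt_top.ne
  -- The integrand is at least b / d on a shell of half-width d whose volume is at least a multiple
  -- of d. The integrals stay bounded below while the shells shrink to a null sphere.
  have hlow : ∀ n, b * (3 * r ^ 2 * V) ≤ ∫ p in shell r (d n), (f p + c) := fun n => by
    have h1 : ∫ p in shell r (d n), b / d n ≤ ∫ p in shell r (d n), (f p + c) := by
      refine setIntegral_mono_on_ae (integrableOn_const (volume_shell_ne_top _ _)) (hi n)
        (measurableSet_shell _ _) (h.mono fun p hp hps => ?_)
      have h2 : |‖p‖ - r| ≤ d n := hps
      have h3 := hp (by linarith [(abs_le.1 h2).1, hd1 n])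
      rw [div_le_iff₀ (hd0 n), mul_comm]
      have h4 : 0 < f p + c := pos_of_mul_pos_right (hb.trans_le h3) (abs_nonneg _)
      exact h3.trans (mul_le_mul_of_nonneg_right h2 h4.le)
    rw [setIntegral_const, smul_eq_mul] at h1
    have h2 := mul_le_mul_of_nonneg_right (volume_shell_ge hr (hd0 n))
      (div_pos hb (hd0 n)).le
    refine le_trans (le_of_eq ?_) (h2.trans h1)
    have := (hd0 n).ne'
    field_simp
    exact hV
  have := ge_of_tendsto' hlim hlow
  have h5 : 0 < b * (3 * r ^ 2 * V) := by positivity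
  linarith

/-- Beyond a large radius f n is small by the tail bound, and so is g by Fatou's lemma. The
remaining annulus has finite volume, and the uniform bound allows dominated convergence there. -/
theorem tendsto_integral_abs_tail {f : ℕ → Space → ℝ} {g : Space → ℝ} {η C r₀ : ℝ}
    (hf : ∀ n, Integrable (f n)) (hg : Integrable g)
    (hfg : ∀ᵐ p, Tendsto (fun n => f n p) atTop (𝓝 (g p)))
    (hb : ∀ k, ∃ D : ℝ, ∀ᶠ n in atTop, ∀ᵐ p : Space, η ≤ ‖p‖ → ‖p‖ ≤ k → |f n p| ≤ D)
    (htail : ∀ n r, r₀ ≤ r → ∫ p in tail r, |f n p| ≤ C / r ^ 2) :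
    Tendsto (fun n => ∫ p, |(tail η).indicator (f n) p - (tail η).indicator g p|) atTop (𝓝 0) := by
  have hgt : ∀ r, r₀ ≤ r → ∫ p in tail r, |g p| ≤ C / r ^ 2 := fun r hr => by
    have h1 := integrable_of_fatou (f := fun n p => (tail r).indicator (fun p => |f n p|) p)
      (g := fun p => (tail r).indicator (fun p => |g p|) p) (k := fun _ => C / r ^ 2)
      (fun n => (hf n).abs.indicator (measurableSet_tail r))
      (fun n => ae_of_all _ fun p => Set.indicator_nonneg (fun _ _ => abs_nonneg _) p)
      (hfg.mono fun p hp => by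
        by_cases hpr : p ∈ tail r
        · simpa only [Set.indicator_of_mem hpr] using hp.abs
        · simp only [Set.indicator_of_notMem hpr, tendsto_const_nhds])
      (fun n => by
        rw [integral_indicator (measurableSet_tail r)]
        exact htail n r hr) tendsto_const_nhds
    rw [integral_indicator (measurableSet_tail r)] at h1
    exact h1.2
  rw [Metric.tendsto_atTop']
  intro e he
  have hC : Tendsto (fun r : ℝ => 2 * (C / r ^ 2)) atTop (𝓝 0) := by
    simpa using ((tendsto_const_nhds (x := C)).div_atTop (tendsto_pow_atTop two_ne_zero)).const_mul 2
  obtain ⟨r, hr1, hr2⟩ := ((hC.eventually (gt_mem_nhds (half_pos he))).and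
    (eventually_ge_atTop r₀)).exists
  set T := tail η ∩ Metric.closedBall 0 r with hT
  have hTm : MeasurableSet T := (measurableSet_tail η).inter Metric.isClosed_closedBall.measurableSet
  have hTf : volume T ≠ ⊤ :=
    ((measure_mono Set.inter_subset_right).trans_lt measure_closedBall_lt_top).ne
  obtain ⟨D, hD⟩ := hb r
  have hlim : Tendsto (fun n => ∫ p in T, |f n p - g p|) atTop (𝓝 0) := by
    have h1 := tendsto_integral_filter_of_dominated_convergence (μ := volume.restrict T)
      (F := fun n p => |f n p - g p|) (f := fun _ => (0 : ℝ)) (l := atTop)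
      (fun p => D + |g p|)
      (Eventually.of_forall fun n => ((hf n).sub hg).abs.1.restrict)
      (by
        filter_upwards [hD] with n hn
        rw [ae_restrict_iff' hTm]
        filter_upwards [hn] with p hp hpT
        rw [Real.norm_eq_abs, abs_abs]
        refine (abs_sub _ _).trans (add_le_add_left (hp hpT.1 ?_) _)
        simpa using hpT.2)
      ((integrableOn_const hTf).add hg.abs.integrableOn)
      (ae_restrict_of_ae (hfg.mono fun p hp => by
        simpa using (hp.sub_const (g p)).abs))
    simpa using h1
  obtain ⟨n₀, hn₀⟩ := (Metric.tendsto_atTop'.1 hlim) (e / 2) (half_pos he)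
  refine ⟨n₀, fun n hn => ?_⟩
  have h2 := hn₀ n hn
  rw [Real.dist_eq, sub_zero, abs_of_nonneg (integral_nonneg fun _ => abs_nonneg _)] at h2 ⊢
  have hd := (hf n).sub hg
  have h3 : ∫ p, |(tail η).indicator (f n) p - (tail η).indicator g p|
      ≤ ∫ p, (T.indicator (fun p => |f n p - g p|) p
        + ((tail r).indicator (fun p => |f n p|) p + (tail r).indicator (fun p => |g p|) p)) := by
    have i1 : Integrable (T.indicator fun p => |f n p - g p|) := hd.abs.indicator hTm
    have i2 : Integrable ((tail r).indicator fun p => |f n p|) :=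
      (hf n).abs.indicator (measurableSet_tail r)
    have i3 : Integrable ((tail r).indicator fun p => |g p|) :=
      hg.abs.indicator (measurableSet_tail r)
    refine integral_mono (((hf n).indicator (measurableSet_tail η)).sub
      (hg.indicator (measurableSet_tail η))).abs (i1.add (i2.add i3)) fun p => ?_
    have n1 : 0 ≤ T.indicator (fun p => |f n p - g p|) p :=
      Set.indicator_nonneg (fun _ _ => abs_nonneg _) p
    have n2 : 0 ≤ (tail r).indicator (fun p => |f n p|) p :=
      Set.indicator_nonneg (fun _ _ => abs_nonneg _) p
    have n3 : 0 ≤ (tail r).indicator (fun p => |g p|) p :=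
      Set.indicator_nonneg (fun _ _ => abs_nonneg _) p
    simp only
    by_cases hpη : p ∈ tail η
    · rw [Set.indicator_of_mem hpη, Set.indicator_of_mem hpη]
      rcases le_total ‖p‖ r with hpr | hpr
      · have : p ∈ T := ⟨hpη, by simpa using hpr⟩
        rw [Set.indicator_of_mem this] at n1 ⊢
        linarith
      · have : p ∈ tail r := hpr
        rw [Set.indicator_of_mem this, Set.indicator_of_mem this] at *
        linarith [abs_sub (f n p) (g p)]
    · rw [Set.indicator_of_notMem hpη, Set.indicator_of_notMem hpη, sub_zero, abs_zero]
      positivity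
  have h4 : ∫ p, (T.indicator (fun p => |f n p - g p|) p
        + ((tail r).indicator (fun p => |f n p|) p + (tail r).indicator (fun p => |g p|) p))
      = (∫ p in T, |f n p - g p|) + ((∫ p in tail r, |f n p|) + ∫ p in tail r, |g p|) := by
    have i1 : Integrable (T.indicator fun p => |f n p - g p|) := hd.abs.indicator hTm
    have i2 : Integrable ((tail r).indicator fun p => |f n p|) :=
      (hf n).abs.indicator (measurableSet_tail r)
    have i3 : Integrable ((tail r).indicator fun p => |g p|) :=
      hg.abs.indicator (measurableSet_tail r)
    have i4 : Integrable fun p => (tail r).indicator (fun p => |f n p|) p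
        + (tail r).indicator (fun p => |g p|) p := i2.add i3
    rw [integral_add i1 i4, integral_add i2 i3, integral_indicator hTm,
      integral_indicator (measurableSet_tail r), integral_indicator (measurableSet_tail r)]
  have h5 := htail n r hr2
  have h6 := hgt r hr2
  linarith

/-! ### The limit pair and strict separation away from the origin -/

/-- The limit of `γₙ`. -/
def limγ (v : Space → ℝ) (μ t N : ℝ) (G H : Space → ℝ) (p : Space) : ℝ :=
  limA v μ t N G p / (2 * √(limA v μ t N G p ^ 2 - limB v t H p ^ 2)) - 1 / 2

/-- The limit of `αₙ`. -/
def limα (v : Space → ℝ) (μ t N : ℝ) (G H : Space → ℝ) (p : Space) : ℝ :=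
  -limB v t H p / (2 * √(limA v μ t N G p ^ 2 - limB v t H p ^ 2))

namespace IsConvSeq

variable {v : Space → ℝ} {M μ t I : ℝ} {R ε : ℕ → ℝ} {γ α : ℕ → Space → ℝ}
  {N C r₀ : ℝ} {G H : Space → ℝ} (h : IsConvSeq v M μ t I R ε γ α N C r₀ G H)
include h

theorem ae_tendsto : ∀ᵐ p, Tendsto (fun n => γ n p) atTop (𝓝 (limγ v μ t N G H p)) ∧
    Tendsto (fun n => α n p) atTop (𝓝 (limα v μ t N G H p)) := by
  filter_upwards [h.ae_abs_limB_lt_limA, h.ae_eventually_euler_lagrange,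
    ae_all_iff.2 fun n => (h.isState n).feasible] with p h1 h2 h3
  exact tendsto_of_abs_lt (h.tendsto_coefA p) (h.tendsto_coefB p) h.tendsto_eps h3 h2 h1

theorem isState_lim : IsState (limγ v μ t N G H) (limα v μ t N G H) := by
  have hst := h.isState
  have h1 := integrable_of_fatou (fun n => (hst n).integrable) (fun n => (hst n).nonneg)
    (h.ae_tendsto.mono fun p hp => hp.1) (k := fun _ => C) (fun n => by
      rw [← (hst n).integral_abs_eq]; exact h.integral_le n) tendsto_const_nhds
  have h2 := integrable_of_fatou (fun n => (hst n).integrable'.abs)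
    (fun n => ae_of_all _ fun _ => abs_nonneg _)
    (h.ae_tendsto.mono fun p hp => hp.2.abs) (k := fun _ => C) (fun n => h.integral_le' n)
    tendsto_const_nhds
  have h3 := integrable_of_fatou (fun n => (hst n).kin_integrable)
    (fun n => (hst n).nonneg.mono fun p hp => mul_nonneg (sq_nonneg _) hp)
    (h.ae_tendsto.mono fun p hp => hp.1.const_mul (‖p‖ ^ 2)) (k := fun _ => C)
    (fun n => h.kin_le n) tendsto_const_nhds
  have h4 : AEStronglyMeasurable (limα v μ t N G H) volume :=
    aestronglyMeasurable_of_tendsto_ae _ (fun n => (hst n).integrable'.1)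
      (h.ae_tendsto.mono fun p hp => hp.2)
  refine ⟨h1.1, (integrable_norm_iff h4).1 h2.1, h3.1, ?_⟩
  filter_upwards [h.ae_tendsto, ae_all_iff.2 fun n => (hst n).feasible] with p hp h5
  exact isClosed_feasible.mem_of_tendsto (hp.1.prodMk_nhds hp.2) (Eventually.of_forall h5)

/-- Equality at one p₀ ≠ 0 makes κ = A - σ B, which is nonnegative and radial, vanish on a whole
sphere. Bounded second differences at a minimum give κ ≤ K d² at distance d from it. Then A² - B² =
κ (A + σ B) is O(d²), and γ + 1/2 = A / (2 √(A² - B²)) is at least of order 1/d, which is not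
integrable. -/
theorem abs_limB_lt_limA {p₀ : Space} (hp₀ : p₀ ≠ 0) : |limB v t H p₀| < limA v μ t N G p₀ := by
  refine lt_of_le_of_ne (h.abs_limB_le_limA p₀) fun heq => ?_
  have hr : 0 < ‖p₀‖ := norm_pos_iff.2 hp₀
  obtain ⟨σ, hσ, hσ0⟩ : ∃ σ : ℝ, |σ| = 1 ∧ limA v μ t N G p₀ - σ * limB v t H p₀ = 0 := by
    rcases abs_choice (limB v t H p₀) with hb | hb
    · exact ⟨1, by simp, by rw [← heq, hb]; ring⟩
    · exact ⟨-1, by simp, by rw [← heq, hb]; ring⟩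
  set κ : Space → ℝ := fun p => limA v μ t N G p - σ * limB v t H p with hκ
  have hσB : ∀ p, |σ * limB v t H p| ≤ limA v μ t N G p := fun p => by
    rw [abs_mul, hσ, one_mul]; exact h.abs_limB_le_limA p
  have hκ0 : ∀ p, 0 ≤ κ p := fun p => sub_nonneg.2 ((le_abs_self _).trans (hσB p))
  -- The first 2 is the second difference of ‖p‖²; A and B each contribute the constant of a
  -- potential and that of t v.
  set K := 2 + 2 * (c₃ * M * C + t * M) with hK
  have hK0 : 0 < K := by
    have := h.cM_nonneg
    have := mul_pos h.t_pos h.kernel.M_pos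
    positivity
  have hquad : ∀ k, κ (p₀ + k) ≤ K * ‖k‖ ^ 2 := fun k => by
    have h1 := h.G_second_diff p₀ k
    have h2 := h.H_second_diff p₀ k
    have h3 := h.kernel.second_diff p₀ k
    have h4 := parallelogram_law_with_norm ℝ p₀ k
    set dG := G (p₀ + k) + G (p₀ - k) - 2 * G p₀
    set dH := H (p₀ + k) + H (p₀ - k) - 2 * H p₀
    set dv := v (p₀ + k) + v (p₀ - k) - 2 * v p₀
    have e : κ (p₀ + k) + κ (p₀ - k) - 2 * κ p₀
        = 2 * ‖k‖ ^ 2 + dG + t * dv - σ * (dH + t * dv) := by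
      have h5 : ‖p₀ + k‖ ^ 2 + ‖p₀ - k‖ ^ 2 - 2 * ‖p₀‖ ^ 2 = 2 * ‖k‖ ^ 2 := by
        linear_combination h4
      simp only [hκ, limA, limB, dG, dH, dv]
      linear_combination h5
    have h6 : t * dv ≤ t * (M * ‖k‖ ^ 2) :=
      mul_le_mul_of_nonneg_left ((le_abs_self _).trans h3) h.t_pos.le
    have h7 : -(σ * (dH + t * dv)) ≤ c₃ * M * C * ‖k‖ ^ 2 + t * (M * ‖k‖ ^ 2) := by
      refine (neg_le_abs _).trans ?_
      rw [abs_mul, hσ, one_mul]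
      refine (abs_add_le _ _).trans (add_le_add h2 ?_)
      rw [abs_mul, abs_of_pos h.t_pos]
      exact mul_le_mul_of_nonneg_left h3 h.t_pos.le
    have h8 : κ p₀ = 0 := hσ0
    have h9 := hκ0 (p₀ - k)
    have h10 := le_abs_self dG
    rw [hK]
    linarith
  have hrad : ∀ p, κ p ≤ K * |‖p‖ - ‖p₀‖| ^ 2 := fun p => by
    set q : Space := (‖p‖ / ‖p₀‖) • p₀ with hq
    have hqn : ‖q‖ = ‖p‖ := by
      rw [hq, norm_smul, Real.norm_eq_abs, abs_of_nonneg (by positivity)]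
      field_simp
    have h1 : κ p = κ q := by
      simp only [hκ]
      rw [h.radial_limA p q hqn.symm, h.radial_limB p q hqn.symm]
    have h2 := hquad (q - p₀)
    have h3 : ‖q - p₀‖ = |‖p‖ - ‖p₀‖| := by
      have : q - p₀ = ((‖p‖ - ‖p₀‖) / ‖p₀‖) • p₀ := by
        rw [hq, sub_div, div_self hr.ne', sub_smul, one_smul]
      rw [this, norm_smul, Real.norm_eq_abs, abs_div, abs_of_pos hr]
      field_simp
    rw [add_sub_cancel, h3] at h2
    rw [h1]
    exact h2
  -- The constant b comes from S² ≤ 2 A K d² and A ≥ ‖p₀‖²/4 for ‖p‖ ≥ ‖p₀‖/2: (d A / (2 S))² ≥ A /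
  -- (8 K) ≥ ‖p₀‖² / (32 K).
  refine not_integrable_of_inv_dist_sphere (r := ‖p₀‖) (b := ‖p₀‖ / √(32 * K)) (c := 1 / 2)
    h.isState_lim.integrable hr (by positivity) ?_
  filter_upwards [h.ae_abs_limB_lt_limA] with p hp hpr
  set A := limA v μ t N G p with hA
  set B := limB v t H p with hB
  set S := √(A ^ 2 - B ^ 2) with hS
  have hd : 0 < A ^ 2 - B ^ 2 := by
    have := sq_lt_sq' (by linarith [abs_nonneg B]) hp
    rw [sq_abs] at this
    linarith
  have hS0 : 0 < S := Real.sqrt_pos.2 hd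
  have hSS : S ^ 2 = A ^ 2 - B ^ 2 := Real.sq_sqrt hd.le
  have hA0 : 0 < A := (abs_nonneg _).trans_lt hp
  have hAr : ‖p₀‖ ^ 2 / 4 ≤ A := by
    have h1 := h.sq_norm_le_limA p
    have h2 := pow_le_pow_left₀ (by positivity) hpr 2
    rw [hA]
    linarith
  have hσ2 : σ ^ 2 = 1 := by rw [← sq_abs, hσ, one_pow]
  have hSκ : S ^ 2 ≤ 2 * A * (K * |‖p‖ - ‖p₀‖| ^ 2) := by
    have h1 : S ^ 2 = κ p * (A + σ * B) := by
      rw [hSS]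
      simp only [hκ, ← hA, ← hB]
      linear_combination (B ^ 2) * hσ2
    rw [h1, mul_comm]
    have h2 := (le_abs_self _).trans (hσB p)
    exact mul_le_mul (by linarith) (hrad p) (hκ0 p) (by positivity)
  have hlim : limγ v μ t N G H p + 1 / 2 = A / (2 * S) := by
    simp only [limγ, ← hA, ← hB, ← hS]; ring
  rw [hlim]
  set d := |‖p‖ - ‖p₀‖| with hdd
  have hd0 : 0 ≤ d := abs_nonneg _
  have hsq : √(32 * K) ^ 2 = 32 * K := Real.sq_sqrt (by positivity)
  set w := √(32 * K) with hw
  have hw0 : 0 < w := Real.sqrt_pos.2 (by positivity)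
  rw [mul_div_assoc', div_le_div_iff₀ hw0 (by positivity)]
  refine (abs_le_of_sq_le_sq' ?_ (by positivity)).2
  have h1 : (d * A * w) ^ 2 = 32 * K * d ^ 2 * A ^ 2 := by
    rw [mul_pow, hsq]; ring
  have h2 : (‖p₀‖ * (2 * S)) ^ 2 = 4 * ‖p₀‖ ^ 2 * S ^ 2 := by ring
  rw [h1, h2]
  calc 4 * ‖p₀‖ ^ 2 * S ^ 2 ≤ 4 * (4 * A) * (2 * A * (K * d ^ 2)) :=
        mul_le_mul (by linarith) hSκ (sq_nonneg _) (by positivity)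
    _ = _ := by ring

/-- Away from the origin the coefficients are eventually uniformly separated. -/
theorem exists_gap {η k : ℝ} (hη : 0 < η) : ∃ δ > 0, ∀ᶠ n in atTop, ∀ p : Space, η ≤ ‖p‖ →
    ‖p‖ ≤ k → δ ≤ coefA v μ (γ n) t p - |coefB v (α n) t p| := by
  set K : Set Space := tail η ∩ Metric.closedBall 0 k with hKdef
  have hK : IsCompact K := (isCompact_closedBall 0 k).inter_left
    (isClosed_le continuous_const continuous_norm)
  suffices ∃ δ > 0, ∀ᶠ n in atTop, ∀ p ∈ K, δ ≤ coefA v μ (γ n) t p - |coefB v (α n) t p| by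
    obtain ⟨δ, hδ, hev⟩ := this
    exact ⟨δ, hδ, hev.mono fun n hn p h1 h2 => hn p ⟨h1, by simpa using h2⟩⟩
  -- Near each point the common Lipschitz constants make the gap uniform in large n; compactness
  -- glues the local gaps.
  refine hK.induction_on (p := fun s => ∃ δ > 0, ∀ᶠ n in atTop, ∀ p ∈ s,
    δ ≤ coefA v μ (γ n) t p - |coefB v (α n) t p|) ⟨1, one_pos, by simp⟩ ?_ ?_ ?_
  · rintro s s' hs ⟨δ, hδ, hev⟩
    exact ⟨δ, hδ, hev.mono fun n hn p hp => hn p (hs hp)⟩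
  · rintro s s' ⟨δ, hδ, hev⟩ ⟨δ', hδ', hev'⟩
    refine ⟨min δ δ', lt_min hδ hδ', ?_⟩
    filter_upwards [hev, hev'] with n h1 h2 p hp
    rcases hp with hp | hp
    · exact (min_le_left _ _).trans (h1 p hp)
    · exact (min_le_right _ _).trans (h2 p hp)
  · intro p₀ hp₀
    have hne : p₀ ≠ 0 := norm_pos_iff.1 (hη.trans_le hp₀.1)
    set gap := limA v μ t N G p₀ - |limB v t H p₀| with hgap
    have hgap0 : 0 < gap := sub_pos.2 (h.abs_limB_lt_limA hne)
    set L := c₃ * M * C + t * M with hL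
    let ω : Space → ℝ := fun p => |‖p‖ ^ 2 - ‖p₀‖ ^ 2| + 2 * (L * ‖p - p₀‖)
    have hω : Tendsto ω (𝓝 p₀) (𝓝 0) := by
      have : Continuous ω := by fun_prop
      simpa [ω] using this.tendsto p₀
    refine ⟨{p | ω p < gap / 2}, mem_nhdsWithin_of_mem_nhds
      (hω.eventually (gt_mem_nhds (half_pos hgap0))), gap / 4, by positivity, ?_⟩
    have hlim : Tendsto (fun n => coefA v μ (γ n) t p₀ - |coefB v (α n) t p₀|) atTop (𝓝 gap) :=
      (h.tendsto_coefA p₀).sub (h.tendsto_coefB p₀).abs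
    filter_upwards [hlim.eventually (lt_mem_nhds (by linarith : 3 / 4 * gap < gap))] with n hn p hp
    have hp' : ω p < gap / 2 := hp
    have hv : |t * v p - t * v p₀| ≤ t * M * ‖p - p₀‖ := by
      rw [← mul_sub, abs_mul, abs_of_pos h.t_pos, mul_assoc]
      exact mul_le_mul_of_nonneg_left (h.kernel.lipschitz p p₀) h.t_pos.le
    have hG := h.pot_lipschitz n p p₀
    have hH := h.pot_lipschitz' n p p₀
    have hBd : |coefB v (α n) t p - coefB v (α n) t p₀| ≤ L * ‖p - p₀‖ := by
      have e : coefB v (α n) t p - coefB v (α n) t p₀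
        = (pot v (α n) p - pot v (α n) p₀) + (t * v p - t * v p₀) := by unfold coefB; ring
      rw [e, hL, add_mul]
      exact (abs_add_le _ _).trans (add_le_add hH hv)
    have hAd : coefA v μ (γ n) t p₀ - coefA v μ (γ n) t p
        ≤ |‖p‖ ^ 2 - ‖p₀‖ ^ 2| + L * ‖p - p₀‖ := by
      have e : coefA v μ (γ n) t p₀ - coefA v μ (γ n) t p
        = -(‖p‖ ^ 2 - ‖p₀‖ ^ 2) - (pot v (γ n) p - pot v (γ n) p₀) - (t * v p - t * v p₀) := by
        unfold coefA; ring
      rw [e, hL, add_mul]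
      linarith [neg_le_abs (‖p‖ ^ 2 - ‖p₀‖ ^ 2), neg_le_abs (pot v (γ n) p - pot v (γ n) p₀),
        neg_le_abs (t * v p - t * v p₀)]
    have h1 := abs_sub_abs_le_abs_sub (coefB v (α n) t p) (coefB v (α n) t p₀)
    simp only [ω] at hp'
    linarith

/-- From A γ + B α ≤ 0 and |α| ≤ γ + 1/2 follows (A - |B|) γ ≤ |B| / 2, so the uniform gap bounds γ
and then α. -/
theorem exists_bound {η k : ℝ} (hη : 0 < η) : ∃ D : ℝ, ∀ᶠ n in atTop, ∀ᵐ p : Space, η ≤ ‖p‖ →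
    ‖p‖ ≤ k → |γ n p| ≤ D ∧ |α n p| ≤ D := by
  obtain ⟨δ, hδ, hev⟩ := h.exists_gap (k := k) hη
  set CB := M * C + 1 / 2 * mass v with hCB
  refine ⟨CB / (2 * δ) + 1 / 2, ?_⟩
  filter_upwards [hev] with n hn
  filter_upwards [h.le_zero n, (h.isState n).feasible] with p h1 h2 h3 h4
  have h5 := hn p h3 h4
  have h6 := h.kernel.abs_coefB_le_const (h.isState n) h.t_pos.le p
  have h7 := mul_le_mul_of_nonneg_left (h.mass_le n) h.kernel.M_pos.le
  have h8 := h2.abs_le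
  have h9 := h2.1
  have h10 := neg_abs_le (coefB v (α n) t p * α n p)
  rw [abs_mul] at h10
  have h11 := mul_le_mul_of_nonneg_left h8 (abs_nonneg (coefB v (α n) t p))
  have h12 := mul_le_mul_of_nonneg_right h5 h9
  have h13 : γ n p ≤ CB / (2 * δ) := by
    rw [le_div_iff₀ (by positivity)]
    linarith
  rw [abs_of_nonneg h9]
  exact ⟨by linarith, by linarith⟩

theorem tendsto_tail {η : ℝ} (hη : 0 < η) :
    Tendsto (fun n => ∫ p, |(tail η).indicator (γ n) p - (tail η).indicator (limγ v μ t N G H) p|)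
      atTop (𝓝 0) ∧
    Tendsto (fun n => ∫ p, |(tail η).indicator (α n) p - (tail η).indicator (limα v μ t N G H) p|)
      atTop (𝓝 0) := by
  constructor
  · refine tendsto_integral_abs_tail (fun n => (h.isState n).integrable) h.isState_lim.integrable
      (h.ae_tendsto.mono fun p hp => hp.1) (fun k => ?_) h.tail_le
    obtain ⟨D, hD⟩ := h.exists_bound (k := k) hη
    exact ⟨D, hD.mono fun n hn => hn.mono fun p hp h1 h2 => (hp h1 h2).1⟩
  · refine tendsto_integral_abs_tail (fun n => (h.isState n).integrable') h.isState_lim.integrable'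
      (h.ae_tendsto.mono fun p hp => hp.2) (fun k => ?_) h.tail_le'
    obtain ⟨D, hD⟩ := h.exists_bound (k := k) hη
    exact ⟨D, hD.mono fun n hn => hn.mono fun p hp h1 h2 => (hp h1 h2).2⟩

end IsConvSeq

/-! ### Transferring mass near the origin into the condensate -/

/-- The smaller of the energies of `(γ, α, t)` and `(γ, -α, t)`. -/
def energyMin (v : Space → ℝ) (μ : ℝ) (γ α : Space → ℝ) (t : ℝ) : ℝ :=
  kin γ - μ * (t + mass γ) + v 0 / 2 * (t + mass γ) ^ 2 + 1 / 2 * (dbl v α α + dbl v γ γ)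
    + t * (lin v γ - |lin v α|)

theorem IsState.neg {γ α : Space → ℝ} (h : IsState γ α) : IsState γ (fun p => -α p) :=
  ⟨h.integrable, h.integrable'.neg, h.kin_integrable, h.feasible.mono fun _ hp => hp.neg⟩

/-- Only t `lin v α` is odd in α, so flipping α selects its sign. The absolute value in `energyMin`
is continuous, and no sign has to be fixed along a sequence. -/
theorem IsState.exists_energy_eq_energyMin {γ α : Space → ℝ} (h : IsState γ α)
    (v : Space → ℝ) (μ t : ℝ) : ∃ β, IsState γ β ∧ energy v μ γ β t = energyMin v μ γ α t := by
  rcases abs_choice (lin v α) with hα | hα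
  · refine ⟨_, h.neg, ?_⟩
    have h1 : lin v (fun p => -α p) = -lin v α := by
      unfold lin; rw [← mul_neg, ← integral_neg]; simp only [mul_neg]
    have h2 : dbl v (fun p => -α p) (fun p => -α p) = dbl v α α := by
      unfold dbl; simp only [neg_mul_neg]
    unfold energy energyMin
    rw [h1, h2, hα]
    ring
  · refine ⟨α, h, ?_⟩
    unfold energy energyMin
    rw [hα]
    ring

theorem integrable_norm_sq_mul_indicator {f : Space → ℝ} {S : Set Space} (hS : MeasurableSet S)
    (hf : Integrable fun p : Space => ‖p‖ ^ 2 * f p) :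
    Integrable fun p : Space => ‖p‖ ^ 2 * S.indicator f p :=
  (hf.indicator hS).congr (ae_of_all _ fun p => by
    by_cases hp : p ∈ S <;> simp [hp])

theorem IsState.indicator {γ α : Space → ℝ} (h : IsState γ α) {S : Set Space}
    (hS : MeasurableSet S) : IsState (S.indicator γ) (S.indicator α) := by
  refine ⟨h.integrable.indicator hS, h.integrable'.indicator hS,
    integrable_norm_sq_mul_indicator hS h.kin_integrable, ?_⟩
  filter_upwards [h.feasible] with p hp
  by_cases hpS : p ∈ S
  · simpa only [Set.indicator_of_mem hpS] using hp
  · simpa only [Set.indicator_of_notMem hpS] using feasible_zero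

theorem eq_indicator_add (S : Set Space) (f : Space → ℝ) :
    f = fun p => S.indicator f p + 1 * Sᶜ.indicator f p := by
  ext p
  rw [one_mul]
  exact (Set.indicator_self_add_compl_apply S f p).symm

theorem integral_abs_indicator_le {f : Space → ℝ} (hf : Integrable f) {S : Set Space}
    (hS : MeasurableSet S) : ∫ p, |S.indicator f p| ≤ ∫ p, |f p| := by
  refine integral_mono (hf.indicator hS).abs hf.abs fun p => ?_
  by_cases hp : p ∈ S <;> simp [hp]

section kernel

variable {v : Space → ℝ} {M : ℝ} (hv : IsKernel v M)
include hv

/-- A function concentrated near the origin acts like a point mass there, hence like a condensate of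
density `mass g`; the Lipschitz constant of v measures the error. -/
theorem IsKernel.abs_pot_sub_mass_mul_le {g : Space → ℝ} {η : ℝ} (hg : Integrable g)
    (hsupp : ∀ p, η < ‖p‖ → g p = 0) (p : Space) :
    |pot v g p - mass g * v p| ≤ c₃ * M * η * ∫ q, |g q| := by
  unfold pot mass
  rw [mul_assoc, ← mul_sub, ← integral_mul_const,
    ← integral_sub (hv.integrable_sub_mul hg p) (hg.mul_const _), abs_mul, abs_of_pos c₃_pos,
    mul_assoc, mul_assoc, ← integral_const_mul, ← integral_const_mul]
  refine mul_le_mul_of_nonneg_left (abs_integral_le_integral_abs.trans (integral_mono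
    ((hv.integrable_sub_mul hg p).sub (hg.mul_const _)).abs ((hg.abs.const_mul _).const_mul _)
    fun q => ?_)) c₃_pos.le
  simp only
  by_cases hq : η < ‖q‖
  · simp [hsupp q hq]
  · have h1 := hv.lipschitz (p - q) p
    rw [sub_sub_cancel_left, norm_neg] at h1
    have h2 := h1.trans (mul_le_mul_of_nonneg_left (not_lt.1 hq) hv.M_pos.le)
    calc |v (p - q) * g q - g q * v p| = |v (p - q) - v p| * |g q| := by
          rw [← abs_mul]; congr 1; ring
      _ ≤ M * η * |g q| := mul_le_mul_of_nonneg_right h2 (abs_nonneg _)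
      _ = M * (η * |g q|) := by ring

theorem IsKernel.abs_dbl_sub_le {f g : Space → ℝ} {η : ℝ} (hf : Integrable f) (hg : Integrable g)
    (hsupp : ∀ p, η < ‖p‖ → g p = 0) :
    |dbl v f g - mass g * lin v f| ≤ c₃ ^ 2 * M * η * ((∫ q, |f q|) * ∫ q, |g q|) := by
  have i1 : Integrable fun p => f p * pot v g p :=
    (hv.integrable_pot_mul hg hf).congr (ae_of_all _ fun p => mul_comm _ _)
  have i2 := (hv.integrable_mul hf).const_mul (mass g)
  rw [hv.dbl_eq hf hg]
  unfold lin
  rw [mul_left_comm, ← mul_sub, ← integral_const_mul, ← integral_sub i1 i2, abs_mul,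
    abs_of_pos c₃_pos]
  have h1 : |∫ p, (f p * pot v g p - mass g * (v p * f p))|
      ≤ (c₃ * M * η * ∫ q, |g q|) * ∫ q, |f q| := by
    rw [← integral_const_mul]
    refine abs_integral_le_integral_abs.trans (integral_mono (i1.sub i2).abs
      (hf.abs.const_mul _) fun p => ?_)
    simp only
    rw [show f p * pot v g p - mass g * (v p * f p) = (pot v g p - mass g * v p) * f p by ring,
      abs_mul]
    exact mul_le_mul_of_nonneg_right (hv.abs_pot_sub_mass_mul_le hg hsupp p) (abs_nonneg _)
  refine (mul_le_mul_of_nonneg_left h1 c₃_pos.le).trans (le_of_eq (by ring))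

/-- Moving the mass of `γ` near the origin into the condensate does not raise the energy much,
up to a change of sign of `α`. -/
theorem IsKernel.energyMin_tail_le {γ α : Space → ℝ} (h : IsState γ α) (μ : ℝ) {t η C : ℝ}
    (ht : 0 ≤ t) (hη : 0 < η) (hγC : ∫ p, |γ p| ≤ C) (hαC : ∫ p, |α p| ≤ C) :
    energyMin v μ ((tail η).indicator γ) ((tail η).indicator α)
        (t + (mass γ - mass ((tail η).indicator γ)))
      ≤ energy v μ γ α t + (2 * (c₃ ^ 2 * M * C ^ 2) * η
        + (t * c₃ * M + c₃ ^ 2 * M * C) * volume.real (Metric.ball (0 : Space) η)) := by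
  set T := tail η with hT
  have hTm : MeasurableSet T := measurableSet_tail η
  set γ₁ := T.indicator γ with hγ₁
  set γ₂ := Tᶜ.indicator γ with hγ₂
  set α₁ := T.indicator α with hα₁
  set α₂ := Tᶜ.indicator α with hα₂
  set W := volume.real (Metric.ball (0 : Space) η) with hW
  have hW0 : 0 ≤ W := measureReal_nonneg
  have hc := c₃_pos
  have hM := hv.M_pos
  have s1 : IsState γ₁ α₁ := h.indicator hTm
  have s2 : IsState γ₂ α₂ := h.indicator hTm.compl
  have eγ : γ = fun p => γ₁ p + 1 * γ₂ p := eq_indicator_add T γ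
  have eα : α = fun p => α₁ p + 1 * α₂ p := eq_indicator_add T α
  have hC0 : 0 ≤ C := (integral_nonneg fun _ => abs_nonneg _).trans hγC
  have b1 := (integral_abs_indicator_le h.integrable hTm).trans hγC
  have b2 := (integral_abs_indicator_le h.integrable hTm.compl).trans hγC
  have b3 := (integral_abs_indicator_le h.integrable' hTm).trans hαC
  have b4 := (integral_abs_indicator_le h.integrable' hTm.compl).trans hαC
  have m1 : mass γ = mass γ₁ + mass γ₂ := by
    conv_lhs => rw [eγ]
    rw [mass_line s1.integrable s2.integrable]; ring
  have m2 : kin γ = kin γ₁ + kin γ₂ := by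
    conv_lhs => rw [eγ]
    rw [kin_line s1.kin_integrable s2.kin_integrable]; ring
  have m3 : dbl v γ γ = dbl v γ₁ γ₁ + 2 * dbl v γ₁ γ₂ + dbl v γ₂ γ₂ := by
    conv_lhs => rw [eγ]
    rw [hv.dbl_line s1.integrable s2.integrable]; ring
  have m4 : dbl v α α = dbl v α₁ α₁ + 2 * dbl v α₁ α₂ + dbl v α₂ α₂ := by
    conv_lhs => rw [eα]
    rw [hv.dbl_line s1.integrable' s2.integrable']; ring
  have m5 : lin v γ = lin v γ₁ + lin v γ₂ := by
    conv_lhs => rw [eγ]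
    rw [hv.lin_line s1.integrable s2.integrable]; ring
  have m6 : lin v α = lin v α₁ + lin v α₂ := by
    conv_lhs => rw [eα]
    rw [hv.lin_line s1.integrable' s2.integrable']; ring
  have hsupp : ∀ (f : Space → ℝ) p, η < ‖p‖ → Tᶜ.indicator f p = 0 := fun f p hp =>
    Set.indicator_of_notMem (fun hp' : p ∈ Tᶜ => hp' (show η ≤ ‖p‖ from hp.le)) f
  have hCC : ∀ {x y : ℝ}, 0 ≤ x → 0 ≤ y → x ≤ C → y ≤ C → c₃ ^ 2 * M * η * (x * y)
      ≤ c₃ ^ 2 * M * C ^ 2 * η := fun {x y} hx hy hxC hyC => by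
    have : x * y ≤ C * C := mul_le_mul hxC hyC hy hC0
    calc c₃ ^ 2 * M * η * (x * y) ≤ c₃ ^ 2 * M * η * (C * C) :=
          mul_le_mul_of_nonneg_left this (by positivity)
      _ = _ := by ring
  -- The cross terms see the inner parts as condensate. The kinetic energy of γ₂ and the
  -- self-interactions of γ₂ and α₂ are nonnegative and dropped at the end.
  have d1 : mass γ₂ * lin v γ₁ - c₃ ^ 2 * M * C ^ 2 * η ≤ dbl v γ₁ γ₂ := by
    have h1 := (_root_.abs_le.1 (hv.abs_dbl_sub_le s1.integrable s2.integrable (hsupp γ))).1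
    have h2 := hCC (integral_nonneg fun p => abs_nonneg (γ₁ p))
      (integral_nonneg fun p => abs_nonneg (γ₂ p)) b1 b2
    linarith
  have d2 : mass α₂ * lin v α₁ - c₃ ^ 2 * M * C ^ 2 * η ≤ dbl v α₁ α₂ := by
    have h1 := (_root_.abs_le.1 (hv.abs_dbl_sub_le s1.integrable' s2.integrable' (hsupp α))).1
    have h2 := hCC (integral_nonneg fun p => abs_nonneg (α₁ p))
      (integral_nonneg fun p => abs_nonneg (α₂ p)) b3 b4
    linarith
  have hball : Tᶜ = Metric.ball (0 : Space) η := compl_tail η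
  have hBi : Integrable (Tᶜ.indicator fun _ => (1 / 2 : ℝ)) := by
    rw [hball]
    exact (integrable_indicator_iff Metric.isOpen_ball.measurableSet).2
      (integrableOn_const measure_ball_lt_top.ne)
  have hBv : ∫ p, Tᶜ.indicator (fun _ => (1 / 2 : ℝ)) p = W / 2 := by
    rw [hball, integral_indicator Metric.isOpen_ball.measurableSet, setIntegral_const,
      smul_eq_mul]
    ring
  have hpt : ∀ᵐ p, |α₂ p| ≤ γ₂ p + Tᶜ.indicator (fun _ => (1 / 2 : ℝ)) p := by
    filter_upwards [h.feasible] with p hp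
    by_cases hpT : p ∈ Tᶜ
    · simpa only [hα₂, hγ₂, Set.indicator_of_mem hpT] using hp.abs_le
    · simp only [hα₂, hγ₂, Set.indicator_of_notMem hpT]; simp
  have l1 : -(c₃ * M * (W / 2)) ≤ lin v γ₂ + lin v α₂ := by
    unfold lin
    rw [← mul_add, ← integral_add (hv.integrable_mul s2.integrable)
      (hv.integrable_mul s2.integrable'), mul_assoc, ← mul_neg, ← hBv, ← integral_const_mul,
      ← integral_neg]
    refine mul_le_mul_of_nonneg_left (integral_mono_ae (hBi.const_mul M).neg
      ((hv.integrable_mul s2.integrable).add (hv.integrable_mul s2.integrable')) ?_) hc.le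
    filter_upwards [hpt] with p hp
    have h1 := (_root_.abs_le.1 hp).1
    have h2 : 0 ≤ Tᶜ.indicator (fun _ => (1 / 2 : ℝ)) p :=
      Set.indicator_nonneg (fun _ _ => by norm_num) p
    have h3 := mul_le_mul_of_nonneg_right (hv.le p) h2
    have h4 := mul_nonneg (hv.nonneg p)
      (by linarith : 0 ≤ γ₂ p + α₂ p + Tᶜ.indicator (fun _ => (1 / 2 : ℝ)) p)
    linarith
  -- The pairing mass removed is at most the mass of γ₂ now added to the condensate, up to half the
  -- volume of the ball.
  have l2 : |mass α₂| ≤ mass γ₂ + c₃ * (W / 2) := by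
    refine (abs_mass_le α₂).trans ?_
    unfold mass
    rw [← mul_add, ← hBv, ← integral_add s2.integrable hBi]
    exact mul_le_mul_of_nonneg_left (integral_mono_ae s2.integrable'.abs
      (s2.integrable.add hBi) hpt) hc.le
  have l3 : |lin v α₁| ≤ c₃ * M * C :=
    (hv.abs_lin_le s1.integrable').trans (mul_le_mul_of_nonneg_left b3 (by positivity))
  have n1 := kin_nonneg s2.nonneg
  have n2 := hv.dbl_self_nonneg s2.integrable
  have n3 := hv.dbl_self_nonneg s2.integrable'
  have n4 := mass_nonneg s2.nonneg
  -- The sign of `lin v α₁` is unknown; the worst case is exactly what the favourable sign in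
  -- `energyMin` achieves.
  have l4 : -((t + mass γ₂) * |lin v α₁| + c₃ * (W / 2) * (c₃ * M * C))
      ≤ (t + mass α₂) * lin v α₁ := by
    have h1 := neg_abs_le ((t + mass α₂) * lin v α₁)
    rw [abs_mul] at h1
    have h2 : |t + mass α₂| ≤ t + mass γ₂ + c₃ * (W / 2) := by
      refine (abs_add_le _ _).trans ?_
      rw [abs_of_nonneg ht]
      linarith
    have h3 := mul_le_mul_of_nonneg_right h2 (abs_nonneg (lin v α₁))
    have h4 := mul_le_mul_of_nonneg_left l3 (by positivity : 0 ≤ c₃ * (W / 2))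
    linarith
  have l5 := mul_le_mul_of_nonneg_left l1 ht
  have e1 : 0 ≤ t * c₃ * M * W := by positivity
  have e2 : 0 ≤ c₃ ^ 2 * M * C * W := by positivity
  have e3 : t + (mass γ - mass γ₁) = t + mass γ₂ := by rw [m1]; ring
  rw [e3]
  unfold energyMin energy
  rw [m1, m2, m3, m4, m5, m6, show t + mass γ₂ + mass γ₁ = t + (mass γ₁ + mass γ₂) by ring]
  linarith

/-- All terms except the kinetic energy are continuous under L¹ convergence; Fatou's lemma with the
n-dependent bound handles that one. -/
theorem IsKernel.energyMin_le_of_tendsto {f g : ℕ → Space → ℝ} {γ α : Space → ℝ} {s l : ℕ → ℝ}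
    {t L μ : ℝ} (hst : ∀ n, IsState (f n) (g n)) (hs : IsState γ α)
    (hae : ∀ᵐ p, Tendsto (fun n => f n p) atTop (𝓝 (γ p)))
    (h1 : Tendsto (fun n => ∫ p, |f n p - γ p|) atTop (𝓝 0))
    (h2 : Tendsto (fun n => ∫ p, |g n p - α p|) atTop (𝓝 0))
    (ht : Tendsto s atTop (𝓝 t)) (hl : Tendsto l atTop (𝓝 L))
    (hle : ∀ n, energyMin v μ (f n) (g n) (s n) ≤ l n) : energyMin v μ γ α t ≤ L := by
  have i1 := fun n => (hst n).integrable
  have i2 := fun n => (hst n).integrable'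
  have t1 := tendsto_mass i1 hs.integrable h1
  have t3 := hv.tendsto_dbl i1 hs.integrable h1
  have t4 := hv.tendsto_dbl i2 hs.integrable' h2
  have t5 := hv.tendsto_lin i1 hs.integrable h1
  have t6 := hv.tendsto_lin i2 hs.integrable' h2
  let rest : (Space → ℝ) → (Space → ℝ) → ℝ → ℝ := fun γ α t =>
    -(μ * (t + mass γ)) + v 0 / 2 * (t + mass γ) ^ 2 + 1 / 2 * (dbl v α α + dbl v γ γ)
      + t * (lin v γ - |lin v α|)
  have hrest : Tendsto (fun n => rest (f n) (g n) (s n)) atTop (𝓝 (rest γ α t)) :=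
    ((((ht.add t1).const_mul μ).neg.add (((ht.add t1).pow 2).const_mul (v 0 / 2))).add
      ((t4.add t3).const_mul (1 / 2))).add (ht.mul (t5.sub t6.abs))
  have e : ∀ γ α t, energyMin v μ γ α t = kin γ + rest γ α t := fun γ α t => by
    simp only [energyMin, rest]; ring
  have hk := integrable_of_fatou (fun n => (hst n).kin_integrable)
    (fun n => (hst n).nonneg.mono fun p hp => mul_nonneg (sq_nonneg ‖p‖) hp)
    (hae.mono fun p hp => hp.const_mul (‖p‖ ^ 2))
    (k := fun n => (l n - rest (f n) (g n) (s n)) / c₃)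
    (fun n => by
      rw [le_div_iff₀ c₃_pos, mul_comm]
      have := hle n
      rw [e] at this
      exact le_sub_iff_add_le.2 this) ((hl.sub hrest).div_const c₃)
  have h3 := hk.2
  rw [le_div_iff₀ c₃_pos, mul_comm] at h3
  rw [e]
  exact le_sub_iff_add_le.1 h3

end kernel

/-! ### Passage to the limit and existence at energy I -/

namespace IsConvSeq

variable {v : Space → ℝ} {M μ t I : ℝ} {R ε : ℕ → ℝ} {γ α : ℕ → Space → ℝ}
  {N C r₀ : ℝ} {G H : Space → ℝ} (h : IsConvSeq v M μ t I R ε γ α N C r₀ G H)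
include h

theorem mass_limγ_le : mass (limγ v μ t N G H) ≤ N := by
  have h1 := integrable_of_fatou (fun n => (h.isState n).integrable)
    (fun n => (h.isState n).nonneg) (h.ae_tendsto.mono fun p hp => hp.1)
    (k := fun n => mass (γ n) / c₃) (fun n => by
      rw [le_div_iff₀ c₃_pos, mul_comm]
      exact le_rfl) (h.tendsto_mass.div_const c₃)
  have h2 := h1.2
  rwa [le_div_iff₀ c₃_pos, mul_comm] at h2

/-- The lost mass N - `mass` of the limit can only have gone to the origin, so it is added to ρ₀.
The limit n → ∞ is taken first, with a ball of radius η cut out so that L¹ convergence holds; then η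
→ 0. -/
theorem exists_energy_le : ∃ γ α s, IsState γ α ∧ 0 ≤ s ∧ energy v μ γ α s ≤ I := by
  set g := limγ v μ t N G H with hg
  set a := limα v μ t N G H with ha
  have hs : IsState g a := h.isState_lim
  let err : ℝ → ℝ := fun η => 2 * (c₃ ^ 2 * M * C ^ 2) * η
        + (t * c₃ * M + c₃ ^ 2 * M * C) * volume.real (Metric.ball (0 : Space) η)
  have hcut : ∀ η, 0 < η → energyMin v μ ((tail η).indicator g) ((tail η).indicator a)
      (t + (N - mass ((tail η).indicator g))) ≤ I + err η := fun η hη => by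
    have hT := measurableSet_tail η
    have hst := fun n => (h.isState n).indicator hT
    refine h.kernel.energyMin_le_of_tendsto (f := fun n => (tail η).indicator (γ n))
      (g := fun n => (tail η).indicator (α n)) (l := fun n => energy v μ (γ n) (α n) t + err η)
      hst (hs.indicator hT) ?_ (h.tendsto_tail hη).1
      (h.tendsto_tail hη).2 ?_ (h.tendsto_energy.add_const _)
      (fun n => h.kernel.energyMin_tail_le (h.isState n) μ h.t_pos.le hη (h.integral_le n)
        (h.integral_le' n))
    · filter_upwards [h.ae_tendsto] with p hp
      by_cases hpT : p ∈ tail η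
      · simpa only [Set.indicator_of_mem hpT] using hp.1
      · simp only [Set.indicator_of_notMem hpT, tendsto_const_nhds]
    · exact (h.tendsto_mass.sub (Bogoliubov.tendsto_mass (fun n => (hst n).integrable)
        (hs.indicator hT).integrable (h.tendsto_tail hη).1)).const_add t
  let η : ℕ → ℝ := fun k => 1 / ((k : ℝ) + 1)
  have hη0 : ∀ k, 0 < η k := fun k => Nat.one_div_pos_of_nat
  have hη : Tendsto η atTop (𝓝 0) := tendsto_one_div_add_atTop_nhds_zero_nat
  have herr : Tendsto (fun k => err (η k)) atTop (𝓝 0) := by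
    have e : ∀ k, volume.real (Metric.ball (0 : Space) (η k))
        = η k ^ 3 * volume.real (Metric.ball (0 : Space) 1) := fun k => by
      rw [measureReal_def, Measure.addHaar_ball _ _ (hη0 k).le, ENNReal.toReal_mul,
        ENNReal.toReal_ofReal (by have := hη0 k; positivity), finrank_euclideanSpace_fin]
      rfl
    have h1 := (hη.const_mul (2 * (c₃ ^ 2 * M * C ^ 2))).add
      (((hη.pow 3).mul_const (volume.real (Metric.ball (0 : Space) 1))).const_mul
        (t * c₃ * M + c₃ ^ 2 * M * C))
    simp only [err, e]
    simpa using h1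
  have hev : ∀ p : Space, p ≠ 0 → ∀ᶠ k in atTop, p ∈ tail (η k) := fun p hp =>
    (hη.eventually (gt_mem_nhds (norm_pos_iff.2 hp))).mono fun k hk => hk.le
  have h0 : ∀ᵐ p : Space, p ≠ 0 := by
    rw [ae_iff]; simp
  have hL1 : ∀ f : Space → ℝ, Integrable f →
      Tendsto (fun k => ∫ p, |(tail (η k)).indicator f p - f p|) atTop (𝓝 0) := fun f hf => by
    have h1 := tendsto_integral_of_dominated_convergence (μ := (volume : Measure Space))
      (F := fun k p => |(tail (η k)).indicator f p - f p|) (f := fun _ => (0 : ℝ))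
      (fun p => |f p|)
      (fun k => ((hf.indicator (measurableSet_tail (η k))).sub hf).abs.1) hf.abs
      (fun k => ae_of_all _ fun p => by
        by_cases hp : p ∈ tail (η k) <;> simp [hp])
      (h0.mono fun p hp => tendsto_const_nhds.congr' ((hev p hp).mono fun k hk => by
        simp [Set.indicator_of_mem hk]))
    simpa using h1
  have hmin : energyMin v μ g a (t + (N - mass g)) ≤ I := by
    refine h.kernel.energyMin_le_of_tendsto (f := fun k => (tail (η k)).indicator g)
      (g := fun k => (tail (η k)).indicator a)
      (l := fun k => I + err (η k)) (fun k => hs.indicator (measurableSet_tail _)) hs ?_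
      (hL1 g hs.integrable) (hL1 a hs.integrable') ?_ (by simpa using herr.const_add I)
      (fun k => hcut _ (hη0 k))
    · filter_upwards [h0] with p hp
      exact tendsto_const_nhds.congr' ((hev p hp).mono fun k hk =>
        (Set.indicator_of_mem hk g).symm)
    · exact ((Bogoliubov.tendsto_mass (fun k => hs.integrable.indicator (measurableSet_tail _))
        hs.integrable (hL1 g hs.integrable)).const_sub N).const_add t
  obtain ⟨β, hβ, he⟩ := hs.exists_energy_eq_energyMin v μ (t + (N - mass g))
  refine ⟨g, β, _, hβ, ?_, he.le.trans hmin⟩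
  have := h.mass_limγ_le
  have := h.t_pos
  linarith

end IsConvSeq

theorem IsKernel.exists_energy_le {v : Space → ℝ} {M : ℝ} (hv : IsKernel v M) (μ : ℝ) :
    ∃ I : ℝ, (∀ R γ α s, IsTest R γ α → 0 ≤ s → I ≤ energy v μ γ α s) ∧
      ∃ γ α s, IsState γ α ∧ 0 ≤ s ∧ energy v μ γ α s ≤ I := by
  obtain ⟨I, t, ht, hI, R, ε, γ, α, h⟩ := hv.exists_isApproxSeq μ
  refine ⟨I, hI, ?_⟩
  rcases ht.eq_or_lt with rfl | ht
  -- At t = 0 the coupling to the condensate disappears and the other terms beyond those in the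
  -- total density are nonnegative, so a pure condensate of the limiting density is at least as
  -- good.
  · obtain ⟨C, _, -, -, hb⟩ := h.bounds hv le_rfl
    have hst := fun n => (h.test n).isState
    obtain ⟨ρ, hρ, φ, hφ, hlim⟩ := (isCompact_Icc (a := (0 : ℝ)) (b := C)).tendsto_subseq
      (x := fun n => mass (γ n)) (fun n => ⟨mass_nonneg (hst n).nonneg, by linarith [(hb n).1]⟩)
    refine ⟨fun _ => 0, fun _ => 0, ρ, (isTest_zero 0).isState, hρ.1, ?_⟩
    rw [energy_zero]
    refine le_of_tendsto_of_tendsto' ((hlim.const_mul (-μ)).add ((hlim.pow 2).const_mul (v 0 / 2)))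
      (h.tendsto_energy.comp hφ.tendsto_atTop) fun n => ?_
    have h1 := hv.dbl_self_nonneg (hst (φ n)).integrable
    have h2 := hv.dbl_self_nonneg (hst (φ n)).integrable'
    have h3 := kin_nonneg (hst (φ n)).nonneg
    simp only [Function.comp_apply, energy]
    linarith
  · obtain ⟨R, ε, γ, α, N, C, r₀, G, H, h'⟩ := h.exists_isConvSeq hv ht hI
    exact h'.exists_energy_le

/-! ### Approximation of arbitrary elements of the domain -/

theorem Feasible.abs_mul_le {g a g' a' : ℝ} (h : Feasible g a) (h' : Feasible g' a') :
    |a * a' + g * g'| ≤ 2 * (g * g') + g + g' := by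
  have h1 := h.two_mul_le h'
  have h2 := mul_nonneg h.1 h'.1
  refine (abs_add_le _ _).trans ?_
  rw [abs_of_nonneg h2]
  linarith [h.1, h'.1]

theorem integrable_of_integrable_one_add_sq {γ : Space → ℝ}
    (h : Integrable fun p : Space => (1 + ‖p‖ ^ 2) * γ p) :
    Integrable γ ∧ Integrable fun p : Space => ‖p‖ ^ 2 * γ p := by
  have h1 : Integrable fun p : Space => (1 + ‖p‖ ^ 2)⁻¹ * ((1 + ‖p‖ ^ 2) * γ p) := by
    refine h.bdd_mul (c := 1) ?_ (ae_of_all _ fun p => ?_)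
    · refine (Continuous.inv₀ (by fun_prop) fun p => ?_).aestronglyMeasurable
      positivity
    · rw [norm_inv, Real.norm_eq_abs, abs_of_pos (by positivity)]
      exact inv_le_one_of_one_le₀ (by nlinarith [sq_nonneg ‖p‖])
  have h2 : Integrable γ := h1.congr (ae_of_all _ fun p => by
    have : (1 + ‖p‖ ^ 2) ≠ 0 := by positivity
    simp only
    field_simp)
  refine ⟨h2, (h.sub h2).congr (ae_of_all _ fun p => ?_)⟩
  simp only [Pi.sub_apply]
  ring

theorem IsState.mem_domain {γ α : Space → ℝ} {s : ℝ} (h : IsState γ α) (hs : 0 ≤ s) :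
    (γ, α, s) ∈ domain := by
  refine ⟨?_, h.integrable'.1, h.nonneg, h.feasible.mono fun p hp => hp.2, hs⟩
  refine (h.integrable.add h.kin_integrable).congr (ae_of_all _ fun p => ?_)
  simp only [Pi.add_apply]
  ring

/-- The energy of an arbitrary element of the domain is a limit of energies of bounded pairs
of bounded support. -/
theorem exists_isTest_tendsto_freeEnergy {V : Space → ℝ} {M : ℝ} (hv : IsKernel (Vhat V) M)
    (μ : ℝ) {γ α : Space → ℝ} {s : ℝ} (hx : (γ, α, s) ∈ domain) :
    ∃ g a : ℕ → Space → ℝ, (∀ k : ℕ, IsTest k (g k) (a k)) ∧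
      Tendsto (fun k => freeEnergy V 0 μ (g k, a k, s)) atTop
        (𝓝 (freeEnergy V 0 μ (γ, α, s))) := by
  obtain ⟨hint, hαm, hγ0, hαγ, -⟩ := hx
  obtain ⟨hγ, hγ2⟩ := integrable_of_integrable_one_add_sq hint
  have hfeas : ∀ᵐ p, Feasible (γ p) (α p) := by
    filter_upwards [hγ0, hαγ] with p h1 h2
    exact ⟨h1, h2⟩
  -- Cutting off the values of γ along with p makes the pair bounded, hence square integrable on S
  -- k; the measurable representative of γ makes S k measurable.
  let S : ℕ → Set Space := fun k => {p | ‖p‖ ≤ k ∧ hγ.1.mk γ p ≤ k}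
  have hS : ∀ k, MeasurableSet (S k) := fun k =>
    (measurableSet_le measurable_norm measurable_const).inter
      (measurableSet_le hγ.1.stronglyMeasurable_mk.measurable measurable_const)
  have hev : ∀ p, ∀ᶠ k in atTop, p ∈ S k := fun p => by
    filter_upwards [tendsto_natCast_atTop_atTop.eventually_ge_atTop ‖p‖,
      tendsto_natCast_atTop_atTop.eventually_ge_atTop (hγ.1.mk γ p)] with k h1 h2
    exact ⟨h1, h2⟩
  have hSball : ∀ k, S k ⊆ Metric.closedBall 0 k := fun k p hp => by simpa using hp.1
  have hSf : ∀ k, volume (S k) ≠ ⊤ := fun k =>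
    ((measure_mono (hSball k)).trans_lt measure_closedBall_lt_top).ne
  have hlimS : ∀ (f : Space → ℝ) p, Tendsto (fun k => (S k).indicator f p) atTop (𝓝 (f p)) :=
    fun f p => tendsto_const_nhds.congr' ((hev p).mono fun k hk =>
      (Set.indicator_of_mem hk f).symm)
  have habs : ∀ (f : Space → ℝ) k p, |(S k).indicator f p| ≤ |f p| := fun f k p => by
    by_cases hp : p ∈ S k <;> simp [hp]
  have hmem : ∀ (f : Space → ℝ) k, AEStronglyMeasurable f volume →
      (∀ᵐ p, |f p| ≤ γ p + 1 / 2) → MemLp ((S k).indicator f) 2 := fun f k hf hb => by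
    rw [memLp_indicator_iff_restrict (hS k)]
    have : IsFiniteMeasure (volume.restrict (S k)) :=
      ⟨by simpa using (hSf k).lt_top⟩
    refine MemLp.of_bound hf.restrict (k + 1 / 2 : ℝ) ?_
    rw [ae_restrict_iff' (hS k)]
    filter_upwards [hb, hγ.1.ae_eq_mk] with p h1 h2 h3
    rw [Real.norm_eq_abs]
    refine h1.trans (add_le_add_left ?_ _)
    rw [h2]
    exact h3.2
  have htest : ∀ k : ℕ, IsTest k ((S k).indicator γ) ((S k).indicator α) := fun k => by
    refine ⟨hmem γ k hγ.1 ?_, hmem α k hαm ?_, ae_of_all _ fun p hp => ?_, ?_⟩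
    · filter_upwards [hγ0] with p hp
      rw [abs_of_nonneg hp]; linarith
    · exact hfeas.mono fun p hp => hp.abs_le
    · have : p ∉ S k := fun hpS => absurd hpS.1 (not_le.2 hp)
      exact ⟨Set.indicator_of_notMem this _, Set.indicator_of_notMem this _⟩
    · filter_upwards [hfeas] with p hp
      by_cases hpS : p ∈ S k
      · simpa only [Set.indicator_of_mem hpS] using hp
      · simpa only [Set.indicator_of_notMem hpS] using feasible_zero
  refine ⟨_, _, htest, ?_⟩
  have t1 : Tendsto (fun k => ∫ p, (S k).indicator γ p) atTop (𝓝 (∫ p, γ p)) :=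
    tendsto_integral_of_dominated_convergence (fun p => |γ p|)
      (fun k => (hγ.indicator (hS k)).1) hγ.abs (fun k => ae_of_all _ fun p => habs γ k p)
      (ae_of_all _ fun p => hlimS γ p)
  have t2 : Tendsto (fun k => ∫ p : Space, ‖p‖ ^ 2 * (S k).indicator γ p) atTop
      (𝓝 (∫ p : Space, ‖p‖ ^ 2 * γ p)) :=
    tendsto_integral_of_dominated_convergence (fun p => |‖p‖ ^ 2 * γ p|)
      (fun k => (integrable_norm_sq_mul_indicator (hS k) hγ2).1) hγ2.abs
      (fun k => ae_of_all _ fun p => by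
        rw [Real.norm_eq_abs, abs_mul, abs_mul]
        exact mul_le_mul_of_nonneg_left (habs γ k p) (abs_nonneg _))
      (ae_of_all _ fun p => (hlimS γ p).const_mul _)
  have t3 : Tendsto (fun k => ∫ p, Vhat V p * ((S k).indicator γ p + (S k).indicator α p)) atTop
      (𝓝 (∫ p, Vhat V p * (γ p + α p))) := by
    refine tendsto_integral_of_dominated_convergence
      (fun p => 2 * (Vhat V p * γ p) + 1 / 2 * Vhat V p)
      (fun k => hv.continuous.aestronglyMeasurable.mul
        ((hγ.1.indicator (hS k)).add (hαm.indicator (hS k))))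
      (((hv.integrable_mul hγ).const_mul 2).add (hv.integrable.const_mul (1 / 2))) (fun k => ?_)
      (ae_of_all _ fun p => ((hlimS γ p).add (hlimS α p)).const_mul _)
    filter_upwards [hfeas] with p hp
    rw [Real.norm_eq_abs, abs_mul, abs_of_nonneg (hv.nonneg p)]
    have h1 := habs γ k p
    have h2 := habs α k p
    rw [abs_of_nonneg hp.1] at h1
    have h3 : |(S k).indicator γ p + (S k).indicator α p| ≤ 2 * γ p + 1 / 2 :=
      (abs_add_le _ _).trans (by linarith [hp.abs_le])
    have h4 := mul_le_mul_of_nonneg_left h3 (hv.nonneg p)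
    linarith
  have t4 : Tendsto (fun k => ∫ z : Space × Space, Vhat V (z.1 - z.2)
      * ((S k).indicator α z.1 * (S k).indicator α z.2
        + (S k).indicator γ z.1 * (S k).indicator γ z.2)) atTop
      (𝓝 (∫ z : Space × Space, Vhat V (z.1 - z.2) * (α z.1 * α z.2 + γ z.1 * γ z.2))) := by
    -- α need not be integrable; the pair integrand is dominated by v(p - q) (2 γ(p) γ(q) + γ(p) +
    -- γ(q)), whose terms linear in γ are integrable because v is.
    have j1 : Integrable (fun z : Space × Space => γ z.2 * Vhat V (z.1 - z.2))
        (volume.prod volume) :=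
      hγ.convolution_integrand (ContinuousLinearMap.mul ℝ ℝ) hv.integrable
    have j2 : Integrable (fun z : Space × Space => γ z.1 * Vhat V (z.1 - z.2))
        (volume.prod volume) :=
      j1.swap.congr (ae_of_all _ fun z => by
        simp only [Function.comp_apply, Prod.fst_swap, Prod.snd_swap]
        rw [hv.sub_comm])
    have hmeas : ∀ {f : Space → ℝ}, AEStronglyMeasurable f volume →
        AEStronglyMeasurable (fun z : Space × Space => f z.1 * f z.2) (volume.prod volume) :=
      fun hf => hf.comp_fst.mul hf.comp_snd
    refine tendsto_integral_of_dominated_convergence (μ := volume.prod volume)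
      (fun z : Space × Space => 2 * (Vhat V (z.1 - z.2) * (γ z.1 * γ z.2))
        + γ z.1 * Vhat V (z.1 - z.2) + γ z.2 * Vhat V (z.1 - z.2))
      (fun k => ?_) ((((hv.integrable_dbl hγ hγ).const_mul 2).add j2).add j1) (fun k => ?_)
      (ae_of_all _ fun z => (((hlimS α z.1).mul (hlimS α z.2)).add
        ((hlimS γ z.1).mul (hlimS γ z.2))).const_mul _)
    · exact (hv.continuous.comp (by fun_prop : Continuous fun z : Space × Space =>
        z.1 - z.2)).aestronglyMeasurable.mul
          ((hmeas (hαm.indicator (hS k))).add (hmeas (hγ.1.indicator (hS k))))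
    · filter_upwards [Measure.quasiMeasurePreserving_fst.ae hfeas,
        Measure.quasiMeasurePreserving_snd.ae hfeas] with z h1 h2
      rw [Real.norm_eq_abs, abs_mul, abs_of_nonneg (hv.nonneg _)]
      have h3 : |(S k).indicator α z.1 * (S k).indicator α z.2
          + (S k).indicator γ z.1 * (S k).indicator γ z.2|
          ≤ 2 * (γ z.1 * γ z.2) + γ z.1 + γ z.2 := by
        by_cases hz : z.1 ∈ S k ∧ z.2 ∈ S k
        · rw [Set.indicator_of_mem hz.1, Set.indicator_of_mem hz.2, Set.indicator_of_mem hz.1,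
            Set.indicator_of_mem hz.2]
          exact h1.abs_mul_le h2
        · have h4 : 0 ≤ 2 * (γ z.1 * γ z.2) + γ z.1 + γ z.2 := by
            have := h1.1
            have := h2.1
            positivity
          rcases not_and_or.1 hz with hz | hz <;> simpa [Set.indicator_of_notMem hz] using h4
      have h4 := mul_le_mul_of_nonneg_left h3 (hv.nonneg (z.1 - z.2))
      linarith
  have td := (t1.const_mul c₃).const_add s
  -- The constant zero stands for the entropy term at T = 0.
  have := (((((t2.const_mul c₃).sub (td.const_mul μ)).sub
    (tendsto_const_nhds (x := (0 : ℝ)))).add ((td.pow 2).const_mul (Vhat V 0 / 2))).add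
      (t4.const_mul (1 / 2 * c₃ ^ 2))).add ((t3.const_mul c₃).const_mul s)
  simp only [freeEnergy, zero_mul]
  exact this

end Bogoliubov

end

theorem theorem2p2 (V : Bogoliubov.Space → ℝ) (hV : Bogoliubov.IsInteraction V)
    (hC3 : ContDiff ℝ 3 (Bogoliubov.Vhat V))
    (hbdd : ∀ k : ℕ, k ≤ 3 →
      ∃ C : ℝ, ∀ p, ‖iteratedFDeriv ℝ k (Bogoliubov.Vhat V) p‖ ≤ C)
    (μ : ℝ) :
    ∃ x ∈ Bogoliubov.domain,
      IsMinOn (Bogoliubov.freeEnergy V 0 μ) Bogoliubov.domain x := by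
  obtain ⟨M, hv⟩ := hV.isKernel (hC3.of_le (by norm_num)) (hbdd 2 (by norm_num))
  obtain ⟨I, hI, γ, α, s, hs, hs0, hle⟩ := hv.exists_energy_le μ
  refine ⟨(γ, α, s), hs.mem_domain hs0, ?_⟩
  rintro ⟨γ', α', s'⟩ hx
  obtain ⟨g, a, ht, hlim⟩ := Bogoliubov.exists_isTest_tendsto_freeEnergy hv μ hx
  -- I bounds the energy of every test pair from below, hence also the limits of such energies,
  -- which exhaust the values on the domain.
  refine le_trans (b := I) ?_ (ge_of_tendsto' hlim fun k => ?_)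
  · rw [Bogoliubov.freeEnergy_eq_energy hv hs.integrable hs.integrable']
    exact hle
  · rw [Bogoliubov.freeEnergy_eq_energy hv (ht k).isState.integrable (ht k).isState.integrable']
    exact hI _ _ _ _ (ht k) hx.2.2.2.2
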